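/- **Model.** Fix numbers $K\ge 1$ of topics and $V\ge 1$ of event types, a probability vector $p^0$ on $\{1,\dots,K\}$, numbers $r^{k'}_k>0$, $a,d>0$, a compact set $\Theta_c$ of $K\times K$ transition matrices which has positive measure, a compact set $C\subset(0,\infty)$ of positive Lebesgue measure, a probability law $\nu_0$ on $(0,\infty)$, and a probability density $f_\tau$ with bounded support in $(0,\infty)$ and $\int |f_\tau\log f_\tau|<\infty$. The prior of $\Lambda=(\lambda^{k'}_k)$ is $\prod_{k'}\mathrm{Dir}(r^{k'})$ restricted to $\Theta_c$ and normalised, with density $p(\Lambda)$; the prior of $\xi$ is $\mathrm{Gamma}(a,d)$ (shape, rate) restricted to $C$ and normalised, with density $p(\xi)$. The parameter is $\eta=(B,G)$, where $B=(b_{k,e})$ is a $K\times V$ matrix with rows summing to one and $G=(g_{k',k})$ is a real $K\times K$ matrix. Its coordinates are $(b_{k,e})_{e<V}$ and $(g_{k',k})$, and all derivatives and vectors are taken in these coordinates. The parameter space is $\Theta=\{\eta: b_{k,e}\in[a',1-a'],\ g_{k',k}\in[g_{\min},g_{\max}]\}$ with $a'>0$. Under $\eta$, an individual has $\Lambda$,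 $\xi$ drawn from the priors, topics $z_1\sim p^0$, $z_n\mid z_{n-1}=k'\sim\lambda^{k'}$, events $e_n\mid z_n=k\sim b_k$, a first event time $t_1\sim\nu_0$, and gaps $t_n-t_{n-1}\sim\mathrm{Exp}(\xi e^{g_{z_{n-1},z_n}})$ for $n\ge2$; independently, $\tau\sim f_\tau$. One observes $Y=((e_n,t_n)_{n\le N},\tau)$, where $N$ is the number of events in $[0,\tau]$. Put $$p(z,\Lambda,\xi,Y\mid\eta)=p(\Lambda)\,p(\xi)\,p^0_{z_1}b_{z_1,e_1}\prod_{n=2}^N b_{z_n,e_n}\lambda^{z_{n-1}}_{z_n}\,\xi e^{g_{z_{n-1},z_n}}\exp\{-\xi e^{g_{z_{n-1},z_n}}(t_n-t_{n-1})\}$$ (the product over events being $1$ if $N=0$). Put $$f(Y\mid\eta)=\max_q\ \mathbb E_q\log\frac{p(z,\Lambda,\xi,Y\mid\eta)f_\tau(\tau)}{q(z,\Lambda,\xi)},\qquad q(z,\Lambda,\xi)=q(\xi)q(z)q(\Lambda),$$ where $q(\xi)$ is a $\mathrm{Gamma}(\tilde a,\tilde d)$ law restricted to $C$, $q(\Lambda)$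 is a product $\prod_k\mathrm{Dir}(\gamma^k)$ restricted to $\Theta_c$, both normalised, and $$q(z)\propto p^0_{z_1}b_{z_1,e_1}\prod_{n=2}^N b_{z_n,e_n}\,p^{z_{n-1}}_{z_n}\,\kappa e^{g_{z_{n-1},z_n}}\exp\{-\kappa e^{g_{z_{n-1},z_n}}(t_n-t_{n-1})\},$$ with all the parameters $\tilde a,\tilde d,\gamma^k_j,\kappa,p^{k'}_k$ ranging over $(0,\infty)$. **Theorem.** Let $\eta^*\in\Theta$ be the true parameter, $Y_1,Y_2,\dots$ i.i.d. with the law of $Y$ under $\eta^*$, and $EL(\eta)=\mathbb E_{\eta^*}f(Y\mid\eta)$. Let $\breve\eta=\breve\eta(\tau)$ be a maximizer of $EL$ over $\Theta$ that lies in the interior of $\Theta$, and put $$A_1=\frac{\partial^2}{\partial\eta^2}\,\mathbb E_{\eta^*} f(Y\mid\eta)\Big|_{\breve\eta},\qquad A_2=\mathbb E_{\eta^*}\Big[\frac{\partial f(Y\mid\eta)}{\partial\eta}\Big|_{\breve\eta}\Big(\frac{\partial f(Y\mid\eta)}{\partial\eta}\Big|_{\breve\eta}\Big)^{T}\Big].$$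 (i) If on some neighbourhood of $\breve\eta$ the function $f(Y\mid\cdot)$ is almost surely twice continuously differentiable with second derivatives dominated by an integrable function of $Y$, then $EL$ is twice continuously differentiable near $\breve\eta$ and $A_1=\mathbb E_{\eta^*}\frac{\partial^2 f(Y\mid\eta)}{\partial\eta^2}\big|_{\breve\eta}$. (ii) Suppose that $EL$ is twice continuously differentiable near $\breve\eta$ and that $A_1$ and $A_2$ have full rank. Then $f(Y\mid\cdot)$ is almost surely differentiable at $\breve\eta$, and $\breve\eta$ is the only maximizer of $EL$ over some compact neighbourhood $U\subseteq\Theta$ of $\breve\eta$. For every such $U$ (in particular $U=\Theta$ if $\breve\eta$ is the only maximizer over $\Theta$) there is a measurable estimator $\hat\eta_m=(\hat B,\hat G)$ that maximizes the sample ELBO $\sum_{i=1}^m f(Y_i\mid\eta)$ over $\eta\in U$, and every sequence of such estimators is consistent for $\breve\eta$, that is $\hat\eta_m\to\breve\eta$ in probability, and satisfies $$\sqrt m\,(\hat\eta_m-\breve\eta)\rightsquigarrow N(0,\ A_1^{-1}A_2A_1^{-1})\qquad(m\to\infty).$$ (The limit $\breve\eta$ need not be the true parameter $\eta^*$.) 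-/

import Mathlib

open MeasureTheory ProbabilityTheory Filter Topology

noncomputable section

namespace LTA

/-! Latent topic model with Markovian transitions, with `K` topics and `W + 1` event types. -/

/-- Index set of the free coordinates of `η = (B, G)`: the entries `b_{k,v}` with `v` not the last
event type (each row of `B` sums to one) and all the entries `g_{k',k}`. -/
abbrev Idx (K W : ℕ) : Type := (Fin K × Fin W) ⊕ (Fin K × Fin K)

/-- The parameter `η = (B, G)` in its free coordinates. -/
abbrev Param (K W : ℕ) : Type := EuclideanSpace ℝ (Idx K W)

/-- The topic-to-event matrix `B`; its last column is one minus the sum of the others. -/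
def bMat {K W : ℕ} (η : Param K W) (k : Fin K) : Fin (W + 1) → ℝ :=
  Fin.snoc (α := fun _ => ℝ) (fun v : Fin W => η (Sum.inl (k, v)))
    (1 - ∑ v : Fin W, η (Sum.inl (k, v)))

/-- The topic-transition intensity matrix `G`: `gMat η k' k = g_{k',k}`. -/
def gMat {K W : ℕ} (η : Param K W) (k' k : Fin K) : ℝ := η (Sum.inr (k', k))

/-- The compact parameter space: `b_{k,e} ∈ [β, 1 - β]` and `g_{k',k} ∈ [gmin, gmax]`. -/
def paramSpace (K W : ℕ) (β gmin gmax : ℝ) : Set (Param K W) :=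
  {η | (∀ k e, bMat η k e ∈ Set.Icc β (1 - β)) ∧ ∀ k' k, gMat η k' k ∈ Set.Icc gmin gmax}

/-- The data recorded for one individual: the number `N` of events, the pairs
(event type, event time) in order, and the termination time `τ`. -/
abbrev Obs (W : ℕ) : Type := (Σ N : ℕ, Fin N → Fin (W + 1) × ℝ) × ℝ

/-- The uniform distribution on the probability simplex of `ℝ^K`, i.e. `Dir(1, …, 1)`, as the law
of `(x_1, …, x_K) / (x_1 + … + x_K)` for independent standard exponential variables. -/
def uniformSimplex (K : ℕ) : Measure (Fin K → ℝ) :=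
  (Measure.pi fun _ : Fin K => expMeasure 1).map fun x k => x k / ∑ j, x j

/-- The uniform distribution on `K × K` transition matrices, with independent rows. -/
def uniformRows (K : ℕ) : Measure (Fin K → Fin K → ℝ) :=
  Measure.pi fun _ : Fin K => uniformSimplex K

/-- The fixed components of the model: the initial law `p⁰` of the topics, the Dirichlet parameters
`r`, the gamma parameters `a`, `d` (shape and rate), the sets to which the Dirichlet prior of `Λ`
and the gamma prior of `ξ` are restricted, the baseline law of the time of the first event, and the
density of the termination time. -/
structure Model (K : ℕ) where
  p0 : Fin K → ℝ
  p0_mem : p0 ∈ stdSimplex ℝ (Fin K)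
  r : Fin K → Fin K → ℝ
  r_pos : ∀ k' k, 0 < r k' k
  a : ℝ
  a_pos : 0 < a
  d : ℝ
  d_pos : 0 < d
  suppΛ : Set (Fin K → Fin K → ℝ)
  suppΛ_meas : MeasurableSet suppΛ
  suppΛ_pos : 0 < uniformRows K suppΛ
  suppξ : Set ℝ
  suppξ_meas : MeasurableSet suppξ
  suppξ_sub : suppξ ⊆ Set.Ioi 0
  suppξ_pos : 0 < volume suppξ
  firstTime : Measure ℝ
  firstTime_prob : IsProbabilityMeasure firstTime
  firstTime_pos : ∀ᵐ s ∂firstTime, 0 < s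
  fτ : ℝ → ℝ
  fτ_meas : Measurable fτ
  fτ_nonneg : ∀ s, 0 ≤ fτ s
  fτ_mass : ∫⁻ s, ENNReal.ofReal (fτ s) = 1
  fτ_bdd : ∃ T : ℝ, ∀ s, fτ s ≠ 0 → 0 < s ∧ s ≤ T
  fτ_log : Integrable fun s => fτ s * Real.log (fτ s)

/-- The priors of the individual effects have compact support: that of `Λ` inside the product of
the probability simplices, that of `ξ` inside `(0, ∞)`. -/
def Model.CompactSupport {K : ℕ} (M : Model K) : Prop :=
  (IsCompact M.suppΛ ∧ M.suppΛ ⊆ {Λ | ∀ k, Λ k ∈ stdSimplex ℝ (Fin K)}) ∧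
    (IsCompact M.suppξ ∧ M.suppξ ⊆ Set.Ioi 0)

section Densities

variable {K : ℕ} (M : Model K)

/-- Unnormalised density of `∏ₖ Dir(γᵏ)` with respect to `uniformRows K`. -/
def dirKernel (γ Λ : Fin K → Fin K → ℝ) : ℝ := ∏ k', ∏ k, Λ k' k ^ (γ k' k - 1)

/-- Density, on `M.suppΛ` and with respect to `uniformRows K`, of the product of the Dirichlet laws
with parameters `γᵏ`, restricted to `M.suppΛ` and normalised. -/
def Model.dirDens (γ Λ : Fin K → Fin K → ℝ) : ℝ :=
  dirKernel γ Λ / ∫ Λ' in M.suppΛ, dirKernel γ Λ' ∂(uniformRows K)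

/-- The law with density `M.dirDens γ`. -/
def Model.dirLaw (γ : Fin K → Fin K → ℝ) : Measure (Fin K → Fin K → ℝ) :=
  ((uniformRows K).restrict M.suppΛ).withDensity fun Λ => ENNReal.ofReal (M.dirDens γ Λ)

/-- Unnormalised density of the gamma law with shape `s` and rate `c`. -/
def gamKernel (s c x : ℝ) : ℝ := x ^ (s - 1) * Real.exp (-(c * x))

/-- Lebesgue density, on `M.suppξ`, of the gamma law with shape `s` and rate `c`, restricted to
`M.suppξ` and normalised. -/
def Model.gamDens (s c x : ℝ) : ℝ :=
  gamKernel s c x / ∫ x' in M.suppξ, gamKernel s c x'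

/-- The law with density `M.gamDens s c`. -/
def Model.gamLaw (s c : ℝ) : Measure ℝ :=
  (volume.restrict M.suppξ).withDensity fun x => ENNReal.ofReal (M.gamDens s c x)

end Densities

section TrueLaw

variable {K W : ℕ} [NeZero K] (M : Model K)

/-- Inverse-cdf sampling: for `u` uniform on `[0, 1]` and `p` a probability vector, `sample p u`
has law `p`. -/
def sample {n : ℕ} [NeZero n] (p : Fin n → ℝ) (u : ℝ) : Fin n :=
  if h : (Finset.univ.filter fun k => u < ∑ j ∈ Finset.Iic k, p j).Nonempty then
    (Finset.univ.filter fun k => u < ∑ j ∈ Finset.Iic k, p j).min' h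
  else 0

/-- All the randomness of one individual: `Λ`, `ξ`, the termination time, the time of the first
event, and for each `n` two uniform variables and a standard exponential one. -/
abbrev Noise (K : ℕ) : Type :=
  (Fin K → Fin K → ℝ) × ℝ × ℝ × ℝ × (ℕ → unitInterval × unitInterval × ℝ)

/-- The joint law of the randomness of one individual; all the components are independent. -/
def Model.noise : Measure (Noise K) :=
  (M.dirLaw M.r).prod <| (M.gamLaw M.a M.d).prod <|
    (volume.withDensity fun s => ENNReal.ofReal (M.fτ s)).prod <| M.firstTime.prod <|
      Measure.infinitePi fun _ : ℕ =>
        (volume : Measure unitInterval).prod ((volume : Measure unitInterval).prod (expMeasure 1))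

/-- The Markov chain of topics: initial law `p⁰`, transition probabilities `Λ k' k = λ^{k'}_k`. -/
def Model.topic (Λ : Fin K → Fin K → ℝ) (u : ℕ → ℝ) : ℕ → Fin K
  | 0 => sample M.p0 (u 0)
  | n + 1 => sample (Λ (Model.topic Λ u n)) (u (n + 1))

/-- The event times: the gap after a transition `k' → k` is exponential with rate
`ξ exp(g_{k',k})`. -/
def eventTime (η : Param K W) (ξ t₀ : ℝ) (z : ℕ → Fin K) (w : ℕ → ℝ) : ℕ → ℝ
  | 0 => t₀
  | n + 1 => eventTime η ξ t₀ z w n + w (n + 1) / (ξ * Real.exp (gMat η (z n) (z (n + 1))))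

/-- What is observed up to time `τ` of the sequence of events `e n` at the increasing times `t n`:
the number of events is the first index `n` with `t n > τ`. -/
def observe (e : ℕ → Fin (W + 1)) (t : ℕ → ℝ) (τ : ℝ) : Obs W :=
  (⟨sInf {n | τ < t n}, fun i => (e i, t i)⟩, τ)

/-- The observation of an individual under the parameter `η`, as a function of the noise. -/
def Model.generate (η : Param K W) (x : Noise K) : Obs W :=
  let Λ := x.1
  let ξ := x.2.1
  let τ := x.2.2.1
  let t₀ := x.2.2.2.1
  let ω := x.2.2.2.2
  let z := M.topic Λ fun n => ((ω n).1 : ℝ)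
  observe (fun n => sample (bMat η (z n)) ((ω n).2.1 : ℝ))
    (eventTime η ξ t₀ z fun n => (ω n).2.2) τ

/-- The law of the observation `Y` of one individual under the parameter `η`. -/
def Model.law (η : Param K W) : Measure (Obs W) := M.noise.map (M.generate η)

end TrueLaw

section ELBO

variable {K W : ℕ} (M : Model K)

/-- The predecessor of an index (for the index `0`, the index itself). -/
def pre {N : ℕ} (n : Fin N) : Fin N := ⟨n.1 - 1, lt_of_le_of_lt (Nat.sub_le _ _) n.2⟩

/-- The gap between the event of index `n` and its predecessor. -/
def gap (y : Obs W) (n : Fin y.1.1) : ℝ := (y.1.2 n).2 - (y.1.2 (pre n)).2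

/-- The density `p(z, Λ, ξ, e_{1:N}, t_{1:N} | η)`. -/
def Model.joint (y : Obs W) (η : Param K W) (z : Fin y.1.1 → Fin K)
    (Λ : Fin K → Fin K → ℝ) (ξ : ℝ) : ℝ :=
  (∏ n, bMat η (z n) (y.1.2 n).1 *
      if n.1 = 0 then M.p0 (z n)
      else Λ (z (pre n)) (z n) * (ξ * Real.exp (gMat η (z (pre n)) (z n)) *
        Real.exp (-(ξ * Real.exp (gMat η (z (pre n)) (z n)) * gap y n)))) *
    M.dirDens M.r Λ * M.gamDens M.a M.d ξ

/-- The parameters of a member of the variational family: gamma parameters `ã`, `d̃`, Dirichlet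
parameters `γ`, and the weights `p` and the rate `κ` of the law of the topics. -/
structure VarParam (K : ℕ) where
  aT : ℝ
  aT_pos : 0 < aT
  dT : ℝ
  dT_pos : 0 < dT
  γ : Fin K → Fin K → ℝ
  γ_pos : ∀ k' k, 0 < γ k' k
  p : Fin K → Fin K → ℝ
  p_pos : ∀ k' k, 0 < p k' k
  κ : ℝ
  κ_pos : 0 < κ

/-- Unnormalised variational probability `q(z | p, κ)` of a sequence of topics. -/
def Model.qzWeight (y : Obs W) (η : Param K W) (q : VarParam K) (z : Fin y.1.1 → Fin K) : ℝ :=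
  ∏ n, bMat η (z n) (y.1.2 n).1 *
    if n.1 = 0 then M.p0 (z n)
    else q.κ * Real.exp (gMat η (z (pre n)) (z n)) *
      Real.exp (-(gap y n * (q.κ * Real.exp (gMat η (z (pre n)) (z n))))) * q.p (z (pre n)) (z n)

/-- The variational probability `q(z | p, κ)`. -/
def Model.qz (y : Obs W) (η : Param K W) (q : VarParam K) (z : Fin y.1.1 → Fin K) : ℝ :=
  M.qzWeight y η q z / ∑ z', M.qzWeight y η q z'

/-- The evidence lower bound `E_q log (p(z, Λ, ξ, y | η) f_τ(τ) / q(z, Λ, ξ))` of one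
individual, where `q(z, Λ, ξ) = q(ξ | ã, d̃) q(z | p, κ) ∏ₖ q(λᵏ | γᵏ)`. -/
def Model.elbo (y : Obs W) (η : Param K W) (q : VarParam K) : ℝ :=
  ∫ x, ∑ z, M.qz y η q z *
      Real.log (M.joint y η z x.1 x.2 * M.fτ y.2 /
        (M.gamDens q.aT q.dT x.2 * M.qz y η q z * M.dirDens q.γ x.1))
    ∂((M.dirLaw q.γ).prod (M.gamLaw q.aT q.dT))

/-- `f(y | η)`: the evidence lower bound maximised over the variational family. -/
def Model.f (y : Obs W) (η : Param K W) : ℝ := ⨆ q : VarParam K, M.elbo y η q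

/-- The evidence lower bound of a sample of size `m`, maximised over the variational laws. -/
def Model.sampleEL {m : ℕ} (y : Fin m → Obs W) (η : Param K W) : ℝ := ∑ i, M.f (y i) η

variable [NeZero K]

/-- The expected evidence lower bound `η ↦ E_{η*} f(Y | η)`. -/
def Model.EL (ηstar η : Param K W) : ℝ := ∫ y, M.f y η ∂(M.law ηstar)

end ELBO

section Sandwich

variable {K W : ℕ}

/-- The partial derivative `∂F/∂η_i`. -/
def partialD (F : Param K W → ℝ) (η : Param K W) (i : Idx K W) : ℝ :=
  fderiv ℝ F η (EuclideanSpace.single i 1)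

/-- The Hessian matrix of `F` at `η`. -/
def hess (F : Param K W → ℝ) (η : Param K W) : Matrix (Idx K W) (Idx K W) ℝ :=
  Matrix.of fun i j => partialD (fun η' => partialD F η' j) η i

variable [NeZero K] (M : Model K) (ηstar η : Param K W)

/-- The Hessian `∂²/∂η² E_{η*} f(Y | η)` of the expected evidence lower bound. -/
def Model.A₁ : Matrix (Idx K W) (Idx K W) ℝ := hess (M.EL ηstar) η

/-- The expected Hessian `E_{η*} ∂²f(Y | η)/∂η²`. -/
def Model.expectedHess : Matrix (Idx K W) (Idx K W) ℝ :=
  Matrix.of fun i j => ∫ y, hess (M.f y) η i j ∂(M.law ηstar)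

/-- The second moment `E_{η*} (∂f(Y | η)/∂η) (∂f(Y | η)/∂η)ᵀ` of the score. -/
def Model.A₂ : Matrix (Idx K W) (Idx K W) ℝ :=
  Matrix.of fun i j => ∫ y, partialD (M.f y) η i * partialD (M.f y) η j ∂(M.law ηstar)

/-- Regularity of `f`: near `η` the function `f(Y | ·)` is almost surely twice continuously
differentiable, with second derivatives dominated by an integrable function of `Y`. -/
def Model.SmoothDominated : Prop :=
  ∃ U ∈ 𝓝 η, ∃ h : Obs W → ℝ, Integrable h (M.law ηstar) ∧
    ∀ᵐ y ∂(M.law ηstar), ContDiffOn ℝ 2 (M.f y) U ∧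
      ∀ η' ∈ U, ∀ i j, |hess (M.f y) η' i j| ≤ h y

/-- Local identifiability: the expected evidence lower bound is twice continuously differentiable
near `η`, and both matrices of the sandwich are of full rank. -/
def Model.LocallyIdentifiable : Prop :=
  ContDiffAt ℝ 2 (M.EL ηstar) η ∧ IsUnit (M.A₁ ηstar η).det ∧ IsUnit (M.A₂ ηstar η).det

end Sandwich

end LTA

end

/-! The profiled bound f(y | η) is a supremum and need not be smooth in η, so an argument through
second derivatives of the sample criterion is not available. Semiconvexity takes its place.

For given laws of Λ and ξ, the best law of the topics among all laws is a Gibbs law, and it already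
has the form of q(z). Hence (`Model.f_eq`) f(y | η) is log f_τ(τ) plus the supremum over q of log
Σ_z w_q(z | η) - D(q). Here D(q) ≥ 0 is the divergence of q(Λ) q(ξ) from the prior, and w_q depends
on q only through E log λ + E log ξ and E ξ. The first quantity enters log w_q additively, and the
second stays in a compact subset of (0, ∞). So each log w_q is Lipschitz and semiconvex in η, with a
constant that does not depend on q and is proportional to the number of events plus the total gap
length. Both properties pass through log-sum-exp and through suprema (`SemiconvexLip.log_sum_exp`,
`SemiconvexLip.of_isLUB`). Rates and termination times are bounded, so an exponential-moment bound
gives that constant a second moment, and f is a `SemiconvexCriterion` under the true law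
(`Model.CompactSupport.exists_semiconvexCriterion`).

The rest concerns such criteria in general. Differentiability of the mean forces almost sure
differentiability of the criterion (`ae_differentiableAt`): on a line, the gap between right and
left derivatives is nonnegative and has mean zero. The gradient is dominated by L.

Semiconvexity also replaces uniform laws for empirical processes in the local analysis. At a point
of the convex hull of nearby net points, the criterion is at most its value at one of them plus ΣL/2
times the squared mesh (`exists_le_of_mem_convexHull`). Upper bounds near the maximiser are thus
needed at finitely many points only, and there Chebyshev's inequality suffices. Peeling over dyadic
shells gives the rate 1/√m. At that scale the criterion is, at each fixed v, close in probability to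
B(v, v)/2 - B(w, v), where B is the Hessian form of EL, negative definite by maximality and full
rank, and w = m^{-1/2} Σ H(Y_i) with H = -A₁⁻¹ ∇f. This quadratic is maximal at w, so √m (η̂ - η̆) =
w + o_P(1) (`tendsto_measure_norm_sub_sum_ge`). The central limit theorem and Slutsky's lemma then
give the sandwich covariance.

The formula for A₁ in the smooth case is differentiation under the integral, done twice, dominated
first by L and then by the given bound. -/

namespace LTA

/-! ### Semiconvex functions and finite nets. -/

section ConvexAnalysis

/-- A strongly convex (or, if `m < 0`, semiconvex) function minus the quadratic centred at any point
is convex. -/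
lemma StrongConvexOn.convexOn_sub_sq {E : Type*} [NormedAddCommGroup E] [InnerProductSpace ℝ E]
    {s : Set E} {m : ℝ} {f : E → ℝ} (hf : StrongConvexOn s m f) (u : E) :
    ConvexOn ℝ s fun x => f x - m / 2 * ‖x - u‖ ^ 2 := by
  -- Recentring changes the quadratic by an affine function: `f - m/2 ‖x - u‖²` is `f - m/2 ‖x‖²`
  -- plus `m ⟪u, x⟫ - m/2 ‖u‖²`.
  have h := (strongConvexOn_iff_convex.1 hf).add
    (((innerSL ℝ (m • u)).toLinearMap.convexOn hf.1).add (convexOn_const (-(m / 2) * ‖u‖ ^ 2) hf.1))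
  refine h.congr fun x _ => ?_
  have := norm_sub_sq_real x u
  simp only [Pi.add_apply, ContinuousLinearMap.coe_coe, innerSL_apply_apply, inner_smul_left,
    RCLike.conj_to_real]
  rw [real_inner_comm] at this
  rw [this]; ring

/-- A semiconvex function at a point of the convex hull of `F` is at most its value at some point
of `F`, up to the square of the distance. -/
lemma exists_le_of_mem_convexHull {E : Type*} [NormedAddCommGroup E] [InnerProductSpace ℝ E]
    {s F : Set E} {c ε : ℝ} {f : E → ℝ} (hf : StrongConvexOn s (-c) f) (hc : 0 ≤ c) (hF : F ⊆ s)
    {u : E} (hu : u ∈ convexHull ℝ F) (hε : ∀ v ∈ F, ‖v - u‖ ≤ ε) :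
    ∃ v ∈ F, f u ≤ f v + c / 2 * ε ^ 2 := by
  -- The convex function `f + c/2 ‖· - u‖²` agrees with `f` at `u`, and on a convex hull a convex
  -- function is at most its value at some generating point.
  obtain ⟨v, hv, h⟩ := (StrongConvexOn.convexOn_sub_sq hf u).exists_ge_of_mem_convexHull hF hu
  refine ⟨v, hv, ?_⟩
  simp only [sub_self, norm_zero] at h
  have : ‖v - u‖ ^ 2 ≤ ε ^ 2 := by gcongr; exact hε v hv
  nlinarith

/-- Compact sets are covered by the convex hulls of small sets of points of a finite set. -/
lemma exists_finset_convexHull {E : Type*} [NormedAddCommGroup E] [NormedSpace ℝ E]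
    [FiniteDimensional ℝ E] {C : Set E} (hC : IsCompact C) {ε : ℝ} (hε : 0 < ε) :
    ∃ G : Finset E, ∀ u ∈ C, u ∈ convexHull ℝ {v | v ∈ G ∧ ‖v - u‖ < ε} := by
  classical
  have key (x : E) : ∃ F : Finset E, ∃ V ∈ 𝓝 x, ∀ u ∈ V,
      u ∈ convexHull ℝ {v | v ∈ F ∧ ‖v - u‖ < ε} := by
    -- A simplex around `x` with vertices within `ε / 2` of `x`. Points of its interior within `ε /
    -- 2` of `x` lie in its hull, with every vertex closer than `ε`.
    obtain ⟨b, hb, hbs⟩ := exists_mem_interior_convexHull_affineBasis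
      (Metric.ball_mem_nhds x (half_pos hε))
    refine ⟨Finset.univ.image b, interior (convexHull ℝ (Set.range b)) ∩ Metric.ball x (ε / 2),
      Filter.inter_mem (isOpen_interior.mem_nhds hb) (Metric.ball_mem_nhds x (half_pos hε)),
      fun u hu => ?_⟩
    refine convexHull_mono ?_ (interior_subset hu.1)
    rintro v ⟨i, rfl⟩
    refine ⟨by simp, ?_⟩
    have h1 := hbs (subset_convexHull ℝ _ ⟨i, rfl⟩)
    have h2 := hu.2
    rw [Metric.mem_ball] at h1 h2
    rw [← dist_eq_norm]
    linarith [dist_triangle_right (b i) u x]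
  choose F V hV hFV using key
  obtain ⟨t, -, ht⟩ := hC.elim_nhds_subcover V fun x _ => hV x
  refine ⟨t.biUnion F, fun u hu => ?_⟩
  obtain ⟨x, hx, hux⟩ := Set.mem_iUnion₂.1 (ht hu)
  refine convexHull_mono ?_ (hFV x u hux)
  rintro v ⟨hv1, hv2⟩
  exact ⟨Finset.mem_biUnion.2 ⟨x, hx, hv1⟩, hv2⟩

variable {ι : Type*} [Fintype ι]

/-- A convex function with partial derivatives at a point is differentiable there. -/
lemma differentiableAt_of_convexOn [DecidableEq ι] {ψ : EuclideanSpace ℝ ι → ℝ}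
    {x : EuclideanSpace ℝ ι} {δ : ℝ}
    (hδ : 0 < δ) (hψ : ConvexOn ℝ (Metric.ball x δ) ψ)
    (hd : ∀ i, DifferentiableAt ℝ (fun t : ℝ => ψ (x + t • EuclideanSpace.single i (1 : ℝ))) 0) :
    DifferentiableAt ℝ ψ x := by
  cases isEmpty_or_nonempty ι
  · exact (hasFDerivAt_of_subsingleton ψ x).differentiableAt
  have hd' (i : ι) : ∃ p : ℝ,
      HasDerivAt (fun t : ℝ => ψ (x + t • EuclideanSpace.single i (1 : ℝ))) p 0 :=
    ⟨_, (hd i).hasDerivAt⟩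
  choose p hp using hd'
  set P : EuclideanSpace ℝ ι →L[ℝ] ℝ := ∑ i, p i • EuclideanSpace.proj i with hP
  set g : EuclideanSpace ℝ ι → ℝ := fun h => ψ (x + h) - ψ x - P h with hg
  have hPs (i : ι) (t : ℝ) : P (t • EuclideanSpace.single i (1 : ℝ)) = t * p i := by
    simp [hP]
  have hgc : ConvexOn ℝ (Metric.ball 0 δ) g := by
    have h1 : ConvexOn ℝ (Metric.ball (0 : EuclideanSpace ℝ ι) δ) fun h => ψ (x + h) := by
      have := hψ.translate_right x
      simpa [Function.comp_def, preimage_add_ball] using this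
    have h2 := (h1.add ((-P).toLinearMap.convexOn (convex_ball 0 δ))).add
      (convexOn_const (-ψ x) (convex_ball 0 δ))
    refine h2.congr fun h _ => ?_
    simp [hg]; ring
  have hg0 : g 0 = 0 := by simp [hg]
  have hcard : (0 : ℝ) < Fintype.card ι := by exact_mod_cast Fintype.card_pos
  refine HasFDerivAt.differentiableAt (f' := P) ?_
  rw [hasFDerivAt_iff_isLittleO_nhds_zero, Asymptotics.isLittleO_iff]
  intro c hc
  have hsmall (i : ι) : ∀ᶠ t : ℝ in 𝓝 0, ‖g (t • EuclideanSpace.single i (1 : ℝ))‖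
      ≤ c / Fintype.card ι * ‖t‖ := by
    have h := (hasDerivAt_iff_isLittleO_nhds_zero.1 (hp i))
    have := Asymptotics.isLittleO_iff.1 h (c := c / Fintype.card ι) (by positivity)
    filter_upwards [this] with t ht
    simpa [hg, hPs, smul_eq_mul] using ht
  obtain ⟨r, hr, hr'⟩ := Metric.eventually_nhds_iff_ball.1 (eventually_all.2 hsmall)
  -- `h` is the average of the vectors `card ι · h_i e_i`, so Jensen's inequality bounds `g h` by an
  -- average of values on the axes, where the partial derivatives make `g` small.
  have hup : ∀ h : EuclideanSpace ℝ ι, Fintype.card ι * ‖h‖ < min r δ → g h ≤ c * ‖h‖ := by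
    intro h hh
    have hcoord (i : ι) : |h i| ≤ ‖h‖ := by simpa using EuclideanSpace.norm_eq h ▸ PiLp.norm_apply_le h i
    set v : ι → EuclideanSpace ℝ ι :=
      fun i => (Fintype.card ι * h i) • EuclideanSpace.single i (1 : ℝ) with hv
    have hvn (i : ι) : |Fintype.card ι * h i| < min r δ := by
      rw [abs_mul, abs_of_pos hcard]
      exact (mul_le_mul_of_nonneg_left (hcoord i) hcard.le).trans_lt hh
    have hsum : ∑ i, (Fintype.card ι : ℝ)⁻¹ • v i = h := by
      ext j
      simp only [hv, smul_smul, WithLp.ofLp_sum, Finset.sum_apply, PiLp.smul_apply,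
        PiLp.single_apply, smul_eq_mul, mul_ite, mul_one, mul_zero, Finset.sum_ite_eq,
        Finset.mem_univ, if_true]
      field_simp
    have hJ := hgc.map_sum_le (t := Finset.univ) (w := fun _ => (Fintype.card ι : ℝ)⁻¹) (p := v)
      (fun i _ => by positivity) (by simp [hcard.ne']) (fun i _ => by
        simpa [hv, norm_smul, abs_mul] using (hvn i).trans_le (min_le_right _ _))
    rw [hsum] at hJ
    refine hJ.trans ?_
    calc ∑ i, (Fintype.card ι : ℝ)⁻¹ • g (v i)
        ≤ ∑ i : ι, (Fintype.card ι : ℝ)⁻¹ * (c * ‖h‖) := by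
          refine Finset.sum_le_sum fun i _ => ?_
          rw [smul_eq_mul]
          refine mul_le_mul_of_nonneg_left ?_ (by positivity)
          have h1 := hr' (Fintype.card ι * h i)
            (by simpa [abs_mul] using (hvn i).trans_le (min_le_left _ _)) i
          refine (le_abs_self _).trans (h1.trans ?_)
          rw [Real.norm_eq_abs, abs_mul, abs_of_pos hcard]
          have := hcoord i
          calc c / Fintype.card ι * (Fintype.card ι * |h i|) = c * |h i| := by field_simp
            _ ≤ c * ‖h‖ := by gcongr
      _ = c * ‖h‖ := by simp
  have hball : ∀ᶠ h : EuclideanSpace ℝ ι in 𝓝 0, Fintype.card ι * ‖h‖ < min r δ := by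
    have : Tendsto (fun h : EuclideanSpace ℝ ι => Fintype.card ι * ‖h‖) (𝓝 0) (𝓝 0) := by
      have : Continuous fun h : EuclideanSpace ℝ ι => (Fintype.card ι : ℝ) * ‖h‖ := by fun_prop
      simpa using this.tendsto 0
    exact this.eventually_lt_const (lt_min hr hδ)
  filter_upwards [hball] with h hh
  have h1 := hup h hh
  -- Convexity gives `0 = g 0 ≤ (g h + g (-h)) / 2`, so the upper bound at `-h` is a lower bound at
  -- `h`.
  have h2 := hup (-h) (by simpa using hh)
  rw [norm_neg] at h2
  have hcard1 : (1 : ℝ) ≤ Fintype.card ι := by exact_mod_cast Fintype.card_pos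
  have hhδ : ‖h‖ < δ := lt_of_le_of_lt (by nlinarith [norm_nonneg h]) (hh.trans_le (min_le_right _ _))
  have h3 := (And.right hgc) (show h ∈ Metric.ball 0 δ by simpa using hhδ)
    (show -h ∈ Metric.ball 0 δ by simpa using hhδ) (show (0 : ℝ) ≤ 1 / 2 by norm_num) (show (0 : ℝ) ≤ 1 / 2 by norm_num) (by norm_num)
  have h4 : (1 / 2 : ℝ) • h + (1 / 2 : ℝ) • -h = 0 := by simp
  rw [h4, hg0] at h3
  simp only [smul_eq_mul] at h3
  change ‖g h‖ ≤ _
  rw [Real.norm_eq_abs, abs_le]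
  constructor <;> linarith

end ConvexAnalysis

end LTA


/-! ### Semiconvex criterion functions: almost sure differentiability and the Taylor remainder. -/

namespace LTA

/-- A criterion function `f y η` which on the convex set `Θ` is Lipschitz and semiconvex in `η`,
with a square integrable constant `L y`. -/
structure SemiconvexCriterion {𝒴 E : Type*} [MeasurableSpace 𝒴] [NormedAddCommGroup E]
    [InnerProductSpace ℝ E] (μ : Measure 𝒴) (f : 𝒴 → E → ℝ) (Θ : Set E) (L : 𝒴 → ℝ) : Prop where
  measurable : ∀ η ∈ Θ, Measurable fun y => f y η
  integrable : ∀ η ∈ Θ, Integrable (fun y => f y η) μ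
  memLp : MemLp L 2 μ
  nonneg : ∀ y, 0 ≤ L y
  lip : ∀ y, ∀ η ∈ Θ, ∀ η' ∈ Θ, |f y η - f y η'| ≤ L y * ‖η - η'‖
  semiconvex : ∀ y, StrongConvexOn Θ (-L y) (f y)

namespace SemiconvexCriterion

section

variable {𝒴 E : Type*} [MeasurableSpace 𝒴] [NormedAddCommGroup E]
    [InnerProductSpace ℝ E] {μ : Measure 𝒴} {f : 𝒴 → E → ℝ} {Θ : Set E}
    {L : 𝒴 → ℝ} {η₀ : E}

lemma integrable_bound [IsProbabilityMeasure μ] (h : SemiconvexCriterion μ f Θ L) : Integrable L μ :=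
  h.memLp.integrable (by norm_num)

/-- On a line, a semiconvex function has one-sided derivatives, the left at most the right. Their
gap is a limit of differences of difference quotients dominated by a multiple of `L`, so its mean is
the corresponding gap for the expectation, which is zero. A nonnegative variable of mean zero
vanishes almost surely. -/
lemma ae_differentiableAt_line [IsProbabilityMeasure μ] (h : SemiconvexCriterion μ f Θ L) (h₀ : η₀ ∈ interior Θ)
    (hd : DifferentiableAt ℝ (fun η => ∫ y, f y η ∂μ) η₀) (e : E) :
    ∀ᵐ y ∂μ, DifferentiableAt ℝ (fun t : ℝ => f y (η₀ + t • e)) 0 := by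
  obtain ⟨δ, hδ, hδΘ⟩ := Metric.mem_nhds_iff.1 (mem_interior_iff_mem_nhds.1 h₀)
  set r := δ / (‖e‖ + 1) with hr
  have hr0 : 0 < r := by positivity
  have hmem (t : ℝ) (ht : t ∈ Set.Ioo (-r) r) : η₀ + t • e ∈ Θ := by
    apply hδΘ
    have h1 : |t| < r := abs_lt.2 ht
    simp only [mem_ball_iff_norm, add_sub_cancel_left, norm_smul, Real.norm_eq_abs]
    calc |t| * ‖e‖ ≤ |t| * (‖e‖ + 1) := by gcongr; linarith
      _ < r * (‖e‖ + 1) := by gcongr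
      _ = δ := by rw [hr]; field_simp
  set φ : 𝒴 → ℝ → ℝ := fun y t => f y (η₀ + t • e) + L y / 2 * (t ^ 2 * ‖e‖ ^ 2) with hφ
  have hφc (y : 𝒴) : ConvexOn ℝ (Set.Ioo (-r) r) (φ y) := by
    have h1 := (StrongConvexOn.convexOn_sub_sq (h.semiconvex y) η₀).comp_affineMap
      (AffineMap.lineMap η₀ (η₀ + e))
    refine (h1.subset (fun t ht => ?_) (convex_Ioo _ _)).congr fun t _ => ?_
    · simpa [AffineMap.lineMap_apply, add_comm] using hmem t ht
    · simp [hφ, AffineMap.lineMap_apply, add_comm _ η₀, norm_smul, mul_pow]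
      ring
  have h0i : (0 : ℝ) ∈ interior (Set.Ioo (-r) r) := by
    rw [interior_Ioo]; exact ⟨by linarith, hr0⟩
  set R : 𝒴 → ℝ := fun y => derivWithin (φ y) (Set.Ioi 0) 0 with hR
  set D : 𝒴 → ℝ := fun y => derivWithin (φ y) (Set.Iio 0) 0 with hD
  have hRd (y : 𝒴) : HasDerivWithinAt (φ y) (R y) (Set.Ioi 0) 0 :=
    (hφc y).hasDerivWithinAt_rightDeriv_of_mem_interior h0i
  have hDd (y : 𝒴) : HasDerivWithinAt (φ y) (D y) (Set.Iio 0) 0 :=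
    (hφc y).hasDerivWithinAt_leftDeriv_of_mem_interior h0i
  have hDR (y : 𝒴) : D y ≤ R y := (hφc y).leftDeriv_le_rightDeriv_of_mem_interior h0i
  -- The shift by `2` keeps `s n < r` at `n = 0` too.
  set s : ℕ → ℝ := fun n => r / (n + 2) with hs
  have hs0 (n : ℕ) : 0 < s n := by positivity
  have hsr (n : ℕ) : s n < r := by
    rw [hs, div_lt_iff₀ (by positivity)]
    nlinarith [(Nat.cast_nonneg n : (0 : ℝ) ≤ n)]
  have hst : Tendsto s atTop (𝓝 0) :=
    tendsto_const_nhds.div_atTop (tendsto_atTop_add_const_right _ _ tendsto_natCast_atTop_atTop)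
  have hsp (n : ℕ) : η₀ + s n • e ∈ Θ := hmem _ ⟨by linarith [hs0 n], hsr n⟩
  have hsm (n : ℕ) : η₀ + (-s n) • e ∈ Θ := hmem _ ⟨by linarith [hsr n], by linarith [hs0 n]⟩
  have h0m : η₀ ∈ Θ := interior_subset h₀
  set Q : ℕ → 𝒴 → ℝ := fun n y =>
    (f y (η₀ + s n • e) - f y η₀) / s n - (f y (η₀ + (-s n) • e) - f y η₀) / (-s n) with hQ
  have hstR : Tendsto s atTop (𝓝[>] 0) :=
    tendsto_nhdsWithin_iff.2 ⟨hst, Eventually.of_forall hs0⟩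
  have hstL : Tendsto (fun n => -s n) atTop (𝓝[<] 0) :=
    tendsto_nhdsWithin_iff.2 ⟨by simpa using hst.neg, Eventually.of_forall fun n => by
      simpa using hs0 n⟩
  have hQlim (y : 𝒴) : Tendsto (fun n => Q n y) atTop (𝓝 (R y - D y)) := by
    have h1 := ((hasDerivWithinAt_iff_tendsto_slope' (by simp)).1 (hRd y)).comp hstR
    have h2 := ((hasDerivWithinAt_iff_tendsto_slope' (by simp)).1 (hDd y)).comp hstL
    -- The convexifying term of `φ` contributes exactly `L y * s n * ‖e‖²` to the difference of the
    -- right and left slopes.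
    have h3 : Tendsto (fun n => L y * (s n * ‖e‖ ^ 2)) atTop (𝓝 0) := by
      simpa using (hst.mul_const (‖e‖ ^ 2)).const_mul (L y)
    have h4 := (h1.sub h2).sub h3
    rw [sub_zero] at h4
    refine h4.congr fun n => ?_
    have := (hs0 n).ne'
    simp only [slope_def_field, Function.comp_apply, hφ, hQ]
    simp
    field_simp
    ring
  have hQm (n : ℕ) : AEStronglyMeasurable (Q n) μ := by
    have h1 := h.measurable _ (hsp n)
    have h2 := h.measurable _ (hsm n)
    have h3 := h.measurable _ h0m
    exact (((h1.sub h3).div_const _).sub ((h2.sub h3).div_const _)).aestronglyMeasurable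
  have hQb (n : ℕ) (y : 𝒴) : ‖Q n y‖ ≤ 2 * ‖e‖ * L y := by
    have h1 := h.lip y _ (hsp n) _ h0m
    have h2 := h.lip y _ (hsm n) _ h0m
    simp only [add_sub_cancel_left, norm_smul, Real.norm_eq_abs, abs_neg, abs_of_pos (hs0 n)]
      at h1 h2
    refine (norm_sub_le _ _).trans ?_
    rw [Real.norm_eq_abs, Real.norm_eq_abs, abs_div _ (s n), abs_div _ (-s n), abs_neg,
      abs_of_pos (hs0 n)]
    have h3 : |f y (η₀ + s n • e) - f y η₀| / s n ≤ ‖e‖ * L y := by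
      rw [div_le_iff₀ (hs0 n)]; linarith
    have h4 : |f y (η₀ + (-s n) • e) - f y η₀| / s n ≤ ‖e‖ * L y := by
      rw [div_le_iff₀ (hs0 n)]; linarith
    linarith
  have hbi : Integrable (fun y => 2 * ‖e‖ * L y) μ := h.integrable_bound.const_mul _
  have hlim := tendsto_integral_of_dominated_convergence _ hQm hbi
    (fun n => Eventually.of_forall (hQb n)) (Eventually.of_forall hQlim)
  have hlim0 : Tendsto (fun n => ∫ y, Q n y ∂μ) atTop (𝓝 0) := by
    have hline : DifferentiableAt ℝ (fun t : ℝ => ∫ y, f y (η₀ + t • e) ∂μ) 0 := by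
      have : DifferentiableAt ℝ (fun t : ℝ => η₀ + t • e) 0 := by fun_prop
      exact DifferentiableAt.comp (g := fun η => ∫ y, f y η ∂μ) (0 : ℝ) (by simpa using hd) this
    have h1 := hasDerivAt_iff_tendsto_slope.1 hline.hasDerivAt
    have h2 := (h1.comp (hstR.mono_right (nhdsGT_le_nhdsNE 0))).sub
      (h1.comp (hstL.mono_right (nhdsLT_le_nhdsNE 0)))
    rw [sub_self] at h2
    refine h2.congr fun n => ?_
    have i1 := h.integrable _ (hsp n)
    have i2 := h.integrable _ (hsm n)
    have i3 := h.integrable _ h0m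
    simp only [hQ, slope_def_field, Function.comp_apply]
    have j1 : Integrable (fun y => (f y (η₀ + s n • e) - f y η₀) / s n) μ := (i1.sub i3).div_const _
    have j2 : Integrable (fun y => (f y (η₀ + (-s n) • e) - f y η₀) / (-s n)) μ :=
      (i2.sub i3).div_const _
    rw [integral_sub j1 j2, integral_div, integral_div, integral_sub i1 i3, integral_sub i2 i3]
    simp
  have hzero : ∫ y, (R y - D y) ∂μ = 0 := tendsto_nhds_unique hlim hlim0
  have hint : Integrable (fun y => R y - D y) μ := by
    refine hbi.mono' (aestronglyMeasurable_of_tendsto_ae atTop hQm (Eventually.of_forall hQlim))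
      (Eventually.of_forall fun y => ?_)
    exact le_of_tendsto (hQlim y).norm (Eventually.of_forall fun n => hQb n y)
  have hae := (integral_eq_zero_iff_of_nonneg (fun y => sub_nonneg.2 (hDR y)) hint).1 hzero
  filter_upwards [hae] with y hy
  have hy' : R y = D y := sub_eq_zero.1 hy
  have h1 : HasDerivAt (φ y) (R y) 0 := by
    rw [hasDerivAt_iff_tendsto_slope_left_right]
    exact ⟨hy' ▸ (hasDerivWithinAt_iff_tendsto_slope' (by simp)).1 (hDd y),
      (hasDerivWithinAt_iff_tendsto_slope' (by simp)).1 (hRd y)⟩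
  have h2 : DifferentiableAt ℝ (fun t : ℝ => φ y t - L y / 2 * (t ^ 2 * ‖e‖ ^ 2)) 0 :=
    h1.differentiableAt.sub (by fun_prop)
  simpa [hφ] using h2

/-- No differentiability is required: where it fails, `fderiv` is zero and `L y ≥ 0`. -/
lemma norm_fderiv_le (h : SemiconvexCriterion μ f Θ L) (h₀ : η₀ ∈ interior Θ) (y : 𝒴) :
    ‖fderiv ℝ (f y) η₀‖ ≤ L y := by
  by_cases hd : DifferentiableAt ℝ (f y) η₀
  · refine hd.hasFDerivAt.le_of_lip' (h.nonneg y) ?_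
    filter_upwards [mem_interior_iff_mem_nhds.1 h₀] with η hη
    exact h.lip y η hη η₀ (interior_subset h₀)
  · rw [fderiv_zero_of_not_differentiableAt hd, norm_zero]; exact h.nonneg y

end

section

variable {𝒴 ι : Type*} [MeasurableSpace 𝒴] [Fintype ι] {μ : Measure 𝒴}
    {f : 𝒴 → EuclideanSpace ℝ ι → ℝ} {Θ : Set (EuclideanSpace ℝ ι)} {L : 𝒴 → ℝ}
    {η₀ : EuclideanSpace ℝ ι}

/-- If the expected criterion function is differentiable at a point, then so is almost surely the
criterion function itself. -/
lemma ae_differentiableAt [IsProbabilityMeasure μ] (h : SemiconvexCriterion μ f Θ L) (h₀ : η₀ ∈ interior Θ)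
    (hd : DifferentiableAt ℝ (fun η => ∫ y, f y η ∂μ) η₀) :
    ∀ᵐ y ∂μ, DifferentiableAt ℝ (f y) η₀ := by
  classical
  obtain ⟨δ, hδ, hδΘ⟩ := Metric.mem_nhds_iff.1 (mem_interior_iff_mem_nhds.1 h₀)
  -- Finitely many coordinate lines share one null set, and for a convex function partial
  -- derivatives at a point give the full derivative.
  have hl := ae_all_iff.2 fun i : ι =>
    h.ae_differentiableAt_line h₀ hd (EuclideanSpace.single i (1 : ℝ))
  filter_upwards [hl] with y hy
  have hc := (StrongConvexOn.convexOn_sub_sq (h.semiconvex y) η₀).subset hδΘ (convex_ball _ _)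
  have hdiff : DifferentiableAt ℝ (fun x => f y x - -L y / 2 * ‖x - η₀‖ ^ 2) η₀ := by
    refine differentiableAt_of_convexOn hδ hc fun i => (hy i).sub ?_
    have : DifferentiableAt ℝ (fun t : ℝ =>
      ‖(η₀ + t • EuclideanSpace.single i (1 : ℝ)) - η₀‖ ^ 2) 0 :=
      DifferentiableAt.norm_sq ℝ (by fun_prop)
    exact this.const_mul _
  have h2 : DifferentiableAt ℝ (fun x => -L y / 2 * ‖x - η₀‖ ^ 2) η₀ :=
    (DifferentiableAt.norm_sq ℝ (by fun_prop)).const_mul _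
  exact (hdiff.add h2).congr_of_eventuallyEq (Eventually.of_forall fun x => by simp)

/-- The coordinates of the derivative are almost sure limits of difference quotients. Semiconvexity
plays no role, so that partial derivatives of a criterion are covered as well. -/
lemma _root_.LTA.aestronglyMeasurable_fderiv {η₀ : EuclideanSpace ℝ ι} {s : Set (EuclideanSpace ℝ ι)}
    (hs : s ∈ 𝓝 η₀) (hm : ∀ η ∈ s, AEStronglyMeasurable (fun y => f y η) μ)
    (hd : ∀ᵐ y ∂μ, DifferentiableAt ℝ (f y) η₀) :
    AEStronglyMeasurable (fun y => fderiv ℝ (f y) η₀) μ := by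
  classical
  have hrep : (fun y => fderiv ℝ (f y) η₀) = fun y =>
      ∑ i, (fderiv ℝ (f y) η₀ (EuclideanSpace.single i (1 : ℝ))) •
        (EuclideanSpace.proj i : EuclideanSpace ℝ ι →L[ℝ] ℝ) := by
    funext y
    refine ContinuousLinearMap.ext fun v => ?_
    conv_lhs => rw [← (EuclideanSpace.basisFun ι ℝ).sum_repr v]
    simp [mul_comm]
  rw [hrep]
  refine Finset.aestronglyMeasurable_fun_sum _ fun i _ => AEStronglyMeasurable.smul_const ?_ _
  set e := EuclideanSpace.single i (1 : ℝ) with he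
  obtain ⟨δ, hδ, hδs⟩ := Metric.mem_nhds_iff.1 hs
  have hs : ∀ n : ℕ, 0 < δ / ((n : ℝ) + 2) := fun n => by positivity
  have hst : Tendsto (fun n : ℕ => δ / ((n : ℝ) + 2)) atTop (𝓝 0) :=
    tendsto_const_nhds.div_atTop (tendsto_atTop_add_const_right _ _ tendsto_natCast_atTop_atTop)
  refine aestronglyMeasurable_of_tendsto_ae (u := atTop)
    (f := fun (n : ℕ) y => (f y (η₀ + (δ / ((n : ℝ) + 2)) • e) - f y η₀) / (δ / ((n : ℝ) + 2)))
    (fun n => ?_) ?_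
  · refine (((hm _ (hδs ?_)).aemeasurable.sub
      (hm _ (hδs (Metric.mem_ball_self hδ))).aemeasurable).div_const _).aestronglyMeasurable
    simp only [mem_ball_iff_norm, add_sub_cancel_left, norm_smul, he,
      Real.norm_of_nonneg (hs n).le]
    simp only [PiLp.norm_single, norm_one, mul_one]
    rw [div_lt_iff₀ (by positivity)]
    nlinarith [(Nat.cast_nonneg n : (0 : ℝ) ≤ n)]
  · filter_upwards [hd] with y hy
    have h1 : HasDerivAt (fun t : ℝ => f y (η₀ + t • e)) (fderiv ℝ (f y) η₀ e) 0 :=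
      hy.hasFDerivAt.hasLineDerivAt e
    have h2 := (hasDerivAt_iff_tendsto_slope.1 h1).comp
      (tendsto_nhdsWithin_iff.2 ⟨hst, Eventually.of_forall fun n => (hs n).ne'⟩)
    refine h2.congr fun n => ?_
    simp [slope_def_field]

lemma aestronglyMeasurable_fderiv (h : SemiconvexCriterion μ f Θ L) (h₀ : η₀ ∈ interior Θ)
    (hd : ∀ᵐ y ∂μ, DifferentiableAt ℝ (f y) η₀) :
    AEStronglyMeasurable (fun y => fderiv ℝ (f y) η₀) μ :=
  LTA.aestronglyMeasurable_fderiv (mem_interior_iff_mem_nhds.1 h₀)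
    (fun η hη => (h.measurable η hη).aestronglyMeasurable) hd

/-- Differentiability is needed at `η₀` alone, since `L` dominates the difference quotients based at
`η₀`. -/
lemma hasFDerivAt_integral [IsProbabilityMeasure μ] (h : SemiconvexCriterion μ f Θ L) (h₀ : η₀ ∈ interior Θ)
    (hd : ∀ᵐ y ∂μ, DifferentiableAt ℝ (f y) η₀) :
    Integrable (fun y => fderiv ℝ (f y) η₀) μ ∧
      HasFDerivAt (fun η => ∫ y, f y η ∂μ) (∫ y, fderiv ℝ (f y) η₀ ∂μ) η₀ :=
  hasFDerivAt_integral_of_dominated_loc_of_lip' (F := fun η y => f y η) (bound := L)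
    (mem_interior_iff_mem_nhds.1 h₀)
    (fun η hη => (h.measurable η hη).aestronglyMeasurable) (h.integrable _ (interior_subset h₀))
    (h.aestronglyMeasurable_fderiv h₀ hd)
    (Eventually.of_forall fun y η hη => h.lip y η hη η₀ (interior_subset h₀)) h.integrable_bound
    (hd.mono fun _ hy => hy.hasFDerivAt)

/-- The first order Taylor remainder is, in mean square, of smaller order than the increment. -/
lemma tendsto_integral_remainder_sq [IsProbabilityMeasure μ] (h : SemiconvexCriterion μ f Θ L) (h₀ : η₀ ∈ interior Θ)
    (hd : ∀ᵐ y ∂μ, DifferentiableAt ℝ (f y) η₀) :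
    Tendsto (fun u => ∫ y, ((f y (η₀ + u) - f y η₀ - fderiv ℝ (f y) η₀ u) / ‖u‖) ^ 2 ∂μ)
      (𝓝 0) (𝓝 0) := by
  have hΘ : ∀ᶠ u in 𝓝 (0 : EuclideanSpace ℝ ι), η₀ + u ∈ Θ := by
    have : Tendsto (fun u => η₀ + u) (𝓝 0) (𝓝 η₀) := by
      simpa using (continuous_const_add η₀).tendsto 0
    exact this (mem_interior_iff_mem_nhds.1 h₀)
  -- The increment and the linear term are each at most `L ‖u‖`, hence the dominating function `4
  -- L²`. At `u = 0` the quotient is `0 / 0 = 0`.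
  have := tendsto_integral_filter_of_dominated_convergence (μ := μ) (l := 𝓝 0)
    (F := fun u y => ((f y (η₀ + u) - f y η₀ - fderiv ℝ (f y) η₀ u) / ‖u‖) ^ 2)
    (f := fun _ => 0) (fun y => 4 * L y ^ 2) ?_ ?_ ?_ ?_
  · simpa using this
  · filter_upwards [hΘ] with u hu
    have h1 : AEMeasurable (fun y => fderiv ℝ (f y) η₀ u) μ :=
      ((ContinuousLinearMap.apply ℝ ℝ u).continuous.comp_aestronglyMeasurable
        (h.aestronglyMeasurable_fderiv h₀ hd)).aemeasurable
    exact (((((h.measurable _ hu).sub (h.measurable _ (interior_subset h₀))).aemeasurable.sub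
      h1).div_const _).pow_const 2).aestronglyMeasurable
  · filter_upwards [hΘ] with u hu
    refine Eventually.of_forall fun y => ?_
    have h1 := h.lip y _ hu _ (interior_subset h₀)
    rw [add_sub_cancel_left] at h1
    have h2 := ((fderiv ℝ (f y) η₀).le_opNorm u).trans
      (mul_le_mul_of_nonneg_right (h.norm_fderiv_le h₀ y) (norm_nonneg u))
    have h3 : |(f y (η₀ + u) - f y η₀ - fderiv ℝ (f y) η₀ u) / ‖u‖| ≤ 2 * L y := by
      rw [abs_div, abs_norm]
      refine div_le_of_le_mul₀ (norm_nonneg _) (by linarith [h.nonneg y]) ?_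
      rw [← Real.norm_eq_abs]
      refine (norm_sub_le _ _).trans ?_
      rw [← Real.norm_eq_abs] at h1
      linarith
    rw [Real.norm_eq_abs, abs_pow]
    calc _ ≤ (2 * L y) ^ 2 := by gcongr
      _ = _ := by ring
  · exact h.memLp.integrable_sq.const_mul 4
  · filter_upwards [hd] with y hy
    have h1 := (hasFDerivAt_iff_isLittleO_nhds_zero.1 hy.hasFDerivAt)
    have h2 := h1.norm_right.tendsto_div_nhds_zero.pow 2
    simpa using h2

end

end SemiconvexCriterion

end LTA


namespace LTA

/-! ### Measurable selection of maximisers. -/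

section MeasurableArgmax

lemma iSup_denseSeq {K : Type*} [TopologicalSpace K] [Nonempty K]
    [TopologicalSpace.SeparableSpace K] {k : K → ℝ} (hk : Continuous k)
    (hb : BddAbove (Set.range k)) :
    ⨆ n, k (TopologicalSpace.denseSeq K n) = ⨆ t, k t := by
  refine le_antisymm (ciSup_le fun n => le_ciSup hb _) (ciSup_le fun t => ?_)
  have hb' : BddAbove (Set.range fun n => k (TopologicalSpace.denseSeq K n)) :=
    hb.mono (Set.range_comp_subset_range _ k)
  have hcl : IsClosed {t | k t ≤ ⨆ n, k (TopologicalSpace.denseSeq K n)} :=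
    isClosed_le hk continuous_const
  have := (TopologicalSpace.denseRange_denseSeq K).closure_eq ▸
    hcl.closure_subset_iff.2 (Set.range_subset_iff.2 fun n => le_ciSup hb' n)
  exact this (Set.mem_univ t)

lemma measurable_iSup_of_continuous {α K : Type*} [MeasurableSpace α] [TopologicalSpace K]
    [Nonempty K] [TopologicalSpace.SeparableSpace K] {k : α → K → ℝ}
    (hm : ∀ t, Measurable fun a => k a t) (hk : ∀ a, Continuous (k a))
    (hb : ∀ a, BddAbove (Set.range (k a))) :
    Measurable fun a => ⨆ t, k a t := by
  simp_rw [← fun a => iSup_denseSeq (hk a) (hb a)]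
  exact Measurable.iSup fun n => hm _

/-- On the line one can select the smallest maximiser. It is at most `c` exactly when the supremum
over `C ∩ (-∞, c]` equals the one over `C`, and by continuity both reduce to countable suprema. -/
lemma exists_measurable_isMaxOn_real {α : Type*} [MeasurableSpace α] {C : Set ℝ}
    (hC : IsCompact C) (hne : C.Nonempty) {k : α → C → ℝ}
    (hm : ∀ t, Measurable fun a => k a t) (hk : ∀ a, Continuous (k a)) :
    ∃ s : α → C, Measurable s ∧ ∀ a t, k a t ≤ k a (s a) := by
  have : CompactSpace C := isCompact_iff_compactSpace.1 hC
  have : Nonempty C := hne.to_subtype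
  set A : α → Set ℝ := fun a => {t | ∃ h : t ∈ C, ∀ t', k a t' ≤ k a ⟨t, h⟩} with hA
  have hAimg (a : α) : A a = (Subtype.val : C → ℝ) '' {t | ∀ t', k a t' ≤ k a t} := by
    ext t; simp [hA]
  have hAc (a : α) : IsCompact (A a) := by
    rw [hAimg]
    refine IsCompact.image (IsClosed.isCompact ?_) continuous_subtype_val
    simp only [Set.ofPred_forall]
    exact isClosed_iInter fun t' => isClosed_le continuous_const (hk a)
  have hAne (a : α) : (A a).Nonempty := by
    obtain ⟨t, -, ht⟩ := isCompact_univ.exists_isMaxOn (Set.univ_nonempty (α := C)) (hk a).continuousOn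
    exact ⟨t.1, t.2, fun t' => ht (Set.mem_univ t')⟩
  have hmem (a : α) : sInf (A a) ∈ A a := (hAc a).sInf_mem (hAne a)
  refine ⟨fun a => ⟨sInf (A a), (hmem a).1⟩, ?_, fun a t => (hmem a).2 t⟩
  refine Measurable.subtype_mk (measurable_of_Iic fun c => ?_)
  -- Treated apart because a real supremum over an empty index type is the default value `0`.
  rcases (C ∩ Set.Iic c).eq_empty_or_nonempty with he | hKne
  · convert MeasurableSet.empty
    ext a
    simp only [Set.mem_preimage, Set.mem_Iic, Set.mem_empty_iff_false, iff_false]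
    intro h
    exact (he ▸ (⟨(hmem a).1, h⟩ : sInf (A a) ∈ C ∩ Set.Iic c) : sInf (A a) ∈ (∅ : Set ℝ))
  · have : CompactSpace (C ∩ Set.Iic c : Set ℝ) :=
      isCompact_iff_compactSpace.1 (hC.inter_right isClosed_Iic)
    have : Nonempty (C ∩ Set.Iic c : Set ℝ) := hKne.to_subtype
    set j : (C ∩ Set.Iic c : Set ℝ) → C := Set.inclusion Set.inter_subset_left with hj
    have hjc : Continuous j := continuous_inclusion _
    have hset : (fun a => sInf (A a)) ⁻¹' Set.Iic c
        = {a | ⨆ t, k a (j t) = ⨆ t, k a t} := by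
      ext a
      have hb : BddAbove (Set.range (k a)) := (isCompact_range (hk a)).bddAbove
      simp only [Set.mem_preimage, Set.mem_Iic, Set.mem_ofPred_eq]
      constructor
      · intro h
        refine le_antisymm (ciSup_le fun t => le_ciSup hb _) (ciSup_le fun t => ?_)
        refine ((hmem a).2 t).trans ?_
        exact le_ciSup (f := fun t => k a (j t)) (isCompact_range ((hk a).comp hjc)).bddAbove
          ⟨sInf (A a), (hmem a).1, h⟩
      · intro h
        obtain ⟨t, -, ht⟩ := isCompact_univ.exists_isMaxOn Set.univ_nonempty
          ((hk a).comp hjc).continuousOn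
        have h1 : ⨆ t, k a (j t) ≤ k a (j t) := ciSup_le fun t' => ht (Set.mem_univ t')
        refine (csInf_le (hAc a).bddBelow ⟨t.2.1, fun t' => ?_⟩).trans t.2.2
        exact ((le_ciSup hb t').trans h.ge).trans h1
    rw [hset]
    exact measurableSet_eq_fun (measurable_iSup_of_continuous (fun t => hm _)
      (fun a => (hk a).comp hjc) fun a => (isCompact_range ((hk a).comp hjc)).bddAbove)
      (measurable_iSup_of_continuous hm hk fun a => (isCompact_range (hk a)).bddAbove)

/-- Measurable selection of a maximiser of a Carathéodory function over a compact set. -/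
lemma exists_measurable_isMaxOn {α E : Type*} [MeasurableSpace α] [MetricSpace E]
    [MeasurableSpace E] [BorelSpace E] {U : Set E} (hU : IsCompact U) (hne : U.Nonempty)
    {g : α → E → ℝ} (hm : ∀ η ∈ U, Measurable fun a => g a η)
    (hc : ∀ a, ContinuousOn (g a) U) :
    ∃ s : α → E, Measurable s ∧ ∀ a, s a ∈ U ∧ IsMaxOn (g a) U (s a) := by
  have : CompactSpace U := isCompact_iff_compactSpace.1 hU
  have : Nonempty U := hne.to_subtype
  -- A nonempty compact metric space is a continuous image of the Cantor set, a compact subset of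
  -- the line. Selecting there and mapping forward reduces to the real case.
  obtain ⟨φ, hφ, hφs⟩ := exists_nat_bool_continuous_surjective_of_compact U
  set ψ : cantorSet → U := φ ∘ cantorSetHomeomorphNatToBool with hψ
  have hψc : Continuous ψ := hφ.comp cantorSetHomeomorphNatToBool.continuous
  have hψs : Function.Surjective ψ := hφs.comp cantorSetHomeomorphNatToBool.surjective
  obtain ⟨s, hs, hsm⟩ := exists_measurable_isMaxOn_real (C := cantorSet) isCompact_cantorSet
    ⟨0, zero_mem_cantorSet⟩ (k := fun a t => g a (ψ t)) (fun t => hm _ (ψ t).2)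
    (fun a => (continuousOn_iff_continuous_domRestrict.1 (hc a)).comp hψc)
  refine ⟨fun a => ψ (s a), (continuous_subtype_val.comp hψc).measurable.comp hs,
    fun a => ⟨(ψ (s a)).2, fun η hη => ?_⟩⟩
  obtain ⟨t, ht⟩ := hψs ⟨η, hη⟩
  have := hsm a t
  rwa [ht] at this

end MeasurableArgmax

/-! ### Chebyshev's inequality and the central limit theorem for i.i.d. samples. -/

section IID

variable {Ω 𝒴 : Type*} [MeasurableSpace Ω] [MeasurableSpace 𝒴] {P : Measure Ω}
  [IsProbabilityMeasure P] {μ : Measure 𝒴} {Y : ℕ → Ω → 𝒴}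

/-- Chebyshev's inequality for sums of independent identically distributed variables. -/
lemma measure_abs_sum_sub_ge_le (hindep : iIndepFun Y P) (hlaw : ∀ i, HasLaw (Y i) μ P)
    {g : 𝒴 → ℝ} (hg : MemLp g 2 μ) (m : ℕ) {a : ℝ} (ha : 0 < a) :
    P {ω | a ≤ |∑ i ∈ Finset.range m, g (Y i ω) - m * ∫ y, g y ∂μ|}
      ≤ ENNReal.ofReal (m * (∫ y, g y ^ 2 ∂μ) / a ^ 2) := by
  have hmem (i : ℕ) : MemLp (fun ω => g (Y i ω)) 2 P := by
    have := (hlaw i).map_eq ▸ hg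
    exact this.comp_of_map (hlaw i).aemeasurable
  have hind : iIndepFun (fun i ω => g (Y i ω)) P := by
    refine hindep.comp₀ (fun _ => g) (fun i => (hlaw i).aemeasurable) fun i => ?_
    rw [(hlaw i).map_eq]; exact hg.1.aemeasurable
  have hE (i : ℕ) : ∫ ω, g (Y i ω) ∂P = ∫ y, g y ∂μ := (hlaw i).integral_comp hg.1
  have hE2 (i : ℕ) : ∫ ω, g (Y i ω) ^ 2 ∂P = ∫ y, g y ^ 2 ∂μ :=
    (hlaw i).integral_comp (f := fun y => g y ^ 2) (hg.1.pow 2)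
  have hS : MemLp (fun ω => ∑ i ∈ Finset.range m, g (Y i ω)) 2 P :=
    memLp_finsetSum _ fun i _ => hmem i
  have hES : ∫ ω, ∑ i ∈ Finset.range m, g (Y i ω) ∂P = m * ∫ y, g y ∂μ := by
    rw [integral_finsetSum _ fun i _ => (hmem i).integrable (by norm_num)]
    simp [hE]
  have h1 := meas_ge_le_variance_div_sq hS ha
  rw [hES] at h1
  refine h1.trans (ENNReal.ofReal_le_ofReal ?_)
  gcongr
  have hv : variance (fun ω => ∑ i ∈ Finset.range m, g (Y i ω)) P
      = ∑ i ∈ Finset.range m, variance (fun ω => g (Y i ω)) P := by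
    have := IndepFun.variance_sum (s := Finset.range m) (fun i _ => hmem i)
      (fun i _ j _ hij => hind.indepFun hij)
    rw [← this]
    congr 1
    ext ω; simp
  rw [hv]
  calc ∑ i ∈ Finset.range m, variance (fun ω => g (Y i ω)) P
      ≤ ∑ i ∈ Finset.range m, ∫ y, g y ^ 2 ∂μ := by
        refine Finset.sum_le_sum fun i _ => ?_
        rw [← hE2 i]
        exact variance_le_expectation_sq (hmem i).1
    _ = m * ∫ y, g y ^ 2 ∂μ := by simp

/-- The multivariate central limit theorem for centred vectors. -/
lemma tendstoInDistribution_multivariateGaussian {ι : Type*} [Fintype ι] [DecidableEq ι]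
    (hindep : iIndepFun Y P) (hlaw : ∀ i, HasLaw (Y i) μ P)
    {H : 𝒴 → EuclideanSpace ℝ ι} (hH : MemLp H 2 μ) (hH0 : ∀ i, ∫ y, H y i ∂μ = 0) :
    TendstoInDistribution (fun (m : ℕ) ω => (√(m : ℝ))⁻¹ • ∑ i ∈ Finset.range m, H (Y i ω)) atTop
      (id : EuclideanSpace ℝ ι → EuclideanSpace ℝ ι) (fun _ => P)
      (multivariateGaussian 0 (Matrix.of fun i j => ∫ y, H y i * H y j ∂μ)) := by
  have hprob : IsProbabilityMeasure μ := (hlaw 0).isProbabilityMeasure_iff.1 inferInstance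
  set S : Matrix ι ι ℝ := Matrix.of fun i j => ∫ y, H y i * H y j ∂μ with hS
  have hcoord (i : ι) : MemLp (fun y => H y i) 2 μ := by
    refine hH.mono ?_ ?_
    · exact (EuclideanSpace.proj (𝕜 := ℝ) i).continuous.comp_aestronglyMeasurable hH.1
    · exact Eventually.of_forall fun y => PiLp.norm_apply_le (H y) i
  have hint (i j : ι) : Integrable (fun y => H y i * H y j) μ := (hcoord i).integrable_mul (hcoord j)
  -- The quadratic form of `S` is a second moment. This gives positive semidefiniteness, without
  -- which the characteristic function of the Gaussian is not available, and it identifies the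
  -- variance of the projection on `t`.
  have hquad (t : EuclideanSpace ℝ ι) :
      (t : ι → ℝ) ⬝ᵥ (S.mulVec t) = ∫ y, (inner ℝ t (H y)) ^ 2 ∂μ := by
    have h1 (y : 𝒴) : (inner ℝ t (H y)) ^ 2 = ∑ i, ∑ j, t i * (t j * (H y i * H y j)) := by
      rw [PiLp.inner_apply, sq, Finset.sum_mul_sum]
      refine Finset.sum_congr rfl fun i _ => Finset.sum_congr rfl fun j _ => ?_
      simp; ring
    simp_rw [h1]
    rw [integral_finsetSum _ fun i _ => integrable_finsetSum _ fun j _ =>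
      ((hint i j).const_mul _).const_mul _]
    simp only [dotProduct, Matrix.mulVec, Finset.mul_sum]
    refine Finset.sum_congr rfl fun i _ => ?_
    rw [integral_finsetSum _ fun j _ => ((hint i j).const_mul _).const_mul _]
    refine Finset.sum_congr rfl fun j _ => ?_
    rw [integral_const_mul, integral_const_mul]
    simp [hS, mul_comm]
  have hpsd : S.PosSemidef := by
    refine Matrix.PosSemidef.of_dotProduct_mulVec_nonneg ?_ fun x => ?_
    · ext i j; simp [hS, mul_comm]
    · have := hquad (WithLp.toLp 2 x)
      simp only [star_trivial]
      rw [this]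
      exact integral_nonneg fun y => sq_nonneg _
  have hYm (i : ℕ) : AEMeasurable (fun ω => H (Y i ω)) P := by
    refine AEMeasurable.comp_aemeasurable ?_ (hlaw i).aemeasurable
    rw [(hlaw i).map_eq]; exact hH.1.aemeasurable
  have hXm (m : ℕ) : AEMeasurable (fun ω => (√(m : ℝ))⁻¹ • ∑ i ∈ Finset.range m, H (Y i ω)) P :=
    (Finset.aemeasurable_fun_sum _ fun i _ => hYm i).const_smul (√(m : ℝ))⁻¹
  refine ⟨hXm, by fun_prop, ?_⟩
  refine ProbabilityMeasure.tendsto_iff_tendsto_charFun.2 fun t => ?_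
  -- projection to one dimension
  set X : ℕ → Ω → ℝ := fun i ω => inner ℝ t (H (Y i ω)) with hX
  have hgm : AEMeasurable (fun y => inner ℝ t (H y)) μ := hH.1.aemeasurable.const_inner
  have hg2 : MemLp (fun y => inner ℝ t (H y)) 2 μ := by
    have := hH.const_inner (𝕜 := ℝ) t
    exact this
  have hX0 : MemLp (X 0) 2 P := ((hlaw 0).map_eq ▸ hg2).comp_of_map (hlaw 0).aemeasurable
  have hXi : iIndepFun X P := hindep.comp₀ (fun _ y => inner ℝ t (H y))
    (fun i => (hlaw i).aemeasurable) fun i => by rw [(hlaw i).map_eq]; exact hgm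
  have hXlaw (i : ℕ) : HasLaw (X i) (μ.map fun y => inner ℝ t (H y)) P := by
    have h1 : HasLaw (fun y => inner ℝ t (H y)) (μ.map fun y => inner ℝ t (H y)) μ := ⟨hgm, rfl⟩
    exact h1.comp (hlaw i)
  have hXid (i : ℕ) : IdentDistrib (X i) (X 0) P P :=
    ⟨(hXlaw i).aemeasurable, (hXlaw 0).aemeasurable, by rw [(hXlaw i).map_eq, (hXlaw 0).map_eq]⟩
  have hmean : ∫ ω, X 0 ω ∂P = 0 := by
    have h1 : ∫ ω, X 0 ω ∂P = ∫ y, inner ℝ t (H y) ∂μ := (hlaw 0).integral_comp hg2.1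
    rw [h1]
    simp_rw [PiLp.inner_apply]
    rw [integral_finsetSum _ fun i _ => ?_]
    · refine Finset.sum_eq_zero fun i _ => ?_
      simp [integral_mul_const, hH0]
    · simpa using ((hcoord i).integrable (by norm_num)).mul_const (t i)
  have hvar : variance (X 0) P = (t : ι → ℝ) ⬝ᵥ (S.mulVec t) := by
    rw [variance_of_integral_eq_zero hX0.1.aemeasurable hmean, hquad]
    exact (hlaw 0).integral_comp (f := fun y => (inner ℝ t (H y)) ^ 2) (hg2.1.pow 2)
  have hclt := tendstoInDistribution_inv_sqrt_mul_sum_sub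
    (Y := id) (P' := gaussianReal 0 (variance (X 0) P).toNNReal)
    ⟨aemeasurable_id, by simp⟩ hX0 hXi hXid
  -- The characteristic function of a vector at `t` is that of its projection on `t` at `1`, so the
  -- scalar theorem suffices.
  have hcf := (ProbabilityMeasure.tendsto_iff_tendsto_charFun.1 hclt.tendsto) 1
  simp only [hmean, mul_zero, sub_zero] at hcf
  simp only [ProbabilityMeasure.coe_mk, Measure.map_id] at hcf ⊢
  rw [charFun_multivariateGaussian hpsd]
  rw [charFun_gaussianReal] at hcf
  convert hcf using 2 with m
  · rw [charFun_apply, charFun_apply, integral_map (hXm m) (by fun_prop),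
      integral_map ?_ (by fun_prop)]
    · congr 1
      ext ω
      simp [hX, inner_smul_left, sum_inner, real_inner_comm, Complex.ofReal_mul]
    · exact (Finset.aemeasurable_fun_sum _ fun i _ => (hXlaw i).aemeasurable).const_mul _
  · rw [Real.coe_toNNReal _ (variance_nonneg _ _), hvar]
    simp

end IID

end LTA


namespace LTA

lemma StrongConvexOn.finset_sum {E κ : Type*} [NormedAddCommGroup E] [NormedSpace ℝ E] {s : Set E}
    (hs : Convex ℝ s) {g : κ → E → ℝ} {c : κ → ℝ} (t : Finset κ)
    (h : ∀ i ∈ t, StrongConvexOn s (c i) (g i)) :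
    StrongConvexOn s (∑ i ∈ t, c i) fun x => ∑ i ∈ t, g i x := by
  refine ⟨hs, fun x hx y hy a b ha hb hab => ?_⟩
  have := Finset.sum_le_sum fun i hi => (h i hi).2 hx hy ha hb hab
  refine this.trans (le_of_eq ?_)
  simp only [smul_eq_mul, Finset.sum_sub_distrib, Finset.sum_add_distrib, ← Finset.mul_sum,
    ← Finset.sum_div, ← Finset.sum_mul]

namespace SemiconvexCriterion

/-! ### Consistency of the maximisers. -/

section Consistency

variable {𝒴 Ω ι : Type*} [MeasurableSpace 𝒴] [MeasurableSpace Ω] [Fintype ι] {μ : Measure 𝒴}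
    {f : 𝒴 → EuclideanSpace ℝ ι → ℝ} {Θ U : Set (EuclideanSpace ℝ ι)} {L : 𝒴 → ℝ}
    {η₀ : EuclideanSpace ℝ ι} {P : Measure Ω} [IsProbabilityMeasure P] {Y : ℕ → Ω → 𝒴}
    {est : ℕ → Ω → EuclideanSpace ℝ ι}

lemma memLp_sub (h : SemiconvexCriterion μ f Θ L) {η η' : EuclideanSpace ℝ ι} (hη : η ∈ Θ)
    (hη' : η' ∈ Θ) : MemLp (fun y => f y η - f y η') 2 μ := by
  refine (h.memLp.mul_const ‖η - η'‖).mono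
    ((h.measurable η hη).sub (h.measurable η' hη')).aestronglyMeasurable
    (Eventually.of_forall fun y => ?_)
  have := h.lip y η hη η' hη'
  rw [Real.norm_eq_abs]
  exact this.trans (le_abs_self _)

lemma integral_sub_sq_le (h : SemiconvexCriterion μ f Θ L) {η η' : EuclideanSpace ℝ ι}
    (hη : η ∈ Θ) (hη' : η' ∈ Θ) :
    ∫ y, (f y η - f y η') ^ 2 ∂μ ≤ (∫ y, L y ^ 2 ∂μ) * ‖η - η'‖ ^ 2 := by
  rw [← integral_mul_const]
  refine integral_mono (h.memLp_sub hη hη').integrable_sq (h.memLp.integrable_sq.mul_const _)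
    fun y => ?_
  have := h.lip y η hη η' hη'
  simp only [← mul_pow]
  rw [← sq_abs]
  gcongr

lemma strongConvexOn_sum (h : SemiconvexCriterion μ f Θ L) (m : ℕ) (y : ℕ → 𝒴) :
    StrongConvexOn Θ (-∑ i ∈ Finset.range m, L (y i))
      fun η => ∑ i ∈ Finset.range m, f (y i) η := by
  rw [← Finset.sum_neg_distrib]
  exact StrongConvexOn.finset_sum (h.semiconvex (y 0)).1 _ fun i _ => h.semiconvex _

/-- The weak law of large numbers for square integrable variables. -/
lemma _root_.LTA.tendsto_measure_abs_sum_sub_ge (hindep : iIndepFun Y P)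
    (hlaw : ∀ i, HasLaw (Y i) μ P) {g : 𝒴 → ℝ} (hg : MemLp g 2 μ) {ε : ℝ} (hε : 0 < ε) :
    Tendsto (fun m : ℕ => P {ω | m * ε ≤ |∑ i ∈ Finset.range m, g (Y i ω) - m * ∫ y, g y ∂μ|})
      atTop (𝓝 0) := by
  have hb : Tendsto (fun m : ℕ => ENNReal.ofReal ((∫ y, g y ^ 2 ∂μ) / ε ^ 2 / m)) atTop (𝓝 0) := by
    rw [← ENNReal.ofReal_zero]
    exact ENNReal.tendsto_ofReal (tendsto_const_nhds.div_atTop tendsto_natCast_atTop_atTop)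
  refine tendsto_of_tendsto_of_tendsto_of_le_of_le' tendsto_const_nhds hb
    (Eventually.of_forall fun _ => zero_le) ?_
  filter_upwards [eventually_gt_atTop 0] with m hm
  have hm' : (0 : ℝ) < m := by exact_mod_cast hm
  refine (measure_abs_sum_sub_ge_le hindep hlaw hg m (by positivity)).trans
    (ENNReal.ofReal_le_ofReal (le_of_eq ?_))
  field_simp

lemma continuousOn_integral [IsProbabilityMeasure μ] (h : SemiconvexCriterion μ f Θ L) :
    ContinuousOn (fun η => ∫ y, f y η ∂μ) Θ := by
  refine LipschitzOnWith.continuousOn (K := (∫ y, L y ∂μ).toNNReal) ?_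
  refine LipschitzOnWith.of_dist_le_mul fun η hη η' hη' => ?_
  rw [Real.coe_toNNReal _ (integral_nonneg h.nonneg), Real.dist_eq, dist_eq_norm,
    ← integral_sub (h.integrable η hη) (h.integrable η' hη'), ← integral_mul_const]
  refine (abs_integral_le_integral_abs).trans (integral_mono
    ((h.integrable η hη).sub (h.integrable η' hη')).abs (h.integrable_bound.mul_const _)
    fun y => h.lip y η hη η' hη')

/-- Maximisers of the sample criterion function are consistent. -/
lemma tendsto_measure_norm_sub_ge (h : SemiconvexCriterion μ f Θ L) (hindep : iIndepFun Y P)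
    (hlaw : ∀ i, HasLaw (Y i) μ P) (hU : IsCompact U) (hUΘ : U ⊆ Θ) (h₀ : η₀ ∈ U)
    (hmax : ∀ η ∈ U, η ≠ η₀ → ∫ y, f y η ∂μ < ∫ y, f y η₀ ∂μ)
    (hest : ∀ m ω, est m ω ∈ U ∧
      IsMaxOn (fun η => ∑ i ∈ Finset.range m, f (Y i ω) η) U (est m ω)) {δ : ℝ} (hδ : 0 < δ) :
    Tendsto (fun m : ℕ => P {ω | δ ≤ ‖est m ω - η₀‖}) atTop (𝓝 0) := by
  have hprob : IsProbabilityMeasure μ := (hlaw 0).isProbabilityMeasure_iff.1 inferInstance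
  set C := U \ Metric.ball η₀ δ with hCdef
  have hC : IsCompact C := hU.diff Metric.isOpen_ball
  rcases C.eq_empty_or_nonempty with he | hne
  · refine tendsto_const_nhds.congr fun m => ?_
    have : {ω | δ ≤ ‖est m ω - η₀‖} = ∅ := by
      ext ω
      simp only [Set.mem_ofPred_eq, Set.mem_empty_iff_false, iff_false, not_le]
      by_contra! hc
      have : est m ω ∈ C := ⟨(hest m ω).1, by simpa [dist_eq_norm] using hc⟩
      simp [he] at this
    rw [this, measure_empty]
  obtain ⟨η₁, hη₁, hη₁max⟩ := hC.exists_isMaxOn hne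
    (h.continuousOn_integral.mono (Set.sdiff_subset.trans hUΘ))
  have hne1 : η₁ ≠ η₀ := by
    rintro rfl
    exact hη₁.2 (Metric.mem_ball_self hδ)
  set Δ := ∫ y, f y η₀ ∂μ - ∫ y, f y η₁ ∂μ with hΔ
  have hΔ0 : 0 < Δ := sub_pos.2 (hmax η₁ hη₁.1 hne1)
  set c := ∫ y, L y ∂μ + 1 with hc
  have hc0 : 0 < c := by have := integral_nonneg (μ := μ) (f := L) h.nonneg; positivity
  -- With the mean of `L` below `c`, moving to the nearest centre costs at most `Δ / 8` per
  -- observation, and the deviation at the centres is below `Δ / 4`. Together they stay below the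
  -- loss `Δ` that the expectation suffers away from `η₀`.
  obtain ⟨t, htC, ht⟩ := hC.elim_nhds_subcover (fun x => Metric.ball x (Δ / (8 * c)))
    fun x _ => Metric.ball_mem_nhds x (by positivity)
  have hbad : Tendsto (fun m : ℕ =>
      P {ω | m * 1 ≤ |∑ i ∈ Finset.range m, L (Y i ω) - m * ∫ y, L y ∂μ|} +
      ∑ x ∈ t, P {ω | m * (Δ / 4) ≤ |∑ i ∈ Finset.range m, (f (Y i ω) x - f (Y i ω) η₀)
        - m * ∫ y, (f y x - f y η₀) ∂μ|}) atTop (𝓝 0) := by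
    have h2 := tendsto_finsetSum t fun x hx => tendsto_measure_abs_sum_sub_ge hindep hlaw
      (h.memLp_sub (hUΘ (htC x hx).1) (hUΘ h₀)) (ε := Δ / 4) (by positivity)
    simpa using (tendsto_measure_abs_sum_sub_ge hindep hlaw h.memLp one_pos).add h2
  refine tendsto_of_tendsto_of_tendsto_of_le_of_le' tendsto_const_nhds hbad
    (Eventually.of_forall fun _ => zero_le) ?_
  filter_upwards [eventually_gt_atTop 0] with m hm
  have hm' : (0 : ℝ) < m := by exact_mod_cast hm
  refine le_trans (measure_mono ?_)
    ((measure_union_le _ _).trans (add_le_add le_rfl (measure_biUnion_finset_le t _)))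
  intro ω hω
  by_contra hcon
  simp only [Set.mem_union, Set.mem_iUnion, Set.mem_ofPred_eq, not_or, not_exists, not_le,
    mul_one] at hcon hω
  obtain ⟨hcon1, hcon2⟩ := hcon
  set η := est m ω with hη
  have hηC : η ∈ C := ⟨(hest m ω).1, by simpa [dist_eq_norm] using hω⟩
  obtain ⟨x, hx, hηx⟩ := Set.mem_iUnion₂.1 (ht hηC)
  have hxC := htC x hx
  have e1 := (abs_lt.1 (hcon2 x hx)).2
  have e2 := (abs_lt.1 hcon1).2
  rw [integral_sub (h.integrable _ (hUΘ hxC.1)) (h.integrable _ (hUΘ h₀)),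
    Finset.sum_sub_distrib] at e1
  have e3 : ∫ y, f y x ∂μ ≤ ∫ y, f y η₁ ∂μ := hη₁max hxC
  have e4 : ∑ i ∈ Finset.range m, f (Y i ω) η₀ ≤ ∑ i ∈ Finset.range m, f (Y i ω) η :=
    (hest m ω).2 h₀
  have e5 : ∑ i ∈ Finset.range m, f (Y i ω) η - ∑ i ∈ Finset.range m, f (Y i ω) x
      ≤ (∑ i ∈ Finset.range m, L (Y i ω)) * (Δ / (8 * c)) := by
    rw [← Finset.sum_sub_distrib, Finset.sum_mul]
    refine Finset.sum_le_sum fun i _ => ?_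
    refine (le_abs_self _).trans ((h.lip _ _ (hUΘ hηC.1) _ (hUΘ hxC.1)).trans ?_)
    exact mul_le_mul_of_nonneg_left (mem_ball_iff_norm.1 hηx).le (h.nonneg _)
  have e6 : (∑ i ∈ Finset.range m, L (Y i ω)) * (Δ / (8 * c)) ≤ m * (Δ / 8) := by
    have : ∑ i ∈ Finset.range m, L (Y i ω) ≤ m * c := by rw [hc]; linarith
    calc _ ≤ m * c * (Δ / (8 * c)) := by gcongr
      _ = m * (Δ / 8) := by field_simp
  have e7 : m * ∫ y, f y x ∂μ ≤ m * ∫ y, f y η₁ ∂μ := by gcongr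
  have e8 : m * Δ = m * ∫ y, f y η₀ ∂μ - m * ∫ y, f y η₁ ∂μ := by rw [hΔ]; ring
  have e9 : 0 < m * Δ := by positivity
  linarith

end Consistency

/-! ### The rate of convergence, by peeling. -/

section Rate

variable {𝒴 Ω ι : Type*} [MeasurableSpace 𝒴] [MeasurableSpace Ω] [Fintype ι] {μ : Measure 𝒴}
    {f : 𝒴 → EuclideanSpace ℝ ι → ℝ} {Θ U : Set (EuclideanSpace ℝ ι)} {L : 𝒴 → ℝ}
    {η₀ : EuclideanSpace ℝ ι} {P : Measure Ω} [IsProbabilityMeasure P] {Y : ℕ → Ω → 𝒴}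
    {est : ℕ → Ω → EuclideanSpace ℝ ι}

/-- Upper bound of the sample criterion function at `η₀ + s u` by its values at `η₀ + s v`, with
`v` in a finite set. -/
lemma exists_sum_le_of_mem_convexHull (h : SemiconvexCriterion μ f Θ L) {m : ℕ} {y : ℕ → 𝒴}
    {G : Finset (EuclideanSpace ℝ ι)} {s ε : ℝ} (hs : 0 ≤ s) {u : EuclideanSpace ℝ ι}
    (hu : u ∈ convexHull ℝ {v | v ∈ G ∧ ‖v - u‖ < ε})
    (hΘ : ∀ v, ‖v - u‖ < ε → η₀ + s • v ∈ Θ) :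
    ∃ v ∈ G, ‖v - u‖ < ε ∧ ∑ i ∈ Finset.range m, f (y i) (η₀ + s • u)
      ≤ ∑ i ∈ Finset.range m, f (y i) (η₀ + s • v)
        + (∑ i ∈ Finset.range m, L (y i)) / 2 * (s * ε) ^ 2 := by
  -- The net is rescaled by an affine map, which commutes with convex hulls; its mesh becomes `s *
  -- ε`, and the semiconvexity error shrinks like the square.
  set T : EuclideanSpace ℝ ι →ᵃ[ℝ] EuclideanSpace ℝ ι :=
    AffineMap.const ℝ _ η₀ + (s • LinearMap.id : EuclideanSpace ℝ ι →ₗ[ℝ] _).toAffineMap with hT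
  have hTv (v : EuclideanSpace ℝ ι) : T v = η₀ + s • v := by simp [hT]
  have hmem : T u ∈ convexHull ℝ (T '' {v | v ∈ G ∧ ‖v - u‖ < ε}) := by
    rw [← AffineMap.image_convexHull]
    exact ⟨u, hu, rfl⟩
  obtain ⟨w, ⟨v, hv, rfl⟩, hw⟩ := exists_le_of_mem_convexHull (h.strongConvexOn_sum m y)
    (Finset.sum_nonneg fun i _ => h.nonneg _) (ε := s * ε) (by
      rintro _ ⟨v, hv, rfl⟩; rw [hTv]; exact hΘ v hv.2) hmem (by
      rintro _ ⟨v, hv, rfl⟩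
      rw [hTv, hTv, add_sub_add_left_eq_sub, ← smul_sub, norm_smul, Real.norm_of_nonneg hs]
      exact mul_le_mul_of_nonneg_left hv.2.le hs)
  rw [hTv, hTv] at hw
  exact ⟨v, hv.1, hv.2, hw⟩

/-- Peeling: maximisers near `η₀` are within `O(1 / √m)`. -/
lemma exists_measure_sqrt_mul_norm_ge_le (h : SemiconvexCriterion μ f Θ L) (hindep : iIndepFun Y P)
    (hlaw : ∀ i, HasLaw (Y i) μ P) (h₀ : η₀ ∈ U)
    {κ δ c : ℝ} (hκ : 0 < κ) (hδ : 0 < δ) (hc : 0 < c) (hball : Metric.closedBall η₀ δ ⊆ Θ)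
    (hquad : ∀ u, ‖u‖ ≤ δ → ∫ y, f y (η₀ + u) ∂μ - ∫ y, f y η₀ ∂μ ≤ -κ * ‖u‖ ^ 2)
    (hest : ∀ m ω, est m ω ∈ U ∧
      IsMaxOn (fun η => ∑ i ∈ Finset.range m, f (Y i ω) η) U (est m ω)) :
    ∃ A : ℝ, ∀ R : ℝ, 0 < R → ∀ m : ℕ, 0 < m →
      P {ω | R ≤ √(m : ℝ) * ‖est m ω - η₀‖ ∧ ‖est m ω - η₀‖ < δ / 3 ∧
        ∑ i ∈ Finset.range m, L (Y i ω) < m * c} ≤ ENNReal.ofReal (A / R ^ 2) := by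
  -- Mesh at most `1 / 2` keeps net points near the annulus `1 ≤ ‖u‖ ≤ 2` at norm between `1 / 2`
  -- and `3`; `c ε² ≤ κ / 4` keeps the semiconvexity error within half of the quadratic drop.
  set ε := min (1 / 2) √(κ / (4 * c)) with hε
  have hε0 : 0 < ε := lt_min (by norm_num) (Real.sqrt_pos.2 (by positivity))
  have hε1 : ε ≤ 1 / 2 := min_le_left _ _
  have hε2 : c * ε ^ 2 ≤ κ / 4 := by
    have : ε ^ 2 ≤ κ / (4 * c) := by
      rw [← Real.sq_sqrt (show 0 ≤ κ / (4 * c) by positivity)]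
      gcongr
      exact min_le_right _ _
    calc c * ε ^ 2 ≤ c * (κ / (4 * c)) := by gcongr
      _ = κ / 4 := by field_simp
  have hann : IsCompact (Metric.closedBall (0 : EuclideanSpace ℝ ι) 2 \ Metric.ball 0 1) :=
    (isCompact_closedBall 0 2).diff Metric.isOpen_ball
  obtain ⟨G, hG⟩ := exists_finset_convexHull hann hε0
  set M := ∫ y, L y ^ 2 ∂μ with hM
  have hM0 : 0 ≤ M := integral_nonneg fun y => sq_nonneg _
  -- Chebyshev on a shell of radius `r`: second moment `m M (3 r)²` against the squared threshold
  -- `(m κ r² / 8)²`. With `m r_j² = R² 4^j` these bounds are geometric in `j`, and the factor `2`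
  -- below bounds their sum `4 / 3`.
  set A₀ := M * 9 * 64 / κ ^ 2 with hA₀
  have hA₀0 : 0 ≤ A₀ := by positivity
  refine ⟨2 * (G.card * A₀), fun R hR m hm => ?_⟩
  have hm' : (0 : ℝ) < m := by exact_mod_cast hm
  have hsm : 0 < √(m : ℝ) := Real.sqrt_pos.2 hm'
  -- Inner radii of the dyadic shells. One finite net `G` of the annulus, rescaled by `r j`, serves
  -- all of them.
  set r : ℕ → ℝ := fun j => R / √(m : ℝ) * 2 ^ j with hr
  have hr0 (j : ℕ) : 0 < r j := by positivity
  have hrsq (j : ℕ) : m * r j ^ 2 = R ^ 2 * 4 ^ j := by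
    have : (2 : ℝ) ^ j * 2 ^ j = 4 ^ j := by rw [← mul_pow]; norm_num
    rw [hr, mul_pow, div_pow, Real.sq_sqrt hm'.le, ← this]; field_simp
  set bad : ℕ → EuclideanSpace ℝ ι → Set Ω := fun j v =>
    {ω | ‖v‖ ≤ 3 ∧ 3 * r j ≤ δ ∧ m * (κ * r j ^ 2 / 8) ≤
      |∑ i ∈ Finset.range m, (f (Y i ω) (η₀ + r j • v) - f (Y i ω) η₀) -
        m * ∫ y, (f y (η₀ + r j • v) - f y η₀) ∂μ|} with hbad
  have h0Θ : η₀ ∈ Θ := hball (Metric.mem_closedBall_self hδ.le)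
  have hvn (j : ℕ) (v : EuclideanSpace ℝ ι) (hv : ‖v‖ ≤ 3) (hj : 3 * r j ≤ δ) :
      ‖r j • v‖ ≤ δ := by
    rw [norm_smul, Real.norm_of_nonneg (hr0 j).le]
    nlinarith [hr0 j]
  have hvΘ (j : ℕ) (v : EuclideanSpace ℝ ι) (hv : ‖v‖ ≤ 3) (hj : 3 * r j ≤ δ) :
      η₀ + r j • v ∈ Θ := hball (by simpa using hvn j v hv hj)
  have hbadP (j : ℕ) (v : EuclideanSpace ℝ ι) :
      P (bad j v) ≤ ENNReal.ofReal (A₀ / R ^ 2 * (1 / 4) ^ j) := by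
    by_cases hcond : ‖v‖ ≤ 3 ∧ 3 * r j ≤ δ
    · refine (measure_mono fun ω hω => hω.2.2).trans
        ((measure_abs_sum_sub_ge_le hindep hlaw (h.memLp_sub (hvΘ j v hcond.1 hcond.2) h0Θ) m
          (mul_pos hm' (by have := hr0 j; positivity))).trans (ENNReal.ofReal_le_ofReal ?_))
      have h1 := h.integral_sub_sq_le (hvΘ j v hcond.1 hcond.2) h0Θ
      rw [add_sub_cancel_left, norm_smul, Real.norm_of_nonneg (hr0 j).le] at h1
      have h2 : ∫ y, (f y (η₀ + r j • v) - f y η₀) ^ 2 ∂μ ≤ M * (r j * 3) ^ 2 := by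
        refine h1.trans ?_
        have := hr0 j
        gcongr
        exact hcond.1
      calc _ ≤ m * (M * (r j * 3) ^ 2) / (m * (κ * r j ^ 2 / 8)) ^ 2 := by gcongr
        _ = A₀ / (m * r j ^ 2) := by
          have := hr0 j
          rw [hA₀]; field_simp; norm_num
        _ = A₀ / R ^ 2 * (1 / 4) ^ j := by
          rw [hrsq, one_div, inv_pow]; field_simp
    · have : bad j v = ∅ := by
        ext ω
        simp only [hbad, Set.mem_ofPred_eq, Set.mem_empty_iff_false, iff_false]
        exact fun hω => hcond ⟨hω.1, hω.2.1⟩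
      rw [this, measure_empty]; exact zero_le
  have hsum : P (⋃ j, ⋃ v ∈ G, bad j v) ≤ ENNReal.ofReal (2 * (G.card * A₀) / R ^ 2) := by
    have h1 (j : ℕ) : P (⋃ v ∈ G, bad j v)
        ≤ ENNReal.ofReal (G.card * (A₀ / R ^ 2) * (1 / 4) ^ j) := by
      refine (measure_biUnion_finset_le G _).trans ((Finset.sum_le_sum fun v _ => hbadP j v).trans
        (le_of_eq ?_))
      rw [Finset.sum_const, nsmul_eq_mul, mul_assoc,
        ENNReal.ofReal_mul (p := (G.card : ℝ)) (by positivity), ENNReal.ofReal_natCast]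
    have h2 : Summable fun j : ℕ => G.card * (A₀ / R ^ 2) * (1 / 4 : ℝ) ^ j :=
      (summable_geometric_of_lt_one (by norm_num) (by norm_num)).mul_left _
    refine (measure_iUnion_le _).trans ((ENNReal.tsum_le_tsum h1).trans ?_)
    rw [← ENNReal.ofReal_tsum_of_nonneg (fun j => by positivity) h2, tsum_mul_left,
      tsum_geometric_of_lt_one (by norm_num) (by norm_num)]
    refine ENNReal.ofReal_le_ofReal ?_
    have : 0 ≤ G.card * (A₀ / R ^ 2) := by positivity
    calc G.card * (A₀ / R ^ 2) * (1 - 1 / 4)⁻¹ ≤ G.card * (A₀ / R ^ 2) * 2 := by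
          gcongr; norm_num
      _ = 2 * (G.card * A₀) / R ^ 2 := by ring
  refine (measure_mono ?_).trans hsum
  rintro ω ⟨hω1, hω2, hω3⟩
  by_contra hcon
  simp only [Set.mem_iUnion, not_exists] at hcon
  set u := est m ω - η₀ with hu
  -- the shell that contains the maximiser
  have hx : 1 ≤ ‖u‖ / (R / √(m : ℝ)) := by
    rw [le_div_iff₀ (by positivity), one_mul, div_le_iff₀ hsm]; linarith
  obtain ⟨j, hj1, hj2⟩ := exists_nat_pow_near hx (one_lt_two)
  rw [le_div_iff₀ (by positivity)] at hj1
  rw [div_lt_iff₀ (by positivity)] at hj2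
  have hj1' : r j ≤ ‖u‖ := by rw [hr]; linarith
  have hj2' : ‖u‖ ≤ 2 * r j := by rw [hr]; rw [pow_succ] at hj2; linarith
  have hj3 : 3 * r j ≤ δ := by linarith
  have hrj := hr0 j
  have hnorm : ‖(r j)⁻¹ • u‖ = ‖u‖ / r j := by
    rw [norm_smul, Real.norm_of_nonneg (by positivity)]; field_simp
  have hmemA : (r j)⁻¹ • u ∈ Metric.closedBall (0 : EuclideanSpace ℝ ι) 2 \ Metric.ball 0 1 := by
    constructor
    · rw [mem_closedBall_zero_iff, hnorm, div_le_iff₀ hrj]; exact hj2'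
    · rw [mem_ball_zero_iff, hnorm, not_lt, le_div_iff₀ hrj]; linarith
  have hlow : 1 ≤ ‖(r j)⁻¹ • u‖ := by simpa using hmemA.2
  have hupp : ‖(r j)⁻¹ • u‖ ≤ 2 := by simpa using hmemA.1
  have hclose (v : EuclideanSpace ℝ ι) (hv : ‖v - (r j)⁻¹ • u‖ < ε) : 1 / 2 ≤ ‖v‖ ∧ ‖v‖ ≤ 3 := by
    have h1 := norm_sub_norm_le ((r j)⁻¹ • u) v
    have h2 := norm_sub_norm_le v ((r j)⁻¹ • u)
    rw [norm_sub_rev] at h1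
    constructor <;> linarith
  obtain ⟨v, hvG, hv, hle⟩ := h.exists_sum_le_of_mem_convexHull (m := m) (y := fun i => Y i ω)
    (η₀ := η₀) (s := r j) hrj.le (hG _ hmemA) fun v hv => hvΘ j v (hclose v hv).2 hj3
  rw [smul_smul, mul_inv_cancel₀ hrj.ne', one_smul, hu, add_sub_cancel] at hle
  have hb := hcon j v hvG
  simp only [hbad, Set.mem_ofPred_eq, not_and, not_le] at hb
  have hb := (abs_lt.1 (hb (hclose v hv).2 hj3)).2
  have hq := hquad _ (hvn j v (hclose v hv).2 hj3)
  rw [integral_sub (h.integrable _ (hvΘ j v (hclose v hv).2 hj3)) (h.integrable _ h0Θ),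
    Finset.sum_sub_distrib] at hb
  rw [norm_smul, Real.norm_of_nonneg hrj.le] at hq
  have hq' : -κ * (r j * ‖v‖) ^ 2 ≤ -(κ * r j ^ 2 / 4) := by
    have : (1 / 2) ^ 2 ≤ ‖v‖ ^ 2 := by gcongr; exact (hclose v hv).1
    have : κ * r j ^ 2 * (1 / 2) ^ 2 ≤ κ * r j ^ 2 * ‖v‖ ^ 2 := by gcongr
    rw [mul_pow]; linarith
  -- Off the bad events the expected drop, at least `m κ r² / 4`, exceeds a deviation below half of
  -- it plus a semiconvexity error of at most half of it. The criterion at the estimator would then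
  -- lie strictly below its value at `η₀`.
  have hmx : ∑ i ∈ Finset.range m, f (Y i ω) η₀ ≤ ∑ i ∈ Finset.range m, f (Y i ω) (est m ω) :=
    (hest m ω).2 h₀
  have hL : (∑ i ∈ Finset.range m, L (Y i ω)) / 2 * (r j * ε) ^ 2 ≤ m * (κ * r j ^ 2 / 8) := by
    calc (∑ i ∈ Finset.range m, L (Y i ω)) / 2 * (r j * ε) ^ 2
        ≤ (m * c) / 2 * (r j * ε) ^ 2 := by gcongr
      _ = m * r j ^ 2 / 2 * (c * ε ^ 2) := by ring
      _ ≤ m * r j ^ 2 / 2 * (κ / 4) := by gcongr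
      _ = _ := by ring
  have hm2 : m * (∫ y, f y (η₀ + r j • v) ∂μ - ∫ y, f y η₀ ∂μ) ≤ m * -(κ * r j ^ 2 / 4) := by
    gcongr; linarith
  linarith

end Rate

end SemiconvexCriterion

end LTA


/-! ### Taylor expansion and tightness of normalised sums. -/

namespace LTA

/-- Second order Taylor expansion in several variables. -/
lemma isLittleO_taylor_two {E : Type*} [NormedAddCommGroup E] [NormedSpace ℝ E] {F : E → ℝ} {x : E}
    (hF : ContDiffAt ℝ 2 F x) :
    (fun u => F (x + u) - F x - fderiv ℝ F x u - 1 / 2 * fderiv ℝ (fderiv ℝ F) x u u)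
      =o[𝓝 0] fun u => ‖u‖ ^ 2 := by
  set B := fderiv ℝ (fderiv ℝ F) x with hB
  have hsymm : IsSymmSndFDerivAt ℝ F x := hF.isSymmSndFDerivAt (by simp)
  have hd1 : ∀ᶠ z in 𝓝 x, DifferentiableAt ℝ F z :=
    (hF.eventually (by simp)).mono fun z hz => hz.differentiableAt (by simp)
  have hd2 : HasFDerivAt (fderiv ℝ F) B x :=
    ((hF.fderiv_right (m := 1) le_rfl).differentiableAt (by simp)).hasFDerivAt
  have h2 := hasFDerivAt_iff_isLittleO_nhds_zero.1 hd2
  have hd1' : ∀ᶠ u in 𝓝 (0 : E), DifferentiableAt ℝ F (x + u) := by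
    have : Tendsto (fun u => x + u) (𝓝 0) (𝓝 x) := by
      simpa using (continuous_const_add x).tendsto 0
    exact this.eventually hd1
  rw [Asymptotics.isLittleO_iff]
  intro c hc
  obtain ⟨r, hr, hball⟩ := Metric.eventually_nhds_iff_ball.1 (hd1'.and (Asymptotics.isLittleO_iff.1 h2 hc))
  filter_upwards [Metric.ball_mem_nhds 0 hr] with u hu
  have hur : ‖u‖ < r := by simpa using hu
  -- By symmetry of `B` the derivative of `g` at `w` is `F'(x + w) - B w`, within `c ‖u‖` of `F'(x)`
  -- on the ball of radius `‖u‖`; the mean value inequality then yields the remainder `c ‖u‖²`.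
  set g : E → ℝ := fun w => F (x + w) - 1 / 2 * B w w with hg
  have hgd : ∀ w ∈ Metric.closedBall (0 : E) ‖u‖,
      HasFDerivWithinAt g (fderiv ℝ F (x + w) - B w) (Metric.closedBall 0 ‖u‖) w := by
    intro w hw
    have hw' : w ∈ Metric.ball (0 : E) r := by
      rw [mem_ball_zero_iff]; exact (mem_closedBall_zero_iff.1 hw).trans_lt hur
    have e1 : HasFDerivAt (fun w => F (x + w)) (fderiv ℝ F (x + w)) w := by
      have := (hball w hw').1.hasFDerivAt.comp w ((hasFDerivAt_id w).const_add x)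
      rw [ContinuousLinearMap.comp_id] at this
      exact this
    have e2 : HasFDerivAt (fun w => B w w) (B w + B.flip w) w := by
      have := (B.hasFDerivAt (x := w)).clm_apply (hasFDerivAt_id w)
      simpa using this
    have e3 := (e1.sub (e2.const_mul (1 / 2))).hasFDerivWithinAt (s := Metric.closedBall 0 ‖u‖)
    have heq : fderiv ℝ F (x + w) - B w
        = fderiv ℝ F (x + w) - (1 / 2 : ℝ) • (B w + B.flip w) := by
      refine ContinuousLinearMap.ext fun z => ?_
      have : B z w = B w z := hsymm z w
      simp only [sub_apply, smul_apply, add_apply, ContinuousLinearMap.flip_apply, smul_eq_mul]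
      rw [this]; ring
    rw [heq]
    exact e3
  have hbound : ∀ w ∈ Metric.closedBall (0 : E) ‖u‖,
      ‖(fderiv ℝ F (x + w) - B w) - fderiv ℝ F x‖ ≤ c * ‖u‖ := by
    intro w hw
    have hw1 := mem_closedBall_zero_iff.1 hw
    have hw' : w ∈ Metric.ball (0 : E) r := by
      rw [mem_ball_zero_iff]; exact hw1.trans_lt hur
    calc _ = ‖fderiv ℝ F (x + w) - fderiv ℝ F x - B w‖ := by congr 1; abel
      _ ≤ c * ‖w‖ := (hball w hw').2
      _ ≤ c * ‖u‖ := by gcongr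
  have hmv := (convex_closedBall (0 : E) ‖u‖).norm_image_sub_le_of_norm_hasFDerivWithin_le' hgd
    hbound (x := 0) (y := u) (by simp) (by simp)
  simp only [hg, add_zero, map_zero, mul_zero, sub_zero] at hmv
  rw [norm_pow, norm_norm, sq, ← mul_assoc]
  have heq : F (x + u) - F x - fderiv ℝ F x u - 1 / 2 * B u u
      = F (x + u) - 1 / 2 * B u u - F x - fderiv ℝ F x u := by ring
  rw [heq]
  exact hmv

/-- For truncation arguments: the radius `R` is fixed first to make the tail small, and only then
does `m` grow, so `a` may depend on `R`. -/
lemma tendsto_zero_of_forall_le_add {p : ℕ → ENNReal} {A : ℝ}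
    (h : ∀ R : ℝ, 0 < R → ∃ a : ℕ → ENNReal, Tendsto a atTop (𝓝 0) ∧
      ∀ᶠ m in atTop, p m ≤ a m + ENNReal.ofReal (A / R ^ 2)) :
    Tendsto p atTop (𝓝 0) := by
  have hR : Tendsto (fun R : ℝ => ENNReal.ofReal (A / R ^ 2)) atTop (𝓝 0) := by
    rw [← ENNReal.ofReal_zero]
    exact ENNReal.tendsto_ofReal (tendsto_const_nhds.div_atTop (tendsto_pow_atTop (by norm_num)))
  rw [ENNReal.tendsto_nhds_zero] at hR ⊢
  intro ε hε
  obtain ⟨R, hRε, hR0⟩ := ((hR (ε / 2) (ENNReal.half_pos hε.ne')).and (eventually_gt_atTop 0)).exists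
  obtain ⟨a, ha, hle⟩ := h R hR0
  filter_upwards [hle, ENNReal.tendsto_nhds_zero.1 ha (ε / 2) (ENNReal.half_pos hε.ne')]
    with m h1 h2
  exact h1.trans ((add_le_add h2 hRε).trans (ENNReal.add_halves ε).le)

section

variable {𝒴 Ω ι : Type*} [MeasurableSpace 𝒴] [MeasurableSpace Ω] [Fintype ι] {μ : Measure 𝒴}
    {P : Measure Ω} [IsProbabilityMeasure P] {Y : ℕ → Ω → 𝒴}

/-- Normalised sums of centred vectors are bounded in probability. -/
lemma exists_measure_norm_sum_ge_le (hindep : iIndepFun Y P) (hlaw : ∀ i, HasLaw (Y i) μ P)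
    {H : 𝒴 → EuclideanSpace ℝ ι} (hH : MemLp H 2 μ) (hH0 : ∀ i, ∫ y, H y i ∂μ = 0) :
    ∃ A : ℝ, 0 ≤ A ∧ ∀ R : ℝ, 0 < R → ∀ m : ℕ, 0 < m →
      P {ω | R ≤ ‖(√(m : ℝ))⁻¹ • ∑ i ∈ Finset.range m, H (Y i ω)‖} ≤ ENNReal.ofReal (A / R ^ 2) := by
  have hcoord (i : ι) : MemLp (fun y => H y i) 2 μ :=
    hH.mono ((EuclideanSpace.proj (𝕜 := ℝ) i).continuous.comp_aestronglyMeasurable hH.1)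
      (Eventually.of_forall fun y => PiLp.norm_apply_le (H y) i)
  -- One more than the dimension, so that the final comparison is strict, also in dimension zero.
  set d : ℝ := Fintype.card ι + 1 with hd
  have hd0 : 0 < d := by positivity
  refine ⟨∑ j, d ^ 2 * ∫ y, H y j ^ 2 ∂μ, Finset.sum_nonneg fun j _ => by
    have : 0 ≤ ∫ y, H y j ^ 2 ∂μ := integral_nonneg fun y => sq_nonneg _
    positivity, fun R hR m hm => ?_⟩
  have hm' : (0 : ℝ) < m := by exact_mod_cast hm
  have hsm : 0 < √(m : ℝ) := Real.sqrt_pos.2 hm'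
  have hj (j : ι) : P {ω | √(m : ℝ) * (R / d) ≤
      |∑ i ∈ Finset.range m, H (Y i ω) j - m * ∫ y, H y j ∂μ|}
      ≤ ENNReal.ofReal (d ^ 2 * (∫ y, H y j ^ 2 ∂μ) / R ^ 2) := by
    refine (measure_abs_sum_sub_ge_le hindep hlaw (hcoord j) m (by positivity)).trans
      (ENNReal.ofReal_le_ofReal (le_of_eq ?_))
    rw [mul_pow, Real.sq_sqrt hm'.le]
    field_simp
  rw [Finset.sum_div, ENNReal.ofReal_sum_of_nonneg fun j _ => by
    have : 0 ≤ ∫ y, H y j ^ 2 ∂μ := integral_nonneg fun y => sq_nonneg _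
    positivity]
  refine le_trans (measure_mono ?_) ((measure_biUnion_finset_le Finset.univ _).trans
    (Finset.sum_le_sum fun j _ => hj j))
  intro ω hω
  by_contra hcon
  simp only [Set.mem_iUnion, Finset.mem_univ, exists_true_left, not_exists, Set.mem_ofPred_eq,
    hH0, mul_zero, sub_zero, not_le] at hcon
  set w := ∑ i ∈ Finset.range m, H (Y i ω) with hw
  have h1 : ‖w‖ ≤ ∑ j, |w j| := by
    rw [EuclideanSpace.norm_eq]
    refine Real.sqrt_le_iff.2 ⟨Finset.sum_nonneg fun j _ => abs_nonneg _, ?_⟩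
    simp only [Real.norm_eq_abs]
    exact Finset.sum_sq_le_sq_sum_of_nonneg fun j _ => abs_nonneg _
  have h2 : ∑ j, |w j| ≤ ∑ _j : ι, √(m : ℝ) * (R / d) := by
    refine Finset.sum_le_sum fun j _ => ?_
    have := (hcon j).le
    simpa [hw] using this
  simp only [Finset.sum_const, Finset.card_univ, nsmul_eq_mul] at h2
  have h3 : R ≤ (√(m : ℝ))⁻¹ * ‖w‖ := by
    have := Set.mem_ofPred_eq ▸ hω
    rwa [norm_smul, norm_inv, Real.norm_of_nonneg hsm.le] at this
  have h4 : √(m : ℝ) * R ≤ ‖w‖ := by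
    rwa [← div_eq_inv_mul, le_div_iff₀ hsm, mul_comm] at h3
  have h5 : (Fintype.card ι : ℝ) * (√(m : ℝ) * (R / d)) < √(m : ℝ) * R := by
    have : (Fintype.card ι : ℝ) < d := by rw [hd]; linarith
    calc (Fintype.card ι : ℝ) * (√(m : ℝ) * (R / d)) < d * (√(m : ℝ) * (R / d)) := by
          gcongr
      _ = √(m : ℝ) * R := by field_simp
  linarith

end

end LTA


/-! ### Local quadratic approximation and asymptotic linearity. -/

namespace LTA

namespace SemiconvexCriterion

variable {𝒴 Ω ι : Type*} [MeasurableSpace 𝒴] [MeasurableSpace Ω] [Fintype ι] {μ : Measure 𝒴}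
    {f : 𝒴 → EuclideanSpace ℝ ι → ℝ} {Θ U : Set (EuclideanSpace ℝ ι)} {L : 𝒴 → ℝ}
    {η₀ : EuclideanSpace ℝ ι} {P : Measure Ω} [IsProbabilityMeasure P] {Y : ℕ → Ω → 𝒴}
    {est : ℕ → Ω → EuclideanSpace ℝ ι}
    {B : EuclideanSpace ℝ ι →L[ℝ] EuclideanSpace ℝ ι →L[ℝ] ℝ}
    {H : 𝒴 → EuclideanSpace ℝ ι}

lemma tendsto_inv_sqrt_smul {E : Type*} [NormedAddCommGroup E] [NormedSpace ℝ E] (v : E) :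
    Tendsto (fun m : ℕ => (√(m : ℝ))⁻¹ • v) atTop (𝓝 0) := by
  have : Tendsto (fun m : ℕ => (√(m : ℝ))⁻¹) atTop (𝓝 0) :=
    (Real.tendsto_sqrt_atTop.comp tendsto_natCast_atTop_atTop).inv_tendsto_atTop
  simpa using this.smul_const v

/-- Quadratic approximation of the sample criterion function at the scale `1 / √m`. -/
lemma tendsto_measure_abs_sum_sub_quadratic_ge [IsProbabilityMeasure μ]
    (h : SemiconvexCriterion μ f Θ L)
    (hindep : iIndepFun Y P) (hlaw : ∀ i, HasLaw (Y i) μ P) (h₀ : η₀ ∈ interior Θ)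
    (hd : ∀ᵐ y ∂μ, DifferentiableAt ℝ (f y) η₀) (hgrad : ∫ y, fderiv ℝ (f y) η₀ ∂μ = 0)
    (hH : ∀ y v, B (H y) v = -fderiv ℝ (f y) η₀ v)
    (htaylor : (fun u => ∫ y, f y (η₀ + u) ∂μ - ∫ y, f y η₀ ∂μ - 1 / 2 * B u u)
      =o[𝓝 0] fun u => ‖u‖ ^ 2) (v : EuclideanSpace ℝ ι) {ε : ℝ} (hε : 0 < ε) :
    Tendsto (fun m : ℕ => P {ω | ε ≤ |∑ i ∈ Finset.range m,
      (f (Y i ω) (η₀ + (√(m : ℝ))⁻¹ • v) - f (Y i ω) η₀) - (1 / 2 * B v v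
        - B ((√(m : ℝ))⁻¹ • ∑ i ∈ Finset.range m, H (Y i ω)) v)|}) atTop (𝓝 0) := by
  -- The criterion increment splits into the gradient part, which is `-B w v` by the choice of `H`,
  -- and the sum of remainders. The latter has mean close to `B v v / 2` by Taylor, and its variance
  -- is at most `‖v‖² ∫ (ρ / ‖u‖)²`, which tends to zero because `m ‖u‖² = ‖v‖²`.
  set ρ : EuclideanSpace ℝ ι → 𝒴 → ℝ := fun u y =>
    f y (η₀ + u) - f y η₀ - fderiv ℝ (f y) η₀ u with hρ
  have hGint : Integrable (fun y => fderiv ℝ (f y) η₀) μ := (h.hasFDerivAt_integral h₀ hd).1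
  have hGv (u : EuclideanSpace ℝ ι) : MemLp (fun y => fderiv ℝ (f y) η₀ u) 2 μ := by
    refine (h.memLp.mul_const ‖u‖).mono
      ((ContinuousLinearMap.apply ℝ ℝ u).continuous.comp_aestronglyMeasurable
        (h.aestronglyMeasurable_fderiv h₀ hd)) (Eventually.of_forall fun y => ?_)
    refine ((fderiv ℝ (f y) η₀).le_opNorm u).trans ((mul_le_mul_of_nonneg_right
      (h.norm_fderiv_le h₀ y) (norm_nonneg u)).trans (le_abs_self _))
  have hGv0 (u : EuclideanSpace ℝ ι) : ∫ y, fderiv ℝ (f y) η₀ u ∂μ = 0 := by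
    rw [← ContinuousLinearMap.integral_apply hGint, hgrad]; rfl
  have h0Θ : η₀ ∈ Θ := interior_subset h₀
  have hvt := tendsto_inv_sqrt_smul v
  have hΘ : ∀ᶠ m : ℕ in atTop, η₀ + (√(m : ℝ))⁻¹ • v ∈ Θ := by
    have : Tendsto (fun m : ℕ => η₀ + (√(m : ℝ))⁻¹ • v) atTop (𝓝 η₀) := by
      simpa using hvt.const_add η₀
    exact this (mem_interior_iff_mem_nhds.1 h₀)
  -- the mean
  have hmean : ∀ᶠ m : ℕ in atTop,
      |m * (∫ y, f y (η₀ + (√(m : ℝ))⁻¹ • v) ∂μ - ∫ y, f y η₀ ∂μ) - 1 / 2 * B v v| ≤ ε / 2 := by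
    set c := ε / (2 * (‖v‖ ^ 2 + 1)) with hc
    have h1 := hvt.eventually (Asymptotics.isLittleO_iff.1 htaylor (c := c) (by positivity))
    filter_upwards [h1, eventually_gt_atTop 0] with m h2 hm
    have hm' : (0 : ℝ) < m := by exact_mod_cast hm
    have hsm : 0 < √(m : ℝ) := Real.sqrt_pos.2 hm'
    have hsq : (√(m : ℝ))⁻¹ * (√(m : ℝ))⁻¹ = (m : ℝ)⁻¹ := by
      rw [← mul_inv, Real.mul_self_sqrt hm'.le]
    simp only [map_smul, smul_apply, smul_eq_mul, norm_smul, norm_inv, norm_pow, norm_mul,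
      Real.norm_of_nonneg hsm.le, norm_norm, mul_pow, sq (√(m : ℝ))⁻¹, hsq] at h2
    have e1 : m * (∫ y, f y (η₀ + (√(m : ℝ))⁻¹ • v) ∂μ - ∫ y, f y η₀ ∂μ) - 1 / 2 * B v v
        = m * (∫ y, f y (η₀ + (√(m : ℝ))⁻¹ • v) ∂μ - ∫ y, f y η₀ ∂μ
          - 1 / 2 * ((√(m : ℝ))⁻¹ * ((√(m : ℝ))⁻¹ * B v v))) := by
      rw [← mul_assoc (√(m : ℝ))⁻¹, hsq]; field_simp
    rw [Real.norm_of_nonneg hm'.le] at h2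
    rw [e1, abs_mul, abs_of_pos hm', ← Real.norm_eq_abs]
    calc _ ≤ m * (c * ((m : ℝ)⁻¹ * ‖v‖ ^ 2)) := by gcongr
      _ = c * ‖v‖ ^ 2 := by field_simp
      _ ≤ c * (‖v‖ ^ 2 + 1) := by gcongr; linarith
      _ = ε / 2 := by rw [hc]; field_simp
  have hrem := (h.tendsto_integral_remainder_sq h₀ hd).comp hvt
  have hbound : Tendsto (fun m : ℕ => ENNReal.ofReal (4 / ε ^ 2 * (‖v‖ ^ 2 *
      ∫ y, (ρ ((√(m : ℝ))⁻¹ • v) y / ‖(√(m : ℝ))⁻¹ • v‖) ^ 2 ∂μ))) atTop (𝓝 0) := by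
    rw [← ENNReal.ofReal_zero]
    refine ENNReal.tendsto_ofReal ?_
    have := (hrem.const_mul (‖v‖ ^ 2)).const_mul (4 / ε ^ 2)
    rw [mul_zero, mul_zero] at this
    exact this
  refine tendsto_of_tendsto_of_tendsto_of_le_of_le' tendsto_const_nhds hbound
    (Eventually.of_forall fun _ => zero_le) ?_
  filter_upwards [hΘ, hmean, eventually_gt_atTop 0] with m hmΘ hmm hm
  have hm' : (0 : ℝ) < m := by exact_mod_cast hm
  have hsm : 0 < √(m : ℝ) := Real.sqrt_pos.2 hm'
  set u := (√(m : ℝ))⁻¹ • v with hu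
  have hρ2 : MemLp (ρ u) 2 μ := (h.memLp_sub hmΘ h0Θ).sub (hGv u)
  have hρint : ∫ y, ρ u y ∂μ = ∫ y, f y (η₀ + u) ∂μ - ∫ y, f y η₀ ∂μ := by
    have i1 := h.integrable _ hmΘ
    have i2 := h.integrable _ h0Θ
    have i3 : Integrable (fun y => f y (η₀ + u) - f y η₀) μ := i1.sub i2
    simp only [hρ]
    rw [integral_sub i3 ((hGv u).integrable (by norm_num)), integral_sub i1 i2, hGv0, sub_zero]
  have hch := measure_abs_sum_sub_ge_le hindep hlaw hρ2 m (half_pos hε)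
  refine (measure_mono fun ω hω => ?_).trans (hch.trans (ENNReal.ofReal_le_ofReal ?_))
  · simp only [Set.mem_ofPred_eq] at hω ⊢
    rw [hρint]
    have e2 : ∑ i ∈ Finset.range m, ρ u (Y i ω)
        = ∑ i ∈ Finset.range m, (f (Y i ω) (η₀ + u) - f (Y i ω) η₀)
          + B ((√(m : ℝ))⁻¹ • ∑ i ∈ Finset.range m, H (Y i ω)) v := by
      simp only [hρ, Finset.sum_sub_distrib, map_smul, map_sum, smul_apply, sum_apply, hH,
        smul_eq_mul, Finset.sum_neg_distrib, hu, ← Finset.mul_sum]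
      ring
    rw [e2]
    set S := ∑ i ∈ Finset.range m, (f (Y i ω) (η₀ + u) - f (Y i ω) η₀)
    set b := B ((√(m : ℝ))⁻¹ • ∑ i ∈ Finset.range m, H (Y i ω)) v
    set e := m * (∫ y, f y (η₀ + u) ∂μ - ∫ y, f y η₀ ∂μ)
    have e3 : S - (1 / 2 * B v v - b) = (S + b - e) + (e - 1 / 2 * B v v) := by ring
    rw [e3] at hω
    have := abs_add_le (S + b - e) (e - 1 / 2 * B v v)
    linarith
  · have e4 : ∫ y, ρ u y ^ 2 ∂μ = ‖u‖ ^ 2 * ∫ y, (ρ u y / ‖u‖) ^ 2 ∂μ := by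
      rw [← integral_const_mul]
      refine integral_congr_ae (Eventually.of_forall fun y => ?_)
      by_cases hu0 : u = 0
      · simp [hρ, hu0]
      · have : ‖u‖ ≠ 0 := norm_ne_zero_iff.2 hu0
        field_simp
    have e5 : m * ‖u‖ ^ 2 = ‖v‖ ^ 2 := by
      rw [hu, norm_smul, norm_inv, Real.norm_of_nonneg hsm.le, mul_pow, inv_pow,
        Real.sq_sqrt hm'.le]
      field_simp
    rw [e4, ← mul_assoc, e5]
    apply le_of_eq
    field_simp
    norm_num

/-- Asymptotic linearity of the maximisers of the sample criterion function. -/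
lemma tendsto_measure_norm_sub_sum_ge (h : SemiconvexCriterion μ f Θ L)
    (hindep : iIndepFun Y P) (hlaw : ∀ i, HasLaw (Y i) μ P) (hU : IsCompact U) (hUΘ : U ⊆ Θ)
    (h₀ : U ∈ 𝓝 η₀) (hmax : ∀ η ∈ U, η ≠ η₀ → ∫ y, f y η ∂μ < ∫ y, f y η₀ ∂μ)
    (hest : ∀ m ω, est m ω ∈ U ∧
      IsMaxOn (fun η => ∑ i ∈ Finset.range m, f (Y i ω) η) U (est m ω))
    (hd : ∀ᵐ y ∂μ, DifferentiableAt ℝ (f y) η₀) (hgrad : ∫ y, fderiv ℝ (f y) η₀ ∂μ = 0)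
    (hH : ∀ y v, B (H y) v = -fderiv ℝ (f y) η₀ v)
    (hH2 : MemLp H 2 μ) (hH0 : ∀ i, ∫ y, H y i ∂μ = 0)
    (htaylor : (fun u => ∫ y, f y (η₀ + u) ∂μ - ∫ y, f y η₀ ∂μ - 1 / 2 * B u u)
      =o[𝓝 0] fun u => ‖u‖ ^ 2)
    (hsymm : ∀ u v, B u v = B v u) {κ : ℝ} (hκ : 0 < κ) (hneg : ∀ u, B u u ≤ -κ * ‖u‖ ^ 2)
    {ε : ℝ} (hε : 0 < ε) :
    Tendsto (fun m : ℕ => P {ω | ε ≤ ‖√(m : ℝ) • (est m ω - η₀)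
      - (√(m : ℝ))⁻¹ • ∑ i ∈ Finset.range m, H (Y i ω)‖}) atTop (𝓝 0) := by
  have hprob : IsProbabilityMeasure μ := (hlaw 0).isProbabilityMeasure_iff.1 inferInstance
  have h₀U : η₀ ∈ U := mem_of_mem_nhds h₀
  have h₀Θ : η₀ ∈ interior Θ := mem_interior_iff_mem_nhds.2 (Filter.mem_of_superset h₀ hUΘ)
  obtain ⟨δ, hδ, hδU, hδquad⟩ : ∃ δ > 0, Metric.closedBall η₀ δ ⊆ U ∧ ∀ u, ‖u‖ ≤ δ →
      ∫ y, f y (η₀ + u) ∂μ - ∫ y, f y η₀ ∂μ ≤ -(κ / 4) * ‖u‖ ^ 2 := by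
    obtain ⟨δ₁, hδ₁, hb₁⟩ := Metric.nhds_basis_closedBall.mem_iff.1 h₀
    obtain ⟨δ₂, hδ₂, hb₂⟩ := Metric.nhds_basis_closedBall.mem_iff.1
      (Asymptotics.isLittleO_iff.1 htaylor (c := κ / 4) (by positivity))
    refine ⟨min δ₁ δ₂, lt_min hδ₁ hδ₂,
      (Metric.closedBall_subset_closedBall (min_le_left _ _)).trans hb₁, fun u hu => ?_⟩
    have h1 : u ∈ Metric.closedBall (0 : EuclideanSpace ℝ ι) δ₂ := by
      simpa using hu.trans (min_le_right _ _)
    have h2 := hb₂ h1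
    simp only [Set.mem_ofPred_eq, norm_pow, norm_norm] at h2
    have h3 := (le_abs_self _).trans h2
    have h4 := hneg u
    linarith
  set c := ∫ y, L y ∂μ + 1 with hc
  have hc0 : 0 < c := by have := integral_nonneg (μ := μ) (f := L) h.nonneg; positivity
  obtain ⟨A₁, hA₁⟩ := h.exists_measure_sqrt_mul_norm_ge_le hindep hlaw h₀U (κ := κ / 4)
    (by positivity) hδ hc0 (hδU.trans hUΘ) hδquad hest
  obtain ⟨A₂, hA₂0, hA₂⟩ := exists_measure_norm_sum_ge_le hindep hlaw hH2 hH0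
  -- `K ε₀²` collects the two net errors, semiconvexity at the estimator and curvature near `w`. The
  -- choices of `ε₀` and `ε₁` make `4 ε₁ + 2 K ε₀² ≤ κ ε² / 8`, which is less than `κ (ε / 2)²`.
  set K := c / 2 + ‖B‖ / 2 with hK
  have hK0 : 0 < K := by positivity
  set ε₀ := min 1 (min (ε / 2) √(κ * ε ^ 2 / (32 * K))) with hε₀
  have hε₀0 : 0 < ε₀ := by
    refine lt_min one_pos (lt_min (by positivity) (Real.sqrt_pos.2 (by positivity)))
  have hε₀1 : ε₀ ≤ 1 := min_le_left _ _
  have hε₀2 : ε₀ ≤ ε / 2 := (min_le_right _ _).trans (min_le_left _ _)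
  have hε₀3 : K * ε₀ ^ 2 ≤ κ * ε ^ 2 / 32 := by
    have : ε₀ ^ 2 ≤ κ * ε ^ 2 / (32 * K) := by
      rw [← Real.sq_sqrt (show 0 ≤ κ * ε ^ 2 / (32 * K) by positivity)]
      gcongr
      exact (min_le_right _ _).trans (min_le_right _ _)
    calc K * ε₀ ^ 2 ≤ K * (κ * ε ^ 2 / (32 * K)) := by gcongr
      _ = κ * ε ^ 2 / 32 := by field_simp
  set ε₁ := κ * ε ^ 2 / 64 with hε₁
  have hε₁0 : 0 < ε₁ := by positivity
  -- The rescaled estimator and `w` both lie in the ball of radius `R` up to probability of order `1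
  -- / R²`, once the consistency and law-of-large-numbers events are removed. The maximum with `0`
  -- is there because `A₁` has no known sign.
  refine tendsto_zero_of_forall_le_add (A := max A₁ 0 + A₂) fun R hR => ?_
  obtain ⟨G, hG⟩ := exists_finset_convexHull
    (isCompact_closedBall (0 : EuclideanSpace ℝ ι) R) hε₀0
  set quad : ℕ → EuclideanSpace ℝ ι → Set Ω := fun m v => {ω | ε₁ ≤ |∑ i ∈ Finset.range m,
      (f (Y i ω) (η₀ + (√(m : ℝ))⁻¹ • v) - f (Y i ω) η₀) - (1 / 2 * B v v
        - B ((√(m : ℝ))⁻¹ • ∑ i ∈ Finset.range m, H (Y i ω)) v)|} with hquad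
  refine ⟨fun m => P {ω | δ / 3 ≤ ‖est m ω - η₀‖}
    + P {ω | m * 1 ≤ |∑ i ∈ Finset.range m, L (Y i ω) - m * ∫ y, L y ∂μ|}
    + ∑ v ∈ G, P (quad m v), ?_, ?_⟩
  · have h1 := h.tendsto_measure_norm_sub_ge hindep hlaw hU hUΘ h₀U hmax hest
      (δ := δ / 3) (by positivity)
    have h2 := tendsto_measure_abs_sum_sub_ge hindep hlaw h.memLp one_pos
    have h3 := tendsto_finsetSum G fun v _ => h.tendsto_measure_abs_sum_sub_quadratic_ge hindep
      hlaw h₀Θ hd hgrad hH htaylor v hε₁0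
    have h4 := (h1.add h2).add h3
    rw [Finset.sum_const_zero, add_zero, add_zero] at h4
    exact h4
  -- Net points used are within `ε₀ ≤ 1` of the ball of radius `R`, so after rescaling they remain
  -- in `U`.
  have hsmall : ∀ᶠ m : ℕ in atTop, (√(m : ℝ))⁻¹ * (R + 1) ≤ δ := by
    have := (tendsto_inv_sqrt_smul (R + 1)).eventually_le_const hδ
    simpa using this
  filter_upwards [hsmall, eventually_gt_atTop 0] with m hmsmall hm
  have hm' : (0 : ℝ) < m := by exact_mod_cast hm
  have hsm : 0 < √(m : ℝ) := Real.sqrt_pos.2 hm'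
  have hfinal : ENNReal.ofReal (A₁ / R ^ 2) + ENNReal.ofReal (A₂ / R ^ 2)
      ≤ ENNReal.ofReal ((max A₁ 0 + A₂) / R ^ 2) := by
    rw [add_div, ENNReal.ofReal_add (by positivity) (by positivity)]
    gcongr
    exact le_max_left _ _
  refine le_trans ?_ (add_le_add le_rfl (hfinal.trans' (add_le_add (hA₁ R hR m hm) (hA₂ R hR m hm))))
  refine le_trans (measure_mono ?_) (((measure_union_le _ _).trans (add_le_add
    ((measure_union_le _ _).trans (add_le_add (measure_union_le _ _)
      (measure_biUnion_finset_le G (quad m)))) (measure_union_le _ _))))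
  intro ω hω
  by_contra hcon
  simp only [Set.mem_union, Set.mem_iUnion, Set.mem_ofPred_eq, not_or, not_exists, not_and,
    not_le, mul_one, hquad] at hcon hω
  obtain ⟨⟨⟨hc1, hc2⟩, hc3⟩, hc4, hc5⟩ := hcon
  have hsumL : ∑ i ∈ Finset.range m, L (Y i ω) < m * c := by
    have := (abs_lt.1 hc2).2; rw [hc]; linarith
  have hRest : √(m : ℝ) * ‖est m ω - η₀‖ < R := by
    by_contra! hcc
    exact hc4 hcc hc1 hsumL
  set w := (√(m : ℝ))⁻¹ • ∑ i ∈ Finset.range m, H (Y i ω) with hw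
  set g := √(m : ℝ) • (est m ω - η₀) with hg
  have hgR : ‖g‖ < R := by rwa [hg, norm_smul, Real.norm_of_nonneg hsm.le]
  have hgm : η₀ + (√(m : ℝ))⁻¹ • g = est m ω := by
    rw [hg, smul_smul, inv_mul_cancel₀ hsm.ne', one_smul, add_sub_cancel]
  have hnear (x v : EuclideanSpace ℝ ι) (hx : ‖x‖ < R) (hv : ‖v - x‖ < ε₀) :
      η₀ + (√(m : ℝ))⁻¹ • v ∈ U := by
    apply hδU
    rw [mem_closedBall_iff_norm, add_sub_cancel_left, norm_smul, norm_inv,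
      Real.norm_of_nonneg hsm.le]
    refine le_trans (mul_le_mul_of_nonneg_left ?_ (by positivity)) hmsmall
    have := norm_sub_norm_le v x
    linarith
  -- upper bound at the maximiser
  obtain ⟨v, hvG, hv, hle⟩ := h.exists_sum_le_of_mem_convexHull (m := m) (y := fun i => Y i ω)
    (η₀ := η₀) (s := (√(m : ℝ))⁻¹) (by positivity) (hG g (by simpa using hgR.le))
    fun v hv => hUΘ (hnear g v hgR hv)
  -- lower bound at a point close to the maximiser of the quadratic form
  obtain ⟨v', hv'G, hv'⟩ : ∃ v' ∈ G, ‖v' - w‖ < ε₀ := by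
    have h1 := hG w (by simpa using hc5.le)
    obtain ⟨v', hv'⟩ := convexHull_nonempty_iff.1 ⟨w, h1⟩
    exact ⟨v', hv'.1, hv'.2⟩
  have hmx : ∑ i ∈ Finset.range m, f (Y i ω) (η₀ + (√(m : ℝ))⁻¹ • v')
      ≤ ∑ i ∈ Finset.range m, f (Y i ω) (est m ω) := (hest m ω).2 (hnear w v' hc5 hv')
  have q1 := (abs_lt.1 (hc3 v hvG)).2
  have q2 := (abs_lt.1 (hc3 v' hv'G)).1
  rw [Finset.sum_sub_distrib] at q1 q2
  rw [hgm] at hle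
  -- Completing the square shows that the quadratic approximation is maximal at `w`.
  have hsq (x : EuclideanSpace ℝ ι) : 1 / 2 * B x x - B w x
      = 1 / 2 * B (x - w) (x - w) - 1 / 2 * B w w := by
    simp only [map_sub, sub_apply]
    rw [hsymm x w]; ring
  rw [hsq] at q1 q2
  have hL : (∑ i ∈ Finset.range m, L (Y i ω)) / 2 * ((√(m : ℝ))⁻¹ * ε₀) ^ 2 ≤ c / 2 * ε₀ ^ 2 := by
    rw [mul_pow, inv_pow, Real.sq_sqrt hm'.le]
    calc _ ≤ (m * c) / 2 * ((m : ℝ)⁻¹ * ε₀ ^ 2) := by gcongr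
      _ = _ := by field_simp
  have hB' : -(‖B‖ * ε₀ ^ 2) ≤ B (v' - w) (v' - w) := by
    have h1 := B.le_opNorm₂ (v' - w) (v' - w)
    have h2 : ‖B‖ * ‖v' - w‖ * ‖v' - w‖ ≤ ‖B‖ * ε₀ ^ 2 := by
      rw [mul_assoc, ← sq]; gcongr
    have h3 := neg_abs_le (B (v' - w) (v' - w))
    rw [Real.norm_eq_abs] at h1
    linarith
  have hBv := hneg (v - w)
  -- The criterion at the estimator is at most the quadratic at `v` plus errors, and at least the
  -- quadratic at `v'`, nearly its maximum, minus errors. Hence `B (v - w) (v - w)` is nearly zero,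
  -- and negative definiteness puts `v` near `w`.
  have hfin : κ * ‖v - w‖ ^ 2 ≤ 4 * ε₁ + 2 * (K * ε₀ ^ 2) := by
    rw [hK]; linarith
  have hvw : ‖v - w‖ < ε / 2 := by
    by_contra! hcc
    have : κ * (ε / 2) ^ 2 ≤ κ * ‖v - w‖ ^ 2 := by gcongr
    have h5 : 0 < κ * ε ^ 2 := by positivity
    rw [hε₁] at hfin
    linarith
  have := norm_sub_le_norm_sub_add_norm_sub g v w
  rw [norm_sub_rev g v] at this
  linarith

end SemiconvexCriterion

end LTA


namespace LTA

/-! ### The Hessian matrix at a local maximum. -/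

section Hessian

variable {K W : ℕ} {F : Param K W → ℝ} {η₀ : Param K W}

lemma hess_apply (hF : ContDiffAt ℝ 2 F η₀) (i j : Idx K W) :
    hess F η₀ i j = fderiv ℝ (fderiv ℝ F) η₀ (EuclideanSpace.single i 1)
      (EuclideanSpace.single j 1) := by
  have hd2 : DifferentiableAt ℝ (fderiv ℝ F) η₀ :=
    (hF.fderiv_right (m := 1) le_rfl).differentiableAt (by simp)
  have h1 : (fun η' => partialD F η' j)
      = fun η' => fderiv ℝ F η' (EuclideanSpace.single j 1) := rfl
  rw [hess, Matrix.of_apply, partialD, h1, fderiv_clm_apply hd2 (by fun_prop)]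
  simp

lemma fderiv_fderiv_apply (hF : ContDiffAt ℝ 2 F η₀) (u v : Param K W) :
    fderiv ℝ (fderiv ℝ F) η₀ u v = (u : Idx K W → ℝ) ⬝ᵥ (hess F η₀).mulVec v := by
  set B := fderiv ℝ (fderiv ℝ F) η₀ with hB
  conv_lhs => rw [← (EuclideanSpace.basisFun (Idx K W) ℝ).sum_repr u,
    ← (EuclideanSpace.basisFun (Idx K W) ℝ).sum_repr v]
  simp only [map_sum, map_smul, sum_apply, smul_apply, smul_eq_mul,
    EuclideanSpace.basisFun_repr, EuclideanSpace.basisFun_apply, dotProduct, Matrix.mulVec,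
    Finset.mul_sum]
  refine (Finset.sum_congr rfl fun j _ => Finset.sum_congr rfl fun i _ => ?_).trans
    Finset.sum_comm
  rw [hess_apply hF]; ring

lemma hess_isSymm (hF : ContDiffAt ℝ 2 F η₀) : (hess F η₀).IsSymm := by
  ext i j
  rw [Matrix.transpose_apply, hess_apply hF, hess_apply hF]
  exact hF.isSymmSndFDerivAt (by simp) _ _

/-- At a local maximum with a nonsingular Hessian, the Hessian is negative definite. -/
lemma exists_fderiv_fderiv_le (hF : ContDiffAt ℝ 2 F η₀) (hmax : IsLocalMax F η₀)
    (hdet : IsUnit (hess F η₀).det) :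
    ∃ κ : ℝ, 0 < κ ∧ ∀ u, fderiv ℝ (fderiv ℝ F) η₀ u u ≤ -κ * ‖u‖ ^ 2 := by
  set B := fderiv ℝ (fderiv ℝ F) η₀ with hB
  have hnonpos (u : Param K W) : B u u ≤ 0 := by
    have ht := isLittleO_taylor_two hF
    rw [hmax.fderiv_eq_zero] at ht
    -- The expansion is taken at `t • u` with small `t ≠ 0`, where `F` does not exceed its value at
    -- `η₀`, and divided by `t²`.
    have key : ∀ c : ℝ, 0 < c → 1 / 2 * B u u ≤ c * ‖u‖ ^ 2 := by
      intro c hc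
      have h1 := Asymptotics.isLittleO_iff.1 ht hc
      have h2 : ∀ᶠ x in 𝓝 (0 : Param K W), F (η₀ + x) ≤ F η₀ := by
        have : Tendsto (fun x => η₀ + x) (𝓝 0) (𝓝 η₀) := by
          simpa using (continuous_const_add η₀).tendsto 0
        exact this.eventually hmax
      have hline : Tendsto (fun t : ℝ => t • u) (𝓝[≠] 0) (𝓝 0) := by
        have : Tendsto (fun t : ℝ => t • u) (𝓝 0) (𝓝 ((0 : ℝ) • u)) :=
          (tendsto_id (α := ℝ)).smul_const u
        rw [zero_smul] at this
        exact this.mono_left nhdsWithin_le_nhds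
      obtain ⟨t, ⟨h3, h4⟩, ht0⟩ := ((hline.eventually (h1.and h2)).and
        (self_mem_nhdsWithin : {(0 : ℝ)}ᶜ ∈ 𝓝[≠] 0)).exists
      have ht0' : t ≠ 0 := ht0
      have h5 := (neg_abs_le _).trans' (neg_le_neg h3)
      simp only [map_smul, smul_apply, smul_eq_mul, norm_smul, zero_apply, mul_zero, sub_zero,
        Real.norm_eq_abs, mul_pow, sq_abs] at h5
      rw [abs_of_nonneg (by positivity), ← hB] at h5
      have h6 : t ^ 2 * (1 / 2 * B u u) ≤ t ^ 2 * (c * ‖u‖ ^ 2) := by linarith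
      exact le_of_mul_le_mul_left h6 (by positivity)
    have h0 : 1 / 2 * B u u ≤ 0 := by
      have : Tendsto (fun c : ℝ => c * ‖u‖ ^ 2) (𝓝[>] 0) (𝓝 (0 * ‖u‖ ^ 2)) :=
        ((tendsto_id (α := ℝ)).mul_const _).mono_left nhdsWithin_le_nhds
      rw [zero_mul] at this
      exact ge_of_tendsto this (by filter_upwards [self_mem_nhdsWithin] with c hc using key c hc)
    linarith
  have hpsd : (-hess F η₀).PosSemidef := by
    refine Matrix.PosSemidef.of_dotProduct_mulVec_nonneg ?_ fun x => ?_
    · have := (hess_isSymm hF).neg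
      rwa [Matrix.IsHermitian, Matrix.conjTranspose_eq_transpose_of_trivial]
    · have h1 := hnonpos (WithLp.toLp 2 x)
      rw [hB, fderiv_fderiv_apply hF] at h1
      simpa [Matrix.neg_mulVec] using h1
  have hpd : (-hess F η₀).PosDef := by
    rw [hpsd.posDef_iff_isUnit, Matrix.isUnit_iff_isUnit_det, Matrix.det_neg]
    exact (IsUnit.pow _ isUnit_one.neg).mul hdet
  have hneg (u : Param K W) (hu : u ≠ 0) : B u u < 0 := by
    have h1 := hpd.dotProduct_mulVec_pos (x := (u : Idx K W → ℝ)) (by simpa using hu)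
    rw [hB, fderiv_fderiv_apply hF]
    simpa [Matrix.neg_mulVec] using h1
  -- The sphere is empty when there are no coordinates; otherwise the maximum of the form on it
  -- supplies `-κ`.
  rcases (Metric.sphere (0 : Param K W) 1).eq_empty_or_nonempty with he | hne
  · refine ⟨1, one_pos, fun u => ?_⟩
    have hu : u = 0 := by
      by_contra hu
      have : (‖u‖⁻¹ • u) ∈ Metric.sphere (0 : Param K W) 1 := by
        rw [mem_sphere_zero_iff_norm, norm_smul, norm_inv, norm_norm,
          inv_mul_cancel₀ (norm_ne_zero_iff.2 hu)]
      rw [he] at this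
      exact this
    simp [hu]
  · have hcont : Continuous fun u : Param K W => B u u := by fun_prop
    obtain ⟨w, hw, hwmax⟩ := (isCompact_sphere (0 : Param K W) 1).exists_isMaxOn hne
      hcont.continuousOn
    have hw0 : w ≠ 0 := by
      rintro rfl
      simp at hw
    refine ⟨-B w w, neg_pos.2 (hneg w hw0), fun u => ?_⟩
    by_cases hu : u = 0
    · simp [hu]
    have hun : 0 < ‖u‖ := norm_pos_iff.2 hu
    have hmem : (‖u‖⁻¹ • u) ∈ Metric.sphere (0 : Param K W) 1 := by
      rw [mem_sphere_zero_iff_norm, norm_smul, norm_inv, norm_norm, inv_mul_cancel₀ hun.ne']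
    have h1 : B (‖u‖⁻¹ • u) (‖u‖⁻¹ • u) ≤ B w w := hwmax hmem
    simp only [map_smul, smul_apply, smul_eq_mul] at h1
    rw [neg_neg]
    calc B u u = ‖u‖ ^ 2 * (‖u‖⁻¹ * (‖u‖⁻¹ * B u u)) := by field_simp
      _ ≤ ‖u‖ ^ 2 * B w w := by gcongr
      _ = B w w * ‖u‖ ^ 2 := mul_comm _ _

end Hessian

/-! ### Asymptotic normality with the sandwich covariance. -/

namespace SemiconvexCriterion

variable {𝒴 Ω : Type*} {K W : ℕ} [MeasurableSpace 𝒴] [MeasurableSpace Ω] {μ : Measure 𝒴}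
    {f : 𝒴 → Param K W → ℝ} {Θ U : Set (Param K W)} {L : 𝒴 → ℝ} {η₀ : Param K W}
    {P : Measure Ω} [IsProbabilityMeasure P] {Y : ℕ → Ω → 𝒴} {est : ℕ → Ω → Param K W}

/-- A maximiser with a nonsingular Hessian is an isolated maximiser. -/
lemma exists_isCompact_lt {F : Param K W → ℝ} (h₀ : Θ ∈ 𝓝 η₀)
    (hmax : IsMaxOn F Θ η₀) (hF : ContDiffAt ℝ 2 F η₀)
    (hdet : IsUnit (hess F η₀).det) :
    ∃ U ∈ 𝓝 η₀, IsCompact U ∧ U ⊆ Θ ∧ ∀ η ∈ U, η ≠ η₀ → F η < F η₀ := by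
  have hloc : IsLocalMax F η₀ := hmax.isLocalMax h₀
  obtain ⟨κ, hκ, hneg⟩ := exists_fderiv_fderiv_le hF hloc hdet
  have ht := isLittleO_taylor_two hF
  rw [hloc.fderiv_eq_zero] at ht
  obtain ⟨δ₁, hδ₁, hb₁⟩ := Metric.nhds_basis_closedBall.mem_iff.1 h₀
  obtain ⟨δ₂, hδ₂, hb₂⟩ := Metric.nhds_basis_closedBall.mem_iff.1
    (Asymptotics.isLittleO_iff.1 ht (c := κ / 4) (by positivity))
  refine ⟨Metric.closedBall η₀ (min δ₁ δ₂), Metric.closedBall_mem_nhds _ (lt_min hδ₁ hδ₂),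
    isCompact_closedBall _ _, (Metric.closedBall_subset_closedBall (min_le_left _ _)).trans hb₁,
    fun η hη hne => ?_⟩
  have hη' : η - η₀ ∈ Metric.closedBall (0 : Param K W) δ₂ := by
    rw [mem_closedBall_zero_iff, ← dist_eq_norm]
    exact (Metric.mem_closedBall.1 hη).trans (min_le_right _ _)
  have h2 := hb₂ hη'
  simp only [Set.mem_ofPred_eq, norm_pow, norm_norm, add_sub_cancel, zero_apply, sub_zero] at h2
  have h3 := (le_abs_self _).trans h2
  have h4 := hneg (η - η₀)
  have h5 : 0 < ‖η - η₀‖ ^ 2 := by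
    have := norm_pos_iff.2 (sub_ne_zero.2 hne)
    positivity
  nlinarith

/-- Asymptotic normality, with the sandwich covariance matrix, of the maximisers of a semiconvex
sample criterion function. -/
theorem tendstoInDistribution_est (h : SemiconvexCriterion μ f Θ L)
    (hindep : iIndepFun Y P) (hlaw : ∀ i, HasLaw (Y i) μ P) (hU : IsCompact U) (hUΘ : U ⊆ Θ)
    (h₀ : U ∈ 𝓝 η₀) (hmax : ∀ η ∈ U, η ≠ η₀ → ∫ y, f y η ∂μ < ∫ y, f y η₀ ∂μ)
    (hC2 : ContDiffAt ℝ 2 (fun η => ∫ y, f y η ∂μ) η₀)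
    (hdet : IsUnit (hess (fun η => ∫ y, f y η ∂μ) η₀).det)
    (hmeas : ∀ m, AEMeasurable (est m) P)
    (hest : ∀ m ω, est m ω ∈ U ∧
      IsMaxOn (fun η => ∑ i ∈ Finset.range m, f (Y i ω) η) U (est m ω)) :
    TendstoInDistribution (fun (m : ℕ) ω => √(m : ℝ) • (est m ω - η₀)) atTop
      (id : Param K W → Param K W) (fun _ => P)
      (multivariateGaussian 0 ((hess (fun η => ∫ y, f y η ∂μ) η₀)⁻¹ *
        Matrix.of (fun i j => ∫ y, partialD (f y) η₀ i * partialD (f y) η₀ j ∂μ) *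
        (hess (fun η => ∫ y, f y η ∂μ) η₀)⁻¹)) := by
  have hprob : IsProbabilityMeasure μ := (hlaw 0).isProbabilityMeasure_iff.1 inferInstance
  set F : Param K W → ℝ := fun η => ∫ y, f y η ∂μ with hFdef
  have h₀U : η₀ ∈ U := mem_of_mem_nhds h₀
  have h₀Θ : η₀ ∈ interior Θ := mem_interior_iff_mem_nhds.2 (Filter.mem_of_superset h₀ hUΘ)
  have hloc : IsLocalMax F η₀ := by
    filter_upwards [h₀] with η hη
    by_cases hne : η = η₀
    · rw [hne]
    · exact (hmax η hη hne).le
  obtain ⟨κ, hκ, hneg⟩ := exists_fderiv_fderiv_le hC2 hloc hdet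
  have hd := h.ae_differentiableAt h₀Θ (hC2.differentiableAt (by simp))
  obtain ⟨hGint, hGder⟩ := h.hasFDerivAt_integral h₀Θ hd
  have hgrad : ∫ y, fderiv ℝ (f y) η₀ ∂μ = 0 := by
    rw [← hGder.fderiv]; exact hloc.fderiv_eq_zero
  have htaylor := isLittleO_taylor_two hC2
  rw [hloc.fderiv_eq_zero] at htaylor
  simp only [zero_apply, sub_zero] at htaylor
  set A := hess F η₀ with hA
  have hAsymm : A.IsSymm := hess_isSymm hC2
  have hAinv : A⁻¹.IsSymm := by rw [Matrix.IsSymm, Matrix.transpose_nonsing_inv, hAsymm]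
  -- the influence function
  set T : (Param K W →L[ℝ] ℝ) →L[ℝ] Param K W := LinearMap.toContinuousLinearMap
    ((WithLp.linearEquiv 2 ℝ (Idx K W → ℝ)).symm.toLinearMap ∘ₗ (-A⁻¹).mulVecLin ∘ₗ
      LinearMap.pi fun i =>
        (ContinuousLinearMap.apply ℝ ℝ (EuclideanSpace.single i (1 : ℝ))).toLinearMap) with hT
  have hTi (G : Param K W →L[ℝ] ℝ) (i : Idx K W) :
      T G i = -∑ k, A⁻¹ i k * G (EuclideanSpace.single k 1) := by
    simp [hT, Matrix.mulVec, dotProduct]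
  -- `T G` is `-A⁻¹` applied to the coordinates of `G`; symmetry of `A` lets the Hessian form cancel
  -- the inverse in its first argument.
  have hTB (G : Param K W →L[ℝ] ℝ) (v : Param K W) :
      fderiv ℝ (fderiv ℝ F) η₀ (T G) v = -G v := by
    set g : Idx K W → ℝ := fun k => G (EuclideanSpace.single k 1) with hg
    have h1 : (T G : Idx K W → ℝ) = -(A⁻¹.mulVec g) := by
      funext i; rw [hTi]; rfl
    rw [fderiv_fderiv_apply hC2, h1, Matrix.dotProduct_mulVec, Matrix.neg_vecMul,
      ← Matrix.mulVec_transpose, hAsymm, Matrix.mulVec_mulVec, Matrix.mul_nonsing_inv _ hdet,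
      Matrix.one_mulVec, neg_dotProduct]
    conv_rhs => rw [← (EuclideanSpace.basisFun (Idx K W) ℝ).sum_repr v]
    simp [dotProduct, hg, mul_comm]
  have hG2 : MemLp (fun y => fderiv ℝ (f y) η₀) 2 μ :=
    h.memLp.mono (h.aestronglyMeasurable_fderiv h₀Θ hd) (Eventually.of_forall fun y =>
      (h.norm_fderiv_le h₀Θ y).trans (le_abs_self _))
  set H : 𝒴 → Param K W := fun y => T (fderiv ℝ (f y) η₀) with hHdef
  have hH2 : MemLp H 2 μ := T.comp_memLp' hG2
  have hH0 (i : Idx K W) : ∫ y, H y i ∂μ = 0 := by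
    have h1 : ∫ y, H y ∂μ = 0 := by
      rw [hHdef, T.integral_comp_comm hGint, hgrad, map_zero]
    have h2 := (EuclideanSpace.proj (𝕜 := ℝ) i).integral_comp_comm (hH2.integrable (by norm_num))
    rw [h1, map_zero] at h2
    exact h2
  have hclt := tendstoInDistribution_multivariateGaussian hindep hlaw hH2 hH0
  have hcov : Matrix.of (fun i j => ∫ y, H y i * H y j ∂μ) = A⁻¹ *
      Matrix.of (fun i j => ∫ y, partialD (f y) η₀ i * partialD (f y) η₀ j ∂μ) * A⁻¹ := by
    have hp (i : Idx K W) : MemLp (fun y => partialD (f y) η₀ i) 2 μ :=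
      (ContinuousLinearMap.apply ℝ ℝ (EuclideanSpace.single i (1 : ℝ))).comp_memLp' hG2
    have hpp (i j : Idx K W) : Integrable (fun y => partialD (f y) η₀ i * partialD (f y) η₀ j) μ :=
      (hp i).integrable_mul (hp j)
    ext i j
    have h1 (y : 𝒴) : H y i * H y j = ∑ l, ∑ k, A⁻¹ i k * A⁻¹ l j *
        (partialD (f y) η₀ k * partialD (f y) η₀ l) := by
      simp only [hHdef, hTi, neg_mul_neg]
      rw [Finset.sum_mul_sum, Finset.sum_comm]
      refine Finset.sum_congr rfl fun l _ => Finset.sum_congr rfl fun k _ => ?_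
      rw [← hAinv.apply l j]; simp only [partialD]; ring
    simp only [Matrix.of_apply, h1]
    rw [integral_finsetSum _ fun l _ => integrable_finsetSum _ fun k _ => (hpp k l).const_mul _]
    simp only [Matrix.mul_apply, Matrix.of_apply, Finset.sum_mul]
    refine Finset.sum_congr rfl fun l _ => ?_
    rw [integral_finsetSum _ fun k _ => (hpp k l).const_mul _]
    refine Finset.sum_congr rfl fun k _ => ?_
    rw [integral_const_mul]; ring
  rw [hcov] at hclt
  -- Slutsky's lemma: the rescaled estimator differs from the normalised sum of `H` by a term
  -- tending to zero in probability.
  refine tendstoInDistribution_of_tendstoInMeasure_sub _ _ hclt ?_ fun m =>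
    ((hmeas m).sub_const η₀).const_smul (√(m : ℝ))
  rw [tendstoInMeasure_iff_norm]
  intro ε hε
  have := h.tendsto_measure_norm_sub_sum_ge hindep hlaw hU hUΘ h₀ hmax hest hd hgrad
    (fun y v => hTB _ v) hH2 hH0 htaylor
    (fun u v => hC2.isSymmSndFDerivAt (by simp) u v) hκ hneg hε
  simpa using this

end SemiconvexCriterion

end LTA


namespace LTA

/-! ### Differentiation under the integral sign. -/

section DifferentiationUnderIntegral

variable {𝒴 : Type*} {K W : ℕ} [MeasurableSpace 𝒴] {μ : Measure 𝒴} {η₀ : Param K W}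

lemma fderiv_eq_sum_partialD (F : Param K W → ℝ) (η : Param K W) :
    fderiv ℝ F η = ∑ i, partialD F η i • (EuclideanSpace.proj i : Param K W →L[ℝ] ℝ) := by
  refine ContinuousLinearMap.ext fun v => ?_
  conv_lhs => rw [← (EuclideanSpace.basisFun (Idx K W) ℝ).sum_repr v]
  simp [mul_comm, partialD]

lemma norm_fderiv_le_of_partialD_le {F : Param K W → ℝ} {η : Param K W} {b : ℝ}
    (hb : ∀ i, |partialD F η i| ≤ b) : ‖fderiv ℝ F η‖ ≤ Fintype.card (Idx K W) * b := by
  rw [fderiv_eq_sum_partialD]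
  refine (norm_sum_le _ _).trans ?_
  rw [← nsmul_eq_mul, ← Finset.card_univ, ← Finset.sum_const]
  refine Finset.sum_le_sum fun i _ => ?_
  rw [norm_smul, Real.norm_eq_abs]
  have h1 : ‖(EuclideanSpace.proj i : Param K W →L[ℝ] ℝ)‖ ≤ 1 :=
    ContinuousLinearMap.opNorm_le_bound _ zero_le_one fun v => by
      simpa using PiLp.norm_apply_le v i
  calc _ ≤ |partialD F η i| * 1 := by gcongr
    _ ≤ b := by rw [mul_one]; exact hb i

/-- Continuous differentiability under the integral sign. -/
lemma contDiffOn_one_integral {g : 𝒴 → Param K W → ℝ} {V : Set (Param K W)} (hV : IsOpen V)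
    {b : 𝒴 → ℝ} (hb : Integrable b μ) (hi : ∀ η ∈ V, Integrable (fun y => g y η) μ)
    (hd : ∀ᵐ y ∂μ, ContDiffOn ℝ 1 (g y) V ∧ ∀ η ∈ V, ∀ i, |partialD (g y) η i| ≤ b y) :
    ContDiffOn ℝ 1 (fun η => ∫ y, g y η ∂μ) V ∧
      ∀ η ∈ V, ∀ i, partialD (fun η => ∫ y, g y η ∂μ) η i = ∫ y, partialD (g y) η i ∂μ := by
  have hdiff : ∀ᵐ y ∂μ, ∀ η ∈ V, DifferentiableAt ℝ (g y) η := hd.mono fun y hy η hη =>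
    (hy.1.differentiableOn (by simp)).differentiableAt (hV.mem_nhds hη)
  have hmeas (η : Param K W) (hη : η ∈ V) :
      AEStronglyMeasurable (fun y => fderiv ℝ (g y) η) μ :=
    aestronglyMeasurable_fderiv (hV.mem_nhds hη) (fun η' hη' => (hi η' hη').1)
      (hdiff.mono fun y hy => hy η hη)
  have hbound : ∀ᵐ y ∂μ, ∀ η ∈ V, ‖fderiv ℝ (g y) η‖ ≤ Fintype.card (Idx K W) * b y :=
    hd.mono fun y hy η hη => norm_fderiv_le_of_partialD_le (hy.2 η hη)
  have hbi : Integrable (fun y => Fintype.card (Idx K W) * b y) μ := hb.const_mul _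
  have hder (η : Param K W) (hη : η ∈ V) :
      HasFDerivAt (fun η => ∫ y, g y η ∂μ) (∫ y, fderiv ℝ (g y) η ∂μ) η :=
    hasFDerivAt_integral_of_dominated_of_fderiv_le (F := fun η y => g y η)
      (F' := fun η y => fderiv ℝ (g y) η) (hV.mem_nhds hη)
      (by filter_upwards [hV.mem_nhds hη] with η' hη' using (hi η' hη').1) (hi η hη) (hmeas η hη)
      hbound hbi (hdiff.mono fun y hy η' hη' => (hy η' hη').hasFDerivAt)
  constructor
  · have hcont : ContinuousOn (fun η => ∫ y, fderiv ℝ (g y) η ∂μ) V := by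
      refine continuousOn_of_dominated hmeas (fun η hη => hbound.mono fun y hy => hy η hη) hbi
        (hd.mono fun y hy => hy.1.continuousOn_fderiv_of_isOpen hV (by simp))
    rw [show (1 : WithTop ℕ∞) = 0 + 1 by simp, contDiffOn_succ_iff_fderiv_of_isOpen hV]
    refine ⟨fun η hη => (hder η hη).differentiableAt.differentiableWithinAt, by simp, ?_⟩
    rw [contDiffOn_zero]
    exact hcont.congr fun η hη => (hder η hη).fderiv
  · intro η hη i
    rw [partialD, (hder η hη).fderiv, ContinuousLinearMap.integral_apply]
    · rfl
    · exact hbi.mono' (hmeas η hη) (hbound.mono fun y hy => hy η hη)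

/-- A semiconvex criterion function with dominated second derivatives has a twice continuously
differentiable expectation, whose Hessian is the expected Hessian. -/
theorem SemiconvexCriterion.contDiffAt_and_hess_eq {f : 𝒴 → Param K W → ℝ}
    [IsProbabilityMeasure μ] {Θ : Set (Param K W)} {L : 𝒴 → ℝ}
    (h : SemiconvexCriterion μ f Θ L) (h₀ : η₀ ∈ interior Θ) {U : Set (Param K W)} (hU : U ∈ 𝓝 η₀)
    {b : 𝒴 → ℝ} (hb : Integrable b μ)
    (hd : ∀ᵐ y ∂μ, ContDiffOn ℝ 2 (f y) U ∧ ∀ η ∈ U, ∀ i j, |hess (f y) η i j| ≤ b y) :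
    ContDiffAt ℝ 2 (fun η => ∫ y, f y η ∂μ) η₀ ∧
      hess (fun η => ∫ y, f y η ∂μ) η₀ = Matrix.of fun i j => ∫ y, hess (f y) η₀ i j ∂μ := by
  set V := interior U ∩ interior Θ with hVdef
  have hV : IsOpen V := isOpen_interior.inter isOpen_interior
  have h₀V : η₀ ∈ V := ⟨mem_interior_iff_mem_nhds.2 hU, h₀⟩
  have hVU : V ⊆ U := fun η hη => interior_subset hη.1
  have hpb (y : 𝒴) (η : Param K W) (hη : η ∈ V) (i : Idx K W) : |partialD (f y) η i| ≤ L y := by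
    refine ((fderiv ℝ (f y) η).le_opNorm _).trans ?_
    simpa using h.norm_fderiv_le hη.2 y
  -- For first derivatives the Lipschitz constant `L` is already an integrable bound.
  obtain ⟨h1, h2⟩ := contDiffOn_one_integral (g := f) hV h.integrable_bound
    (fun η hη => h.integrable η (interior_subset hη.2))
    (hd.mono fun y hy => ⟨(hy.1.mono hVU).of_le (by norm_num), fun η hη i => hpb y η hη i⟩)
  have hdiff : ∀ᵐ y ∂μ, ∀ η ∈ V, DifferentiableAt ℝ (f y) η := hd.mono fun y hy η hη =>
    ((hy.1.mono hVU).differentiableOn (by simp)).differentiableAt (hV.mem_nhds hη)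
  have hint (j : Idx K W) (η : Param K W) (hη : η ∈ V) :
      Integrable (fun y => partialD (f y) η j) μ := by
    refine h.integrable_bound.mono' ?_ (Eventually.of_forall fun y => hpb y η hη j)
    exact (ContinuousLinearMap.apply ℝ ℝ _).continuous.comp_aestronglyMeasurable
      (h.aestronglyMeasurable_fderiv hη.2 (hdiff.mono fun y hy => hy η hη))
  have hC1 (y : 𝒴) (hy : ContDiffOn ℝ 2 (f y) U) (j : Idx K W) :
      ContDiffOn ℝ 1 (fun η => partialD (f y) η j) V :=
    ((hy.mono hVU).fderiv_of_isOpen hV (m := 1) (by norm_num)).clm_apply contDiffOn_const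
  -- The same result applied to each partial derivative, now dominated by the bound `b` on the
  -- second derivatives.
  have key (j : Idx K W) := contDiffOn_one_integral (g := fun y η => partialD (f y) η j) hV hb
    (hint j) (hd.mono fun y hy => ⟨hC1 y hy.1 j, fun η hη i => hy.2 η (hVU hη) i j⟩)
  have heq (j : Idx K W) : Set.EqOn (fun η => partialD (fun η => ∫ y, f y η ∂μ) η j)
      (fun η => ∫ y, partialD (f y) η j ∂μ) V := fun η hη => h2 η hη j
  constructor
  · refine ContDiffOn.contDiffAt (s := V) ?_ (hV.mem_nhds h₀V)
    rw [show (2 : WithTop ℕ∞) = 1 + 1 by norm_num, contDiffOn_succ_iff_fderiv_of_isOpen hV]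
    refine ⟨h1.differentiableOn (by simp), by simp, ?_⟩
    have : fderiv ℝ (fun η => ∫ y, f y η ∂μ) = fun η => ∑ i,
        partialD (fun η => ∫ y, f y η ∂μ) η i • (EuclideanSpace.proj i : Param K W →L[ℝ] ℝ) :=
      funext fun η => fderiv_eq_sum_partialD _ η
    rw [this]
    exact ContDiffOn.sum fun i _ => ((key i).1.congr (heq i)).smul contDiffOn_const
  · ext i j
    have h3 : (fun η => partialD (fun η => ∫ y, f y η ∂μ) η j)
        =ᶠ[𝓝 η₀] fun η => ∫ y, partialD (f y) η j ∂μ :=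
      Filter.eventuallyEq_of_mem (hV.mem_nhds h₀V) (heq j)
    rw [hess, Matrix.of_apply, partialD, h3.fderiv_eq]
    exact (key j).2 η₀ h₀V i

end DifferentiationUnderIntegral

end LTA


namespace LTA

/-! ### Laws with a normalised density, and Gibbs' inequality. -/

section NormalisedKernels

/-- A nonnegative kernel `w` on a measure space that can be normalised to a positive density. -/
structure IsKernel {X : Type*} [MeasurableSpace X] (ν : Measure X) (w : X → ℝ) : Prop where
  integrable : Integrable w ν
  pos : ∀ᵐ x ∂ν, 0 < w x
  ne_zero : ν ≠ 0

/-- The density obtained by normalising `w`. -/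
noncomputable def normDens {X : Type*} [MeasurableSpace X] (ν : Measure X) (w : X → ℝ) (x : X) : ℝ :=
  w x / ∫ x', w x' ∂ν

/-- The law with density `normDens ν w`. -/
noncomputable def normLaw {X : Type*} [MeasurableSpace X] (ν : Measure X) (w : X → ℝ) : Measure X :=
  ν.withDensity fun x => ENNReal.ofReal (normDens ν w x)

variable {X : Type*} [MeasurableSpace X] {ν : Measure X} {w w' : X → ℝ}

lemma IsKernel.integral_pos (h : IsKernel ν w) : 0 < ∫ x, w x ∂ν := by
  rw [integral_pos_iff_support_of_nonneg_ae (h.pos.mono fun x hx => hx.le) h.integrable]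
  have hu : ν (Function.support w)ᶜ = 0 := by
    refine measure_mono_null ?_ (ae_iff.1 h.pos)
    intro x hx
    have : w x = 0 := by simpa using hx
    simp [this]
  have h1 := measure_univ_le_add_compl (μ := ν) (Function.support w)
  rw [hu, add_zero] at h1
  refine lt_of_lt_of_le ?_ h1
  exact pos_iff_ne_zero.2 (by simpa using h.ne_zero)

lemma IsKernel.normDens_pos (h : IsKernel ν w) : ∀ᵐ x ∂ν, 0 < normDens ν w x :=
  h.pos.mono fun _ hx => div_pos hx h.integral_pos

lemma IsKernel.integrable_normDens (h : IsKernel ν w) : Integrable (normDens ν w) ν :=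
  h.integrable.div_const _

lemma IsKernel.integral_normDens (h : IsKernel ν w) : ∫ x, normDens ν w x ∂ν = 1 := by
  simp only [normDens, integral_div]
  exact div_self h.integral_pos.ne'

lemma IsKernel.isProbabilityMeasure (h : IsKernel ν w) : IsProbabilityMeasure (normLaw ν w) := by
  constructor
  rw [normLaw, withDensity_apply _ MeasurableSet.univ, Measure.restrict_univ,
    ← ofReal_integral_eq_lintegral_ofReal h.integrable_normDens
      (h.normDens_pos.mono fun x hx => hx.le), h.integral_normDens, ENNReal.ofReal_one]

lemma IsKernel.ae_law {p : X → Prop} (hp : ∀ᵐ x ∂ν, p x) : ∀ᵐ x ∂(normLaw ν w), p x :=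
  (withDensity_absolutelyContinuous _ _).ae_le hp

lemma IsKernel.integrable_law_iff (h : IsKernel ν w) {g : X → ℝ} :
    Integrable g (normLaw ν w) ↔ Integrable (fun x => normDens ν w x * g x) ν := by
  rw [normLaw, integrable_withDensity_iff_integrable_smul₀'
    (h.integrable_normDens.aemeasurable.ennreal_ofReal) (by simp)]
  refine integrable_congr (h.normDens_pos.mono fun x hx => ?_)
  simp [ENNReal.toReal_ofReal hx.le]

lemma IsKernel.integrable_law (h : IsKernel ν w) {g : X → ℝ}
    (hg : Integrable (fun x => g x * w x) ν) : Integrable g (normLaw ν w) := by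
  rw [h.integrable_law_iff]
  convert hg.div_const (∫ x', w x' ∂ν) using 2 with x
  rw [normDens]; ring

lemma IsKernel.integral_law (h : IsKernel ν w) (g : X → ℝ) :
    ∫ x, g x ∂(normLaw ν w) = ∫ x, normDens ν w x * g x ∂ν := by
  rw [normLaw, integral_withDensity_eq_integral_toReal_smul₀
    (h.integrable_normDens.aemeasurable.ennreal_ofReal) (by simp)]
  refine integral_congr_ae (h.normDens_pos.mono fun x hx => ?_)
  simp [ENNReal.toReal_ofReal hx.le]

/-- Gibbs' inequality for normalised kernels. -/
lemma IsKernel.integral_log_div_nonpos (h : IsKernel ν w) (h' : IsKernel ν w')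
    (hi : Integrable (fun x => Real.log (normDens ν w' x / normDens ν w x)) (normLaw ν w)) :
    ∫ x, Real.log (normDens ν w' x / normDens ν w x) ∂(normLaw ν w) ≤ 0 := by
  have := h.isProbabilityMeasure
  have hcongr : (fun x => normDens ν w x * (normDens ν w' x / normDens ν w x)) =ᵐ[ν]
      normDens ν w' := h.normDens_pos.mono fun x hx => mul_div_cancel₀ _ hx.ne'
  have hi2 : Integrable (fun x => normDens ν w' x / normDens ν w x) (normLaw ν w) := by
    rw [h.integrable_law_iff]
    exact h'.integrable_normDens.congr hcongr.symm
  calc _ ≤ ∫ x, (normDens ν w' x / normDens ν w x - 1) ∂(normLaw ν w) := by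
        refine integral_mono_ae hi (hi2.sub (integrable_const _)) ?_
        filter_upwards [IsKernel.ae_law h.normDens_pos, IsKernel.ae_law h'.normDens_pos] with x h1 h2
        exact Real.log_le_sub_one_of_pos (div_pos h2 h1)
    _ = 0 := by
        rw [integral_sub hi2 (integrable_const _), h.integral_law, integral_congr_ae hcongr,
          h'.integral_normDens]
        simp

end NormalisedKernels

/-! ### Integrability of Dirichlet kernels. -/

section Simplex

lemma measurable_gammaPDF (a r : ℝ) : Measurable (gammaPDF a r) :=
  (measurable_gammaPDFReal a r).ennreal_ofReal

lemma ae_expMeasure_pos : ∀ᵐ t ∂(expMeasure 1), 0 < t := by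
  rw [expMeasure, gammaMeasure, ae_withDensity_iff (measurable_gammaPDF 1 1)]
  have h0 : ∀ᵐ t : ℝ, t ≠ 0 := by simp [ae_iff]
  filter_upwards [h0] with t ht hpdf
  by_contra hlt
  exact hpdf (gammaPDF_of_neg (lt_of_le_of_ne (not_lt.1 hlt) ht))

instance : IsProbabilityMeasure (expMeasure 1) := isProbabilityMeasure_expMeasure one_pos

lemma integrable_rpow_expMeasure {s : ℝ} (hs : -1 < s) :
    Integrable (fun t : ℝ => t ^ s) (expMeasure 1) := by
  rw [expMeasure, gammaMeasure, integrable_withDensity_iff_integrable_smul'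
    (measurable_gammaPDF 1 1) (by simp [gammaPDF])]
  have h := integrableOn_rpow_mul_exp_neg_mul_rpow hs one_pos one_pos
  have h2 := (integrable_indicator_iff measurableSet_Ioi).2 h
  refine h2.congr ?_
  have h0 : ∀ᵐ t : ℝ, t ≠ 0 := by simp [ae_iff]
  filter_upwards [h0] with t ht
  rcases lt_or_gt_of_ne ht with h | h
  · rw [gammaPDF_of_neg h, Set.indicator_of_notMem (by simp [h.le])]; simp
  · rw [gammaPDF_of_nonneg h.le, Set.indicator_of_mem (by simpa using h), ENNReal.toReal_ofReal]
    · simp [mul_comm]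
    · simp [Real.exp_nonneg]

lemma integrable_rpow_mul_pow_expMeasure (n : ℕ) {s : ℝ} (hs : -1 < s) :
    Integrable (fun t : ℝ => t ^ s * (1 + t) ^ n) (expMeasure 1) := by
  induction n generalizing s with
  | zero => simpa using integrable_rpow_expMeasure hs
  | succ n ih =>
    refine ((ih hs).add (ih (s := s + 1) (by linarith))).congr ?_
    filter_upwards [ae_expMeasure_pos] with t ht
    simp only [Pi.add_apply, Real.rpow_add_one ht.ne']
    ring

variable {K : ℕ}

lemma measurable_normalise :
    Measurable fun (x : Fin K → ℝ) k => x k / ∑ j, x j := by fun_prop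

lemma ae_uniformSimplex : ∀ᵐ x ∂(uniformSimplex K), ∀ k, 0 < x k ∧ x k ≤ 1 := by
  rw [uniformSimplex, ae_map_iff measurable_normalise.aemeasurable]
  · have h : ∀ᵐ x ∂(Measure.pi fun _ : Fin K => expMeasure 1), ∀ k, 0 < x k := by
      rw [ae_all_iff]
      intro k
      exact (Measure.quasiMeasurePreserving_eval (μ := fun _ : Fin K => expMeasure 1) k).ae
        ae_expMeasure_pos
    filter_upwards [h] with x hx k
    have hle : x k ≤ ∑ j, x j := Finset.single_le_sum (fun j _ => (hx j).le) (Finset.mem_univ k)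
    have := (hx k).trans_le hle
    exact ⟨div_pos (hx k) this, (div_le_one this).2 hle⟩
  · simp only [Set.ofPred_forall, Set.ofPred_and]
    refine MeasurableSet.iInter fun k => MeasurableSet.inter ?_ ?_
    · exact measurableSet_lt measurable_const (measurable_pi_apply k)
    · exact measurableSet_le (measurable_pi_apply k) measurable_const

instance : IsProbabilityMeasure (uniformSimplex K) :=
  Measure.isProbabilityMeasure_map measurable_normalise.aemeasurable

/-- A power of a normalised coordinate is at most one if the exponent is nonnegative; otherwise `(e
/ S)^c = e^c S^(-c)` with `S^(-c) ≤ 1 + S`. The normalising sum then enters only through `1 + S`. -/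
lemma rpow_div_le {e S c : ℝ} (he : 0 < e) (heS : e ≤ S) (hc : -1 < c) :
    (e / S) ^ c ≤ (1 + e ^ (min c 0)) * (1 + S) := by
  have hS : 0 < S := he.trans_le heS
  have h1 : 0 ≤ e ^ (min c 0) := Real.rpow_nonneg he.le _
  rcases le_total 0 c with h | h
  · have : (e / S) ^ c ≤ 1 := Real.rpow_le_one (by positivity) ((div_le_one hS).2 heS) h
    nlinarith
  · rw [min_eq_left h] at h1 ⊢
    have h2 : (e / S) ^ c = e ^ c * S ^ (-c) := by
      rw [Real.div_rpow he.le hS.le, Real.rpow_neg hS.le, div_eq_mul_inv]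
    have h3 : S ^ (-c) ≤ 1 + S := by
      calc S ^ (-c) ≤ (1 + S) ^ (-c) := Real.rpow_le_rpow hS.le (by linarith) (by linarith)
        _ ≤ (1 + S) ^ (1 : ℝ) := Real.rpow_le_rpow_of_exponent_le (by linarith) (by linarith)
        _ = 1 + S := Real.rpow_one _
    rw [h2]
    calc e ^ c * S ^ (-c) ≤ e ^ c * (1 + S) := by gcongr
      _ ≤ _ := by nlinarith

lemma one_add_sum_le_prod {ι : Type*} (t : Finset ι) {x : ι → ℝ} (hx : ∀ j ∈ t, 0 ≤ x j) :
    1 + ∑ j ∈ t, x j ≤ ∏ j ∈ t, (1 + x j) := by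
  classical
  induction t using Finset.induction_on with
  | empty => simp
  | insert a t ha ih =>
    rw [Finset.sum_insert ha, Finset.prod_insert ha]
    have h1 := ih fun j hj => hx j (Finset.mem_insert_of_mem hj)
    have h2 := hx a (Finset.mem_insert_self a t)
    have h3 : 0 ≤ ∑ j ∈ t, x j :=
      Finset.sum_nonneg fun j hj => hx j (Finset.mem_insert_of_mem hj)
    nlinarith

/-- Pulled back to independent exponentials, the product is dominated by `∏ (1 + x_k^(min c_k 0)) (1
+ S)^K`. Since `1 + S ≤ ∏ (1 + x_j)`, this is at most a product of one-variable functions, each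
integrable because its exponents exceed `-1`. -/
lemma integrable_prod_rpow_uniformSimplex {c : Fin K → ℝ} (hc : ∀ k, -1 < c k) :
    Integrable (fun x => ∏ k, x k ^ c k) (uniformSimplex K) := by
  have hm : Measurable fun x : Fin K → ℝ => ∏ k, x k ^ c k := by
    refine Finset.measurable_prod _ fun k _ => ?_
    exact (measurable_pi_apply k).pow_const _
  rw [uniformSimplex, integrable_map_measure hm.aestronglyMeasurable
    measurable_normalise.aemeasurable]
  have hb : Integrable (fun x : Fin K → ℝ =>
      ∏ k, ((1 + x k ^ (min (c k) 0)) * (1 + x k) ^ K))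
      (Measure.pi fun _ : Fin K => expMeasure 1) := by
    refine Integrable.fintype_prod (𝕜 := ℝ)
      (f := fun k t => (1 + t ^ (min (c k) 0)) * (1 + t) ^ K) fun k => ?_
    have h1 := integrable_rpow_mul_pow_expMeasure K (s := 0) (by norm_num)
    have h2 := integrable_rpow_mul_pow_expMeasure K (s := min (c k) 0)
      (lt_min (hc k) (by norm_num))
    refine (h1.add h2).congr (Eventually.of_forall fun t => ?_)
    simp only [Pi.add_apply, Real.rpow_zero]
    ring
  refine hb.mono' (hm.comp measurable_normalise).aestronglyMeasurable ?_
  have h : ∀ᵐ x ∂(Measure.pi fun _ : Fin K => expMeasure 1), ∀ k, 0 < x k := by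
    rw [ae_all_iff]
    intro k
    exact (Measure.quasiMeasurePreserving_eval (μ := fun _ : Fin K => expMeasure 1) k).ae
      ae_expMeasure_pos
  filter_upwards [h] with x hx
  have hS : ∀ k, x k ≤ ∑ j, x j := fun k =>
    Finset.single_le_sum (fun j _ => (hx j).le) (Finset.mem_univ k)
  have hnn : 0 ≤ ∑ j, x j := Finset.sum_nonneg fun j _ => (hx j).le
  have hnn2 : ∀ k, 0 ≤ (x k / ∑ j, x j) ^ c k := fun k =>
    Real.rpow_nonneg (div_nonneg (hx k).le hnn) _
  simp only [Function.comp_apply]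
  rw [Real.norm_of_nonneg (Finset.prod_nonneg fun k _ => hnn2 k)]
  calc ∏ k, (x k / ∑ j, x j) ^ c k
      ≤ ∏ k, ((1 + x k ^ (min (c k) 0)) * (1 + ∑ j, x j)) :=
        Finset.prod_le_prod (fun k _ => hnn2 k) fun k _ => rpow_div_le (hx k) (hS k) (hc k)
    _ = (∏ k, (1 + x k ^ (min (c k) 0))) * (1 + ∑ j, x j) ^ K := by
        rw [Finset.prod_mul_distrib]; simp
    _ ≤ (∏ k, (1 + x k ^ (min (c k) 0))) * (∏ j, (1 + x j)) ^ K := by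
        refine mul_le_mul_of_nonneg_left (pow_le_pow_left₀ (by linarith)
          (one_add_sum_le_prod _ fun j _ => (hx j).le) _)
          (Finset.prod_nonneg fun k _ => ?_)
        have := Real.rpow_nonneg (hx k).le (min (c k) 0)
        linarith
    _ = _ := by rw [Finset.prod_mul_distrib, Finset.prod_pow]

lemma ae_uniformRows : ∀ᵐ Λ ∂(uniformRows K), ∀ k' k, 0 < Λ k' k ∧ Λ k' k ≤ 1 := by
  rw [ae_all_iff]
  intro k'
  exact (Measure.quasiMeasurePreserving_eval (μ := fun _ : Fin K => uniformSimplex K) k').ae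
    ae_uniformSimplex

lemma integrable_dirKernel {γ : Fin K → Fin K → ℝ} (hγ : ∀ k' k, 0 < γ k' k) :
    Integrable (dirKernel γ) (uniformRows K) :=
  Integrable.fintype_prod (𝕜 := ℝ) (f := fun k' (x : Fin K → ℝ) => ∏ k, x k ^ (γ k' k - 1))
    fun k' => integrable_prod_rpow_uniformSimplex fun k => by linarith [hγ k' k]

lemma dirKernel_pos {γ Λ : Fin K → Fin K → ℝ} (h : ∀ k' k, 0 < Λ k' k) : 0 < dirKernel γ Λ :=
  Finset.prod_pos fun k' _ => Finset.prod_pos fun k _ => Real.rpow_pos_of_pos (h k' k) _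

lemma measurable_dirKernel (γ : Fin K → Fin K → ℝ) : Measurable (dirKernel γ) := by
  refine Finset.measurable_prod _ fun k' _ => Finset.measurable_prod _ fun k _ => ?_
  exact ((measurable_pi_apply k).comp (measurable_pi_apply k')).pow_const _

/-- Half of each exponent is spent on the logarithm: `Λ^(γ-1) = Λ^(γ/2-1) Λ^(γ/2)`, where the second
factor times the logarithm is bounded on `(0, 1]` and the first factors form an integrable Dirichlet
kernel with parameters `γ / 2`. -/
lemma integrable_log_mul_dirKernel {γ : Fin K → Fin K → ℝ} (hγ : ∀ k' k, 0 < γ k' k)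
    (k' k : Fin K) : Integrable (fun Λ => Real.log (Λ k' k) * dirKernel γ Λ) (uniformRows K) := by
  have hγ2 : ∀ i j, 0 < γ i j / 2 := fun i j => half_pos (hγ i j)
  have hm : Measurable fun Λ : Fin K → Fin K → ℝ => Λ k' k :=
    (measurable_pi_apply k).comp (measurable_pi_apply k')
  refine ((integrable_dirKernel hγ2).const_mul (1 / (γ k' k / 2))).mono'
    ((Real.measurable_log.comp hm).mul (measurable_dirKernel γ)).aestronglyMeasurable ?_
  filter_upwards [ae_uniformRows] with Λ hΛ
  have hsplit : dirKernel γ Λ =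
      dirKernel (fun i j => γ i j / 2) Λ * ∏ q : Fin K × Fin K, Λ q.1 q.2 ^ (γ q.1 q.2 / 2) := by
    rw [Fintype.prod_prod_type]
    simp only [dirKernel, ← Finset.prod_mul_distrib]
    refine Finset.prod_congr rfl fun i _ => Finset.prod_congr rfl fun j _ => ?_
    rw [← Real.rpow_add (hΛ i j).1]
    congr 1; ring
  have hpos := dirKernel_pos (γ := fun i j => γ i j / 2) fun i j => (hΛ i j).1
  have hle : ∏ q : Fin K × Fin K, Λ q.1 q.2 ^ (γ q.1 q.2 / 2) ≤ Λ k' k ^ (γ k' k / 2) := by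
    classical
    rw [← Finset.mul_prod_erase _ _ (Finset.mem_univ (k', k))]
    refine mul_le_of_le_one_right (Real.rpow_nonneg (hΛ k' k).1.le _)
      (Finset.prod_le_one (fun q _ => Real.rpow_nonneg (hΛ _ _).1.le _) fun q _ => ?_)
    exact Real.rpow_le_one (hΛ _ _).1.le (hΛ _ _).2 (hγ2 _ _).le
  have hnn : 0 ≤ ∏ q : Fin K × Fin K, Λ q.1 q.2 ^ (γ q.1 q.2 / 2) :=
    Finset.prod_nonneg fun q _ => Real.rpow_nonneg (hΛ _ _).1.le _
  have hlog := Real.abs_log_mul_self_rpow_lt (Λ k' k) (γ k' k / 2) (hΛ k' k).1 (hΛ k' k).2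
    (hγ2 k' k)
  rw [abs_mul, abs_of_nonneg (Real.rpow_nonneg (hΛ k' k).1.le _)] at hlog
  rw [hsplit, Real.norm_eq_abs, abs_mul, abs_mul, abs_of_pos hpos, abs_of_nonneg hnn]
  calc |Real.log (Λ k' k)| * (dirKernel (fun i j => γ i j / 2) Λ *
        ∏ q : Fin K × Fin K, Λ q.1 q.2 ^ (γ q.1 q.2 / 2))
      ≤ |Real.log (Λ k' k)| * (dirKernel (fun i j => γ i j / 2) Λ * Λ k' k ^ (γ k' k / 2)) := by
        gcongr
    _ = (|Real.log (Λ k' k)| * Λ k' k ^ (γ k' k / 2)) * dirKernel (fun i j => γ i j / 2) Λ := by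
        ring
    _ ≤ _ := by gcongr

end Simplex

end LTA


namespace LTA

/-! ### Bookkeeping for integrals. -/

section HasMean

/-- `g` is integrable with integral `a`. -/
def HasMean {X : Type*} [MeasurableSpace X] (μ : Measure X) (g : X → ℝ) (a : ℝ) : Prop :=
  Integrable g μ ∧ ∫ x, g x ∂μ = a

variable {X X' ι : Type*} [MeasurableSpace X] [MeasurableSpace X'] {μ : Measure X}
  {μ' : Measure X'} {g g' : X → ℝ} {a a' : ℝ}

lemma HasMean.const [IsProbabilityMeasure μ] (a : ℝ) : HasMean μ (fun _ => a) a :=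
  ⟨integrable_const _, by simp⟩

lemma HasMean.add (h : HasMean μ g a) (h' : HasMean μ g' a') :
    HasMean μ (fun x => g x + g' x) (a + a') :=
  ⟨h.1.add h'.1, by rw [integral_add h.1 h'.1, h.2, h'.2]⟩

lemma HasMean.sub (h : HasMean μ g a) (h' : HasMean μ g' a') :
    HasMean μ (fun x => g x - g' x) (a - a') :=
  ⟨h.1.sub h'.1, by rw [integral_sub h.1 h'.1, h.2, h'.2]⟩

lemma HasMean.const_mul (h : HasMean μ g a) (c : ℝ) : HasMean μ (fun x => c * g x) (c * a) :=
  ⟨h.1.const_mul c, by rw [integral_const_mul, h.2]⟩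

lemma HasMean.sum (t : Finset ι) {g : ι → X → ℝ} {a : ι → ℝ} (h : ∀ i ∈ t, HasMean μ (g i) (a i)) :
    HasMean μ (fun x => ∑ i ∈ t, g i x) (∑ i ∈ t, a i) :=
  ⟨integrable_finsetSum _ fun i hi => (h i hi).1, by
    rw [integral_finsetSum _ fun i hi => (h i hi).1]
    exact Finset.sum_congr rfl fun i hi => (h i hi).2⟩

lemma HasMean.congr (h : HasMean μ g a) (hg : g =ᵐ[μ] g') : HasMean μ g' a :=
  ⟨h.1.congr hg, by rw [← integral_congr_ae hg, h.2]⟩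

lemma HasMean.comp_fst [IsProbabilityMeasure μ] [IsProbabilityMeasure μ'] (h : HasMean μ g a) :
    HasMean (μ.prod μ') (fun x => g x.1) a :=
  ⟨h.1.comp_fst μ', by rw [integral_fun_fst]; simp [h.2]⟩

lemma HasMean.comp_snd [IsProbabilityMeasure μ] [IsProbabilityMeasure μ'] (h : HasMean μ g a) :
    HasMean (μ'.prod μ) (fun x => g x.2) a :=
  ⟨h.1.comp_snd μ', by rw [integral_fun_snd]; simp [h.2]⟩

end HasMean

/-! ### The variational laws of Λ and ξ. -/

section Laws

variable {K : ℕ} {M : Model K}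

/-- `dirDens` and `dirLaw` are by definition `normDens` and `normLaw` of this kernel, so the general
facts transfer by unfolding. -/
lemma Model.isKernel_dir (M : Model K) {γ : Fin K → Fin K → ℝ} (hγ : ∀ k' k, 0 < γ k' k) :
    IsKernel ((uniformRows K).restrict M.suppΛ) (dirKernel γ) where
  integrable := (integrable_dirKernel hγ).integrableOn
  pos := ae_restrict_of_ae (ae_uniformRows.mono fun _ h => dirKernel_pos fun k' k => (h k' k).1)
  ne_zero := by simpa [Measure.restrict_eq_zero] using M.suppΛ_pos.ne'

lemma Model.CompactSupport.integrableOn (hM : M.CompactSupport) {g : ℝ → ℝ}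
    (hg : ContinuousOn g (Set.Ioi 0)) : IntegrableOn g M.suppξ :=
  (hg.mono hM.2.2).integrableOn_compact hM.2.1

lemma continuousOn_gamKernel (s c : ℝ) : ContinuousOn (gamKernel s c) (Set.Ioi 0) := by
  refine ContinuousOn.mul (fun _ hx => ?_) (by fun_prop)
  exact (Real.continuousAt_rpow_const _ _ (Or.inl (ne_of_gt hx))).continuousWithinAt

lemma gamKernel_pos {s c x : ℝ} (hx : 0 < x) : 0 < gamKernel s c x :=
  mul_pos (Real.rpow_pos_of_pos hx _) (Real.exp_pos _)

/-- All real `s` and `c` are allowed, since the kernel is continuous on a compact subset of `(0,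
∞)`. -/
lemma Model.CompactSupport.isKernel_gam (hM : M.CompactSupport) (s c : ℝ) :
    IsKernel (volume.restrict M.suppξ) (gamKernel s c) where
  integrable := hM.integrableOn (continuousOn_gamKernel s c)
  pos := (ae_restrict_mem M.suppξ_meas).mono fun _ h => gamKernel_pos (M.suppξ_sub h)
  ne_zero := by simpa [Measure.restrict_eq_zero] using M.suppξ_pos.ne'

lemma Model.isProbabilityMeasure_dirLaw (M : Model K) {γ : Fin K → Fin K → ℝ}
    (hγ : ∀ k' k, 0 < γ k' k) : IsProbabilityMeasure (M.dirLaw γ) :=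
  (M.isKernel_dir hγ).isProbabilityMeasure

lemma Model.CompactSupport.isProbabilityMeasure_gamLaw (hM : M.CompactSupport) (s c : ℝ) :
    IsProbabilityMeasure (M.gamLaw s c) :=
  (hM.isKernel_gam s c).isProbabilityMeasure

lemma Model.CompactSupport.integrable_gamLaw (hM : M.CompactSupport) (s c : ℝ) {g : ℝ → ℝ}
    (hg : ContinuousOn g (Set.Ioi 0)) : Integrable g (M.gamLaw s c) :=
  (hM.isKernel_gam s c).integrable_law
    (hM.integrableOn (hg.mul (continuousOn_gamKernel s c)))

lemma Model.ae_dirLaw (M : Model K) (γ : Fin K → Fin K → ℝ) :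
    ∀ᵐ Λ ∂(M.dirLaw γ), Λ ∈ M.suppΛ ∧ ∀ k' k, 0 < Λ k' k ∧ Λ k' k ≤ 1 :=
  IsKernel.ae_law ((ae_restrict_mem M.suppΛ_meas).and (ae_restrict_of_ae ae_uniformRows))

lemma Model.ae_gamLaw (M : Model K) (s c : ℝ) : ∀ᵐ ξ ∂(M.gamLaw s c), ξ ∈ M.suppξ :=
  IsKernel.ae_law (ae_restrict_mem M.suppξ_meas)

lemma Model.dirDens_pos (M : Model K) {γ : Fin K → Fin K → ℝ} (hγ : ∀ k' k, 0 < γ k' k)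
    {Λ : Fin K → Fin K → ℝ} (hΛ : ∀ k' k, 0 < Λ k' k) : 0 < M.dirDens γ Λ :=
  div_pos (dirKernel_pos hΛ) (M.isKernel_dir hγ).integral_pos

lemma Model.CompactSupport.gamDens_pos (hM : M.CompactSupport) (s c : ℝ) {x : ℝ} (hx : 0 < x) :
    0 < M.gamDens s c x :=
  div_pos (gamKernel_pos hx) (hM.isKernel_gam s c).integral_pos

lemma Model.integrable_log_dirLaw (M : Model K) {γ : Fin K → Fin K → ℝ}
    (hγ : ∀ k' k, 0 < γ k' k) (k' k : Fin K) :
    Integrable (fun Λ => Real.log (Λ k' k)) (M.dirLaw γ) :=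
  (M.isKernel_dir hγ).integrable_law (integrable_log_mul_dirKernel hγ k' k).integrableOn

lemma log_dirKernel {γ Λ : Fin K → Fin K → ℝ} (hΛ : ∀ k' k, 0 < Λ k' k) :
    Real.log (dirKernel γ Λ) = ∑ k', ∑ k, (γ k' k - 1) * Real.log (Λ k' k) := by
  rw [dirKernel, Real.log_prod fun k' _ =>
    (Finset.prod_pos fun k _ => Real.rpow_pos_of_pos (hΛ k' k) _).ne']
  refine Finset.sum_congr rfl fun k' _ => ?_
  rw [Real.log_prod fun k _ => (Real.rpow_pos_of_pos (hΛ k' k) _).ne']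
  exact Finset.sum_congr rfl fun k _ => Real.log_rpow (hΛ k' k) _

lemma Model.integrable_log_dirDens (M : Model K) {γ γ' : Fin K → Fin K → ℝ}
    (hγ : ∀ k' k, 0 < γ k' k) (hγ' : ∀ k' k, 0 < γ' k' k) :
    Integrable (fun Λ => Real.log (M.dirDens γ' Λ)) (M.dirLaw γ) := by
  have := M.isProbabilityMeasure_dirLaw hγ
  have h1 : Integrable (fun Λ : Fin K → Fin K → ℝ =>
      ∑ k', ∑ k, (γ' k' k - 1) * Real.log (Λ k' k)) (M.dirLaw γ) :=
    integrable_finsetSum _ fun k' _ => integrable_finsetSum _ fun k _ =>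
      (M.integrable_log_dirLaw hγ k' k).const_mul _
  refine (h1.sub (integrable_const
    (Real.log (∫ Λ' in M.suppΛ, dirKernel γ' Λ' ∂(uniformRows K))))).congr ?_
  filter_upwards [M.ae_dirLaw γ] with Λ hΛ
  have hpos := fun k' k => (hΛ.2 k' k).1
  rw [Model.dirDens, Real.log_div (dirKernel_pos hpos).ne'
    (M.isKernel_dir hγ').integral_pos.ne', log_dirKernel hpos]
  rfl

lemma Model.CompactSupport.integrable_log_gamDens (hM : M.CompactSupport) (s c s' c' : ℝ) :
    Integrable (fun x => Real.log (M.gamDens s' c' x)) (M.gamLaw s c) := by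
  refine hM.integrable_gamLaw s c (ContinuousOn.log ?_ fun x hx => (hM.gamDens_pos s' c' hx).ne')
  exact (continuousOn_gamKernel s' c').div_const _

/-- Expectation of the logarithm of the transition matrix and of the rate under `q`. -/
noncomputable def Model.meanLog (M : Model K) (q : VarParam K) (k' k : Fin K) : ℝ :=
  (∫ Λ, Real.log (Λ k' k) ∂(M.dirLaw q.γ)) + ∫ x, Real.log x ∂(M.gamLaw q.aT q.dT)

/-- Expectation of the rate under `q`. -/
noncomputable def Model.meanRate (M : Model K) (q : VarParam K) : ℝ :=
  ∫ x, x ∂(M.gamLaw q.aT q.dT)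

/-- Divergence of `q(Λ) q(ξ)` from the prior. -/
noncomputable def Model.divergence (M : Model K) (q : VarParam K) : ℝ :=
  -(∫ Λ, Real.log (M.dirDens M.r Λ / M.dirDens q.γ Λ) ∂(M.dirLaw q.γ)) -
    ∫ x, Real.log (M.gamDens M.a M.d x / M.gamDens q.aT q.dT x) ∂(M.gamLaw q.aT q.dT)

lemma Model.integrable_log_dirDens_div (M : Model K) {γ γ' : Fin K → Fin K → ℝ}
    (hγ : ∀ k' k, 0 < γ k' k) (hγ' : ∀ k' k, 0 < γ' k' k) :
    Integrable (fun Λ => Real.log (M.dirDens γ' Λ / M.dirDens γ Λ)) (M.dirLaw γ) := by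
  refine ((M.integrable_log_dirDens hγ hγ').sub (M.integrable_log_dirDens hγ hγ)).congr ?_
  filter_upwards [M.ae_dirLaw γ] with Λ hΛ
  have hpos := fun k' k => (hΛ.2 k' k).1
  exact (Real.log_div (M.dirDens_pos hγ' hpos).ne' (M.dirDens_pos hγ hpos).ne').symm

lemma Model.CompactSupport.integrable_log_gamDens_div (hM : M.CompactSupport) (s c s' c' : ℝ) :
    Integrable (fun x => Real.log (M.gamDens s' c' x / M.gamDens s c x)) (M.gamLaw s c) := by
  refine ((hM.integrable_log_gamDens s c s' c').sub (hM.integrable_log_gamDens s c s c)).congr ?_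
  filter_upwards [M.ae_gamLaw s c] with x hx
  have hpos := M.suppξ_sub hx
  exact (Real.log_div (hM.gamDens_pos s' c' hpos).ne' (hM.gamDens_pos s c hpos).ne').symm

/-- A sum of two relative entropies, one for Λ and one for ξ, each nonnegative by Gibbs' inequality.
-/
lemma Model.CompactSupport.divergence_nonneg (hM : M.CompactSupport) (q : VarParam K) :
    0 ≤ M.divergence q := by
  have h1 := (M.isKernel_dir q.γ_pos).integral_log_div_nonpos (M.isKernel_dir M.r_pos)
    (M.integrable_log_dirDens_div q.γ_pos M.r_pos)
  have h2 := (hM.isKernel_gam q.aT q.dT).integral_log_div_nonpos (hM.isKernel_gam M.a M.d)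
    (hM.integrable_log_gamDens_div q.aT q.dT M.a M.d)
  have h3 : M.divergence q =
      -(∫ Λ, Real.log (normDens ((uniformRows K).restrict M.suppΛ) (dirKernel M.r) Λ /
          normDens ((uniformRows K).restrict M.suppΛ) (dirKernel q.γ) Λ)
          ∂(normLaw ((uniformRows K).restrict M.suppΛ) (dirKernel q.γ))) -
      ∫ x, Real.log (normDens (volume.restrict M.suppξ) (gamKernel M.a M.d) x /
          normDens (volume.restrict M.suppξ) (gamKernel q.aT q.dT) x)
          ∂(normLaw (volume.restrict M.suppξ) (gamKernel q.aT q.dT)) := rfl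
  rw [h3]
  linarith

lemma Model.CompactSupport.exists_bounds (hM : M.CompactSupport) :
    ∃ x₀ x₁ : ℝ, 0 < x₀ ∧ x₀ ≤ x₁ ∧ M.suppξ ⊆ Set.Icc x₀ x₁ := by
  have hne : M.suppξ.Nonempty := nonempty_of_measure_ne_zero M.suppξ_pos.ne'
  obtain ⟨x₀, h₀, h₀'⟩ := hM.2.1.exists_isLeast hne
  obtain ⟨x₁, h₁, h₁'⟩ := hM.2.1.exists_isGreatest hne
  exact ⟨x₀, x₁, hM.2.2 h₀, h₀' h₁, fun x hx => ⟨h₀' hx, h₁' hx⟩⟩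

lemma Model.CompactSupport.meanRate_mem (hM : M.CompactSupport) {x₀ x₁ : ℝ}
    (hx : M.suppξ ⊆ Set.Icc x₀ x₁) (q : VarParam K) : M.meanRate q ∈ Set.Icc x₀ x₁ := by
  have := hM.isProbabilityMeasure_gamLaw q.aT q.dT
  have hi : Integrable (fun x : ℝ => x) (M.gamLaw q.aT q.dT) :=
    hM.integrable_gamLaw _ _ continuousOn_id
  constructor
  · have := integral_mono_ae (integrable_const x₀) hi
      ((M.ae_gamLaw q.aT q.dT).mono fun x h => (hx h).1)
    simpa [Model.meanRate] using this
  · have := integral_mono_ae hi (integrable_const x₁)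
      ((M.ae_gamLaw q.aT q.dT).mono fun x h => (hx h).2)
    simpa [Model.meanRate] using this

lemma Model.CompactSupport.integrable_log_gamLaw (hM : M.CompactSupport) (s c : ℝ) :
    Integrable Real.log (M.gamLaw s c) :=
  hM.integrable_gamLaw s c fun _ hx =>
    (Real.continuousAt_log (ne_of_gt hx)).continuousWithinAt

/-- Entries of a transition matrix have nonpositive logarithms. An upper bound uniform in `q` is all
that finiteness of the supremum requires. -/
lemma Model.CompactSupport.meanLog_le (hM : M.CompactSupport) {x₀ x₁ : ℝ} (h₀ : 0 < x₀)
    (hx : M.suppξ ⊆ Set.Icc x₀ x₁) (q : VarParam K) (k' k : Fin K) :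
    M.meanLog q k' k ≤ Real.log x₁ := by
  have := hM.isProbabilityMeasure_gamLaw q.aT q.dT
  have h1 : ∫ Λ, Real.log (Λ k' k) ∂(M.dirLaw q.γ) ≤ 0 :=
    integral_nonpos_of_ae ((M.ae_dirLaw q.γ).mono fun Λ h =>
      Real.log_nonpos (h.2 k' k).1.le (h.2 k' k).2)
  have h2 := integral_mono_ae (hM.integrable_log_gamLaw q.aT q.dT)
    (integrable_const (Real.log x₁)) ((M.ae_gamLaw q.aT q.dT).mono fun x h =>
      Real.log_le_log (h₀.trans_le (hx h).1) (hx h).2)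
  simp only [integral_const, probReal_univ, smul_eq_mul, one_mul] at h2
  rw [Model.meanLog]
  linarith

end Laws

/-! ### Eliminating the variational law of the topics. -/

section Elbo

variable {K W : ℕ} {M : Model K}

/-- The weight of a sequence of topics when the logarithms of the transition rates are replaced
by `A` and the rate by `x`. -/
noncomputable def Model.weight (M : Model K) (y : Obs W) (A : Fin K → Fin K → ℝ) (x : ℝ) (η : Param K W)
    (z : Fin y.1.1 → Fin K) : ℝ :=
  ∏ n, bMat η (z n) (y.1.2 n).1 * if n.1 = 0 then M.p0 (z n)
    else Real.exp (A (z (pre n)) (z n) + gMat η (z (pre n)) (z n) -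
      x * Real.exp (gMat η (z (pre n)) (z n)) * gap y n)

/-- The logarithm of the total weight of all the sequences of topics. -/
noncomputable def Model.logPartition (M : Model K) (y : Obs W) (A : Fin K → Fin K → ℝ) (x : ℝ)
    (η : Param K W) : ℝ :=
  Real.log (∑ z, M.weight y A x η z)

lemma Model.weight_nonneg (M : Model K) (y : Obs W) (A : Fin K → Fin K → ℝ) (x : ℝ)
    {η : Param K W} (hη : ∀ k e, 0 < bMat η k e) (z : Fin y.1.1 → Fin K) :
    0 ≤ M.weight y A x η z := by
  refine Finset.prod_nonneg fun n _ => mul_nonneg (hη _ _).le ?_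
  split_ifs
  · exact M.p0_mem.1 _
  · exact (Real.exp_pos _).le

lemma Model.exists_p0_pos (M : Model K) : ∃ k, 0 < M.p0 k := by
  by_contra! h
  have h1 := M.p0_mem.2
  have : ∑ k, M.p0 k ≤ 0 := Finset.sum_nonpos fun k _ => h k
  linarith

lemma Model.weight_pos (M : Model K) (y : Obs W) (A : Fin K → Fin K → ℝ) (x : ℝ)
    {η : Param K W} (hη : ∀ k e, 0 < bMat η k e) {z : Fin y.1.1 → Fin K}
    (hz : ∀ n : Fin y.1.1, n.1 = 0 → 0 < M.p0 (z n)) : 0 < M.weight y A x η z := by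
  refine Finset.prod_pos fun n _ => mul_pos (hη _ _) ?_
  split_ifs with h
  · exact hz n h
  · exact Real.exp_pos _

lemma Model.weight_eq_zero (M : Model K) (y : Obs W) (A : Fin K → Fin K → ℝ) (x : ℝ)
    {η : Param K W} {z : Fin y.1.1 → Fin K}
    (hz : ¬ ∀ n : Fin y.1.1, n.1 = 0 → 0 < M.p0 (z n)) : M.weight y A x η z = 0 := by
  push Not at hz
  obtain ⟨n, h0, hn⟩ := hz
  refine Finset.prod_eq_zero (Finset.mem_univ n) ?_
  rw [if_pos h0, le_antisymm hn (M.p0_mem.1 _), mul_zero]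

lemma Model.sum_weight_pos (M : Model K) (y : Obs W) (A : Fin K → Fin K → ℝ) (x : ℝ)
    {η : Param K W} (hη : ∀ k e, 0 < bMat η k e) : 0 < ∑ z, M.weight y A x η z := by
  obtain ⟨k, hk⟩ := M.exists_p0_pos
  exact Finset.sum_pos' (fun z _ => M.weight_nonneg y A x hη z)
    ⟨fun _ => k, Finset.mem_univ _, M.weight_pos y A x hη fun _ _ => hk⟩

/-- The variational weights and the averaged model weights belong to one exponential family; `p` and
`κ` serve only as a parametrisation of `A` and `x`. -/
lemma Model.qzWeight_eq_weight (M : Model K) (y : Obs W) (η : Param K W) (q : VarParam K) :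
    M.qzWeight y η q = M.weight y (fun k' k => Real.log (q.κ * q.p k' k)) q.κ η := by
  funext z
  refine Finset.prod_congr rfl fun n _ => ?_
  congr 1
  split_ifs
  · rfl
  · rw [sub_eq_add_neg, Real.exp_add, Real.exp_add,
      Real.exp_log (mul_pos q.κ_pos (q.p_pos _ _))]
    ring_nf

/-- Gibbs' inequality: `q log (w / q)` is at most the logarithm of the total mass of `w`. -/
lemma sum_mul_log_sub_log_le {ι : Type*} (t : Finset ι) {p w : ι → ℝ} (hp : ∀ i ∈ t, 0 ≤ p i)
    (hp1 : ∑ i ∈ t, p i = 1) (hw : ∀ i ∈ t, 0 ≤ w i) (hpw : ∀ i ∈ t, w i = 0 → p i = 0) :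
    ∑ i ∈ t, p i * (Real.log (w i) - Real.log (p i)) ≤ Real.log (∑ i ∈ t, w i) := by
  have hS : 0 < ∑ i ∈ t, w i := by
    refine lt_of_le_of_ne (Finset.sum_nonneg hw) fun h => ?_
    have h0 := (Finset.sum_eq_zero_iff_of_nonneg hw).1 h.symm
    rw [Finset.sum_eq_zero fun i hi => hpw i hi (h0 i hi)] at hp1
    exact zero_ne_one hp1
  have key : ∀ i ∈ t, p i * (Real.log (w i) - Real.log (p i)) - p i * Real.log (∑ i ∈ t, w i) ≤
      w i / (∑ i ∈ t, w i) - p i := by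
    intro i hi
    rcases (hp i hi).eq_or_lt with h | h
    · rw [← h]; simp [div_nonneg (hw i hi) hS.le]
    · have hwi : 0 < w i := lt_of_le_of_ne (hw i hi) fun h' => h.ne' (hpw i hi h'.symm)
      have h1 := Real.log_le_sub_one_of_pos (div_pos (div_pos hwi hS) h)
      rw [Real.log_div (div_pos hwi hS).ne' h.ne', Real.log_div hwi.ne' hS.ne'] at h1
      have h2 := mul_le_mul_of_nonneg_left h1 h.le
      have h3 : p i * (w i / (∑ i ∈ t, w i) / p i - 1) = w i / (∑ i ∈ t, w i) - p i := by
        field_simp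
      linarith
  have h4 := Finset.sum_le_sum key
  rw [Finset.sum_sub_distrib, Finset.sum_sub_distrib, ← Finset.sum_mul, ← Finset.sum_div, hp1,
    div_self hS.ne'] at h4
  linarith

lemma log_mul_div_mul {J r g f g' c r' : ℝ} (hJ : 0 < J) (hr : 0 < r) (hg : 0 < g) (hf : f ≠ 0)
    (hg' : 0 < g') (hc : 0 < c) (hr' : 0 < r') :
    Real.log (J * r * g * f / (g' * c * r')) =
      Real.log J + Real.log (r / r') + Real.log (g / g') + Real.log f - Real.log c := by
  rw [Real.log_div (mul_ne_zero (by positivity) hf) (by positivity),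
    Real.log_mul (by positivity) hf, Real.log_mul (by positivity) hg.ne',
    Real.log_mul hJ.ne' hr.ne', Real.log_mul (by positivity) hr'.ne',
    Real.log_mul hg'.ne' hc.ne', Real.log_div hr.ne' hr'.ne', Real.log_div hg.ne' hg'.ne']
  ring

/-- On a sequence of positive initial probability the log joint density is affine in `log λ`, `log
ξ` and `ξ`, apart from the prior. Averaging under `q` therefore replaces these by their means, and
the prior terms produce the divergence. The number `c` stands for the variational probability of
`z`. -/
lemma Model.hasMean_log (hM : M.CompactSupport) (y : Obs W) {η : Param K W}
    (hη : ∀ k e, 0 < bMat η k e) (q : VarParam K) {z : Fin y.1.1 → Fin K}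
    (hz : ∀ n : Fin y.1.1, n.1 = 0 → 0 < M.p0 (z n)) (hfτ : M.fτ y.2 ≠ 0) {c : ℝ} (hc : 0 < c) :
    HasMean ((M.dirLaw q.γ).prod (M.gamLaw q.aT q.dT))
      (fun x => Real.log (M.joint y η z x.1 x.2 * M.fτ y.2 /
        (M.gamDens q.aT q.dT x.2 * c * M.dirDens q.γ x.1)))
      (Real.log (M.weight y (M.meanLog q) (M.meanRate q) η z) - M.divergence q +
        Real.log (M.fτ y.2) - Real.log c) := by
  have := M.isProbabilityMeasure_dirLaw q.γ_pos
  have := hM.isProbabilityMeasure_gamLaw q.aT q.dT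
  have hA : ∀ k' k, HasMean ((M.dirLaw q.γ).prod (M.gamLaw q.aT q.dT))
      (fun x => Real.log (x.1 k' k) + Real.log x.2) (M.meanLog q k' k) := fun k' k =>
    (HasMean.comp_fst ⟨M.integrable_log_dirLaw q.γ_pos k' k, rfl⟩).add
      (HasMean.comp_snd ⟨hM.integrable_log_gamLaw _ _, rfl⟩)
  have hX : HasMean ((M.dirLaw q.γ).prod (M.gamLaw q.aT q.dT)) (fun x => x.2) (M.meanRate q) :=
    HasMean.comp_snd (g := fun x => x) ⟨hM.integrable_gamLaw _ _ continuousOn_id, rfl⟩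
  have hterm : ∀ n : Fin y.1.1, HasMean ((M.dirLaw q.γ).prod (M.gamLaw q.aT q.dT))
      (fun x => Real.log (bMat η (z n) (y.1.2 n).1) +
        if n.1 = 0 then Real.log (M.p0 (z n)) else
          Real.log (x.1 (z (pre n)) (z n)) + Real.log x.2 + gMat η (z (pre n)) (z n) -
            Real.exp (gMat η (z (pre n)) (z n)) * gap y n * x.2)
      (Real.log (bMat η (z n) (y.1.2 n).1) +
        if n.1 = 0 then Real.log (M.p0 (z n)) else
          M.meanLog q (z (pre n)) (z n) + gMat η (z (pre n)) (z n) -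
            Real.exp (gMat η (z (pre n)) (z n)) * gap y n * M.meanRate q) := by
    intro n
    refine (HasMean.const _).add ?_
    split_ifs
    · exact HasMean.const _
    · exact ((hA _ _).add (HasMean.const _)).sub (hX.const_mul _)
  have hD1 : HasMean ((M.dirLaw q.γ).prod (M.gamLaw q.aT q.dT))
      (fun x => Real.log (M.dirDens M.r x.1 / M.dirDens q.γ x.1)) _ :=
    HasMean.comp_fst (g := fun Λ => Real.log (M.dirDens M.r Λ / M.dirDens q.γ Λ))
      ⟨M.integrable_log_dirDens_div q.γ_pos M.r_pos, rfl⟩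
  have hD2 : HasMean ((M.dirLaw q.γ).prod (M.gamLaw q.aT q.dT))
      (fun x => Real.log (M.gamDens M.a M.d x.2 / M.gamDens q.aT q.dT x.2)) _ :=
    HasMean.comp_snd (g := fun x => Real.log (M.gamDens M.a M.d x / M.gamDens q.aT q.dT x))
      ⟨hM.integrable_log_gamDens_div q.aT q.dT M.a M.d, rfl⟩
  have hall := ((((HasMean.sum Finset.univ fun n _ => hterm n).add hD1).add hD2).add
    (HasMean.const (Real.log (M.fτ y.2)))).sub (HasMean.const (Real.log c))
  have hw : Real.log (M.weight y (M.meanLog q) (M.meanRate q) η z) =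
      ∑ n : Fin y.1.1, (Real.log (bMat η (z n) (y.1.2 n).1) +
        if n.1 = 0 then Real.log (M.p0 (z n)) else
          M.meanLog q (z (pre n)) (z n) + gMat η (z (pre n)) (z n) -
            Real.exp (gMat η (z (pre n)) (z n)) * gap y n * M.meanRate q) := by
    rw [Model.weight, Real.log_prod]
    · refine Finset.sum_congr rfl fun n _ => ?_
      split_ifs with h
      · rw [Real.log_mul (hη _ _).ne' (hz n h).ne']
      · rw [Real.log_mul (hη _ _).ne' (Real.exp_pos _).ne', Real.log_exp]
        ring
    · intro n _
      refine mul_ne_zero (hη _ _).ne' ?_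
      split_ifs with h
      · exact (hz n h).ne'
      · exact (Real.exp_pos _).ne'
  have hval : Real.log (M.weight y (M.meanLog q) (M.meanRate q) η z) - M.divergence q +
        Real.log (M.fτ y.2) - Real.log c =
      (∑ n : Fin y.1.1, (Real.log (bMat η (z n) (y.1.2 n).1) +
        if n.1 = 0 then Real.log (M.p0 (z n)) else
          M.meanLog q (z (pre n)) (z n) + gMat η (z (pre n)) (z n) -
            Real.exp (gMat η (z (pre n)) (z n)) * gap y n * M.meanRate q)) +
      (∫ Λ, Real.log (M.dirDens M.r Λ / M.dirDens q.γ Λ) ∂(M.dirLaw q.γ)) +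
      (∫ x, Real.log (M.gamDens M.a M.d x / M.gamDens q.aT q.dT x) ∂(M.gamLaw q.aT q.dT)) +
      Real.log (M.fτ y.2) - Real.log c := by
    rw [hw, Model.divergence]; ring
  rw [hval]
  refine hall.congr ?_
  have hfst : ∀ᵐ x ∂((M.dirLaw q.γ).prod (M.gamLaw q.aT q.dT)),
      ∀ k' k, 0 < x.1 k' k :=
    Measure.quasiMeasurePreserving_fst.ae
      ((M.ae_dirLaw q.γ).mono fun Λ h k' k => (h.2 k' k).1)
  have hsnd : ∀ᵐ x ∂((M.dirLaw q.γ).prod (M.gamLaw q.aT q.dT)), 0 < x.2 :=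
    Measure.quasiMeasurePreserving_snd.ae
      ((M.ae_gamLaw q.aT q.dT).mono fun x h => M.suppξ_sub h)
  filter_upwards [hfst, hsnd] with x h1 h2
  have hd1 := M.dirDens_pos M.r_pos h1
  have hd2 := M.dirDens_pos q.γ_pos h1
  have hg1 := hM.gamDens_pos M.a M.d h2
  have hg2 := hM.gamDens_pos q.aT q.dT h2
  have hterm0 : ∀ n : Fin y.1.1, 0 < bMat η (z n) (y.1.2 n).1 *
      if n.1 = 0 then M.p0 (z n)
      else x.1 (z (pre n)) (z n) * (x.2 * Real.exp (gMat η (z (pre n)) (z n)) *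
        Real.exp (-(x.2 * Real.exp (gMat η (z (pre n)) (z n)) * gap y n))) := by
    intro n
    refine mul_pos (hη _ _) ?_
    split_ifs with h
    · exact hz n h
    · have := h1 (z (pre n)) (z n); positivity
  have hprod := Finset.prod_pos fun n (_ : n ∈ Finset.univ) => hterm0 n
  rw [Model.joint, log_mul_div_mul hprod hd1 hg1 hfτ hg2 hc hd2,
    Real.log_prod fun n _ => (hterm0 n).ne']
  have hsum : ∑ n : Fin y.1.1, (Real.log (bMat η (z n) (y.1.2 n).1) +
        if n.1 = 0 then Real.log (M.p0 (z n)) else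
          Real.log (x.1 (z (pre n)) (z n)) + Real.log x.2 + gMat η (z (pre n)) (z n) -
            Real.exp (gMat η (z (pre n)) (z n)) * gap y n * x.2) =
      ∑ n : Fin y.1.1, Real.log (bMat η (z n) (y.1.2 n).1 *
        if n.1 = 0 then M.p0 (z n)
        else x.1 (z (pre n)) (z n) * (x.2 * Real.exp (gMat η (z (pre n)) (z n)) *
          Real.exp (-(x.2 * Real.exp (gMat η (z (pre n)) (z n)) * gap y n)))) := by
    refine Finset.sum_congr rfl fun n _ => ?_
    split_ifs with h
    · rw [Real.log_mul (hη _ _).ne' (hz n h).ne']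
    · have h3 := h1 (z (pre n)) (z n)
      rw [Real.log_mul (hη _ _).ne' (by positivity), Real.log_mul h3.ne' (by positivity),
        Real.log_mul (by positivity) (by positivity), Real.log_mul h2.ne' (by positivity),
        Real.log_exp, Real.log_exp]
      ring
  rw [hsum]

/-- Sequences with vanishing initial probability have zero variational mass and drop out, whatever
value the logarithm takes there. -/
lemma Model.elbo_eq (hM : M.CompactSupport) (y : Obs W) {η : Param K W}
    (hη : ∀ k e, 0 < bMat η k e) (q : VarParam K) (hfτ : M.fτ y.2 ≠ 0) :
    M.elbo y η q = ∑ z, M.qz y η q z *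
      (Real.log (M.weight y (M.meanLog q) (M.meanRate q) η z) - Real.log (M.qz y η q z)) -
      M.divergence q + Real.log (M.fτ y.2) := by
  have := M.isProbabilityMeasure_dirLaw q.γ_pos
  have := hM.isProbabilityMeasure_gamLaw q.aT q.dT
  have hsum := M.sum_weight_pos y (fun k' k => Real.log (q.κ * q.p k' k)) q.κ hη
  have hone : ∑ z, M.qz y η q z = 1 := by
    simp only [Model.qz, M.qzWeight_eq_weight, ← Finset.sum_div]
    exact div_self hsum.ne'
  have hmean : ∀ z ∈ (Finset.univ : Finset (Fin y.1.1 → Fin K)),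
      HasMean ((M.dirLaw q.γ).prod (M.gamLaw q.aT q.dT))
      (fun x => M.qz y η q z * Real.log (M.joint y η z x.1 x.2 * M.fτ y.2 /
        (M.gamDens q.aT q.dT x.2 * M.qz y η q z * M.dirDens q.γ x.1)))
      (M.qz y η q z * (Real.log (M.weight y (M.meanLog q) (M.meanRate q) η z) - M.divergence q +
        Real.log (M.fτ y.2) - Real.log (M.qz y η q z))) := by
    intro z _
    by_cases hz : ∀ n : Fin y.1.1, n.1 = 0 → 0 < M.p0 (z n)
    · refine (M.hasMean_log hM y hη q hz hfτ ?_).const_mul _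
      rw [Model.qz, M.qzWeight_eq_weight]
      exact div_pos (M.weight_pos _ _ _ hη hz) hsum
    · have h0 : M.qz y η q z = 0 := by
        rw [Model.qz, M.qzWeight_eq_weight, M.weight_eq_zero _ _ _ hz, zero_div]
      simp only [h0, zero_mul]
      exact HasMean.const 0
  rw [Model.elbo, (HasMean.sum Finset.univ hmean).2]
  have : ∀ z, M.qz y η q z * (Real.log (M.weight y (M.meanLog q) (M.meanRate q) η z) -
        M.divergence q + Real.log (M.fτ y.2) - Real.log (M.qz y η q z)) =
      M.qz y η q z * (Real.log (M.weight y (M.meanLog q) (M.meanRate q) η z) -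
        Real.log (M.qz y η q z)) +
      M.qz y η q z * (Real.log (M.fτ y.2) - M.divergence q) := fun z => by ring
  simp only [this]
  rw [Finset.sum_add_distrib, ← Finset.sum_mul, hone]
  ring

/-- With the laws of Λ and ξ fixed, the dependence on the law of the topics is of the form `Σ q log
(w / q)`, bounded by the log total weight through Gibbs' inequality. -/
lemma Model.elbo_le (hM : M.CompactSupport) (y : Obs W) {η : Param K W}
    (hη : ∀ k e, 0 < bMat η k e) (q : VarParam K) (hfτ : M.fτ y.2 ≠ 0) :
    M.elbo y η q ≤ M.logPartition y (M.meanLog q) (M.meanRate q) η - M.divergence q +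
      Real.log (M.fτ y.2) := by
  rw [M.elbo_eq hM y hη q hfτ]
  have hsum := M.sum_weight_pos y (fun k' k => Real.log (q.κ * q.p k' k)) q.κ hη
  have h := sum_mul_log_sub_log_le Finset.univ (p := M.qz y η q)
    (w := M.weight y (M.meanLog q) (M.meanRate q) η) (fun z _ => ?_) ?_ (fun z _ => ?_) ?_
  · rw [Model.logPartition]; linarith
  · rw [Model.qz, M.qzWeight_eq_weight]
    exact div_nonneg (M.weight_nonneg _ _ _ hη z) hsum.le
  · simp only [Model.qz, M.qzWeight_eq_weight, ← Finset.sum_div]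
    exact div_self hsum.ne'
  · exact M.weight_nonneg _ _ _ hη z
  · intro z _ h0
    by_cases hz : ∀ n : Fin y.1.1, n.1 = 0 → 0 < M.p0 (z n)
    · exact absurd h0 (M.weight_pos _ _ _ hη hz).ne'
    · rw [Model.qz, M.qzWeight_eq_weight, M.weight_eq_zero _ _ _ hz, zero_div]

/-- For given laws of `Λ` and `ξ` the optimal law of the topics belongs to the family. -/
lemma Model.exists_elbo_eq (hM : M.CompactSupport) (y : Obs W) {η : Param K W}
    (hη : ∀ k e, 0 < bMat η k e) (q : VarParam K) (hfτ : M.fτ y.2 ≠ 0) :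
    ∃ q', M.elbo y η q' = M.logPartition y (M.meanLog q) (M.meanRate q) η - M.divergence q +
      Real.log (M.fτ y.2) := by
  obtain ⟨x₀, x₁, h₀, -, hx⟩ := hM.exists_bounds
  have hrate : 0 < M.meanRate q := h₀.trans_le (hM.meanRate_mem hx q).1
  -- Taking `κ = E ξ` and `p = exp (E log λ + E log ξ) / κ` makes the variational weights equal to
  -- the averaged model weights, which is the case of equality. The laws of Λ and ξ are those of
  -- `q`, so the divergence is unchanged.
  let q' : VarParam K :=
    { q with
      p := fun k' k => Real.exp (M.meanLog q k' k) / M.meanRate q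
      p_pos := fun k' k => div_pos (Real.exp_pos _) hrate
      κ := M.meanRate q
      κ_pos := hrate }
  have hsum := M.sum_weight_pos y (M.meanLog q) (M.meanRate q) hη
  have hwt : M.qzWeight y η q' = M.weight y (M.meanLog q) (M.meanRate q) η := by
    rw [M.qzWeight_eq_weight]
    have : (fun k' k => Real.log (q'.κ * q'.p k' k)) = M.meanLog q := by
      funext k' k
      change Real.log (M.meanRate q * (Real.exp (M.meanLog q k' k) / M.meanRate q)) = _
      rw [mul_div_cancel₀ _ hrate.ne', Real.log_exp]
    rw [this]
  refine ⟨q', ?_⟩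
  rw [M.elbo_eq hM y hη q' hfτ]
  change ∑ z, M.qz y η q' z * (Real.log (M.weight y (M.meanLog q) (M.meanRate q) η z) -
    Real.log (M.qz y η q' z)) - M.divergence q + Real.log (M.fτ y.2) = _
  congr 2
  have hterm : ∀ z, M.qz y η q' z * (Real.log (M.weight y (M.meanLog q) (M.meanRate q) η z) -
      Real.log (M.qz y η q' z)) = M.weight y (M.meanLog q) (M.meanRate q) η z /
        (∑ z', M.weight y (M.meanLog q) (M.meanRate q) η z') *
        M.logPartition y (M.meanLog q) (M.meanRate q) η := by
    intro z
    rw [Model.qz, hwt]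
    rcases eq_or_ne (M.weight y (M.meanLog q) (M.meanRate q) η z) 0 with h0 | h0
    · simp [h0]
    · rw [Real.log_div h0 hsum.ne', Model.logPartition]
      ring
  simp only [hterm]
  rw [← Finset.sum_mul, ← Finset.sum_div, div_self hsum.ne', one_mul]

/-- `f(y | η)` as a supremum over the laws of `Λ` and `ξ` only. -/
lemma Model.f_eq (hM : M.CompactSupport) (y : Obs W) {η : Param K W}
    (hη : ∀ k e, 0 < bMat η k e) (hfτ : M.fτ y.2 ≠ 0)
    (hbdd : BddAbove (Set.range fun q =>
      M.logPartition y (M.meanLog q) (M.meanRate q) η - M.divergence q)) :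
    M.f y η = (⨆ q, (M.logPartition y (M.meanLog q) (M.meanRate q) η - M.divergence q)) +
      Real.log (M.fτ y.2) := by
  have : Nonempty (VarParam K) :=
    ⟨⟨1, one_pos, 1, one_pos, 1, fun _ _ => one_pos, 1, fun _ _ => one_pos, 1, one_pos⟩⟩
  have hle : ∀ q, M.elbo y η q ≤
      (⨆ q, (M.logPartition y (M.meanLog q) (M.meanRate q) η - M.divergence q)) +
      Real.log (M.fτ y.2) := fun q =>
    (M.elbo_le hM y hη q hfτ).trans (add_le_add_left (le_ciSup hbdd q) _)
  refine le_antisymm (ciSup_le hle) ?_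
  rw [← le_sub_iff_add_le]
  refine ciSup_le fun q => ?_
  obtain ⟨q', hq'⟩ := M.exists_elbo_eq hM y hη q hfτ
  rw [le_sub_iff_add_le, ← hq']
  exact le_ciSup (f := fun q => M.elbo y η q) ⟨_, Set.forall_mem_range.2 hle⟩ q'

/-- Here the logarithm is taken at zero, where `Real.log 0 = 0`. Such observations have probability
zero, but regularity of `f y` is recorded for every `y`. -/
lemma Model.f_eq_zero (M : Model K) (y : Obs W) (η : Param K W) (hfτ : M.fτ y.2 = 0) :
    M.f y η = 0 := by
  have : ∀ q, M.elbo y η q = 0 := fun q => by simp [Model.elbo, hfτ]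
  simp [Model.f, this]

end Elbo

end LTA


namespace LTA

/-! ### Calculus of Lipschitz semiconvex functions. -/

section SemiconvexLip

variable {E : Type*} [NormedAddCommGroup E] [NormedSpace ℝ E]

/-- `g` is Lipschitz and semiconvex on `s`, both with constant `L`. -/
structure SemiconvexLip (s : Set E) (L : ℝ) (g : E → ℝ) : Prop where
  lip : ∀ x ∈ s, ∀ y ∈ s, |g x - g y| ≤ L * ‖x - y‖
  semiconvex : ∀ x ∈ s, ∀ y ∈ s, ∀ a b : ℝ, 0 ≤ a → 0 ≤ b → a + b = 1 →
    g (a • x + b • y) ≤ a * g x + b * g y + a * b * (L / 2 * ‖x - y‖ ^ 2)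

variable {s : Set E} {L L' : ℝ} {g g' : E → ℝ}

lemma SemiconvexLip.const (s : Set E) (c : ℝ) : SemiconvexLip s 0 fun _ => c where
  lip x _ y _ := by simp
  semiconvex x _ y _ a b _ _ hab := by rw [← add_mul, hab]; simp

lemma SemiconvexLip.mono (h : SemiconvexLip s L g) (hL : L ≤ L') : SemiconvexLip s L' g where
  lip x hx y hy := (h.lip x hx y hy).trans (by gcongr)
  semiconvex x hx y hy a b ha hb hab := (h.semiconvex x hx y hy a b ha hb hab).trans (by gcongr)

lemma SemiconvexLip.congr (h : SemiconvexLip s L g) (hs : Convex ℝ s)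
    (hg : ∀ x ∈ s, g' x = g x) : SemiconvexLip s L g' where
  lip x hx y hy := by rw [hg x hx, hg y hy]; exact h.lip x hx y hy
  semiconvex x hx y hy a b ha hb hab := by
    rw [hg x hx, hg y hy, hg _ (hs hx hy ha hb hab)]; exact h.semiconvex x hx y hy a b ha hb hab

lemma SemiconvexLip.add (h : SemiconvexLip s L g) (h' : SemiconvexLip s L' g') :
    SemiconvexLip s (L + L') fun x => g x + g' x where
  lip x hx y hy := by
    have h1 := h.lip x hx y hy
    have h2 := h'.lip x hx y hy
    rw [add_mul, add_sub_add_comm]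
    exact (abs_add_le _ _).trans (add_le_add h1 h2)
  semiconvex x hx y hy a b ha hb hab := by
    have h1 := h.semiconvex x hx y hy a b ha hb hab
    have h2 := h'.semiconvex x hx y hy a b ha hb hab
    linarith

lemma SemiconvexLip.add_const (h : SemiconvexLip s L g) (c : ℝ) :
    SemiconvexLip s L fun x => g x + c := by
  simpa using h.add (SemiconvexLip.const s c)

lemma SemiconvexLip.const_mul (h : SemiconvexLip s L g) {c : ℝ} (hc : 0 ≤ c) :
    SemiconvexLip s (c * L) fun x => c * g x where
  lip x hx y hy := by
    rw [← mul_sub, abs_mul, abs_of_nonneg hc, mul_assoc]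
    exact mul_le_mul_of_nonneg_left (h.lip x hx y hy) hc
  semiconvex x hx y hy a b ha hb hab := by
    have := mul_le_mul_of_nonneg_left (h.semiconvex x hx y hy a b ha hb hab) hc
    linarith

lemma SemiconvexLip.sum {ι : Type*} (t : Finset ι) {L : ι → ℝ} {g : ι → E → ℝ}
    (h : ∀ i ∈ t, SemiconvexLip s (L i) (g i)) :
    SemiconvexLip s (∑ i ∈ t, L i) fun x => ∑ i ∈ t, g i x := by
  classical
  induction t using Finset.induction_on with
  | empty => simpa using SemiconvexLip.const s 0
  | insert i t hi ih =>
    simp only [Finset.sum_insert hi]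
    exact (h i (Finset.mem_insert_self i t)).add
      (ih fun j hj => h j (Finset.mem_insert_of_mem hj))

/-- Suprema of families of functions that are Lipschitz and semiconvex with a common constant. -/
lemma SemiconvexLip.of_isLUB {ι : Type*} {g : ι → E → ℝ} {G : E → ℝ} (hs : Convex ℝ s)
    (h : ∀ i, SemiconvexLip s L (g i)) (hle : ∀ i, ∀ x ∈ s, g i x ≤ G x)
    (happ : ∀ x ∈ s, ∀ ε > 0, ∃ i, G x ≤ g i x + ε) : SemiconvexLip s L G where
  lip := by
    have key : ∀ x ∈ s, ∀ y ∈ s, G x - G y ≤ L * ‖x - y‖ := by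
      intro x hx y hy
      refine le_of_forall_pos_le_add fun ε hε => ?_
      obtain ⟨i, hi⟩ := happ x hx ε hε
      have h1 := (le_abs_self _).trans ((h i).lip x hx y hy)
      have h2 := hle i y hy
      linarith
    intro x hx y hy
    rw [abs_sub_le_iff]
    exact ⟨key x hx y hy, by rw [norm_sub_rev]; exact key y hy x hx⟩
  semiconvex x hx y hy a b ha hb hab := by
    refine le_of_forall_pos_le_add fun ε hε => ?_
    obtain ⟨i, hi⟩ := happ _ (hs hx hy ha hb hab) ε hε
    have h1 := (h i).semiconvex x hx y hy a b ha hb hab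
    have h2 := mul_le_mul_of_nonneg_left (hle i x hx) ha
    have h3 := mul_le_mul_of_nonneg_left (hle i y hy) hb
    linarith

/-- Composition with an affine functional that is Lipschitz with constant `c`. -/
lemma SemiconvexLip.comp_affine {I : Set ℝ} {h : ℝ → ℝ} (hh : SemiconvexLip I L h) (hL : 0 ≤ L)
    {ℓ : E → ℝ} {c : ℝ} (hc : 1 ≤ c) (hmaps : ∀ x ∈ s, ℓ x ∈ I)
    (hlip : ∀ x y, |ℓ x - ℓ y| ≤ c * ‖x - y‖)
    (haff : ∀ x y (a b : ℝ), a + b = 1 → ℓ (a • x + b • y) = a * ℓ x + b * ℓ y) :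
    SemiconvexLip s (c ^ 2 * L) fun x => h (ℓ x) where
  lip x hx y hy := by
    have h1 := hh.lip _ (hmaps x hx) _ (hmaps y hy)
    rw [Real.norm_eq_abs] at h1
    have h2 := hlip x y
    -- Because `c ≥ 1`, the semiconvexity constant `c ^ 2 * L` also serves as Lipschitz constant.
    have h3 : c * ‖x - y‖ ≤ c ^ 2 * ‖x - y‖ := by
      refine mul_le_mul_of_nonneg_right ?_ (norm_nonneg _)
      nlinarith
    calc |h (ℓ x) - h (ℓ y)| ≤ L * |ℓ x - ℓ y| := h1
      _ ≤ L * (c ^ 2 * ‖x - y‖) := mul_le_mul_of_nonneg_left (h2.trans h3) hL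
      _ = c ^ 2 * L * ‖x - y‖ := by ring
  semiconvex x hx y hy a b ha hb hab := by
    have h1 := hh.semiconvex _ (hmaps x hx) _ (hmaps y hy) a b ha hb hab
    rw [haff x y a b hab]
    simp only [smul_eq_mul] at h1
    refine h1.trans ?_
    have h2 : ‖ℓ x - ℓ y‖ ^ 2 ≤ c ^ 2 * ‖x - y‖ ^ 2 := by
      rw [← mul_pow]
      exact pow_le_pow_left₀ (norm_nonneg _) (hlip x y) 2
    have h3 : L / 2 * ‖ℓ x - ℓ y‖ ^ 2 ≤ c ^ 2 * L / 2 * ‖x - y‖ ^ 2 := by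
      calc L / 2 * ‖ℓ x - ℓ y‖ ^ 2 ≤ L / 2 * (c ^ 2 * ‖x - y‖ ^ 2) := by gcongr
        _ = _ := by ring
    have h4 := mul_le_mul_of_nonneg_left h3 (mul_nonneg ha hb)
    linarith

/-- The derivative is at most `1 / β` and the second derivative is bounded below on the half-line;
the sum of the two terms is one constant for both properties. The concavity defect is controlled by
`log t ≤ t - 1`, which leaves exactly `a b (x - y)² / (x y)`. -/
lemma semiconvexLip_log {β : ℝ} (hβ : 0 < β) :
    SemiconvexLip (Set.Ici β) (2 / β ^ 2 + 1 / β) Real.log where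
  lip := by
    have key : ∀ x ∈ Set.Ici β, ∀ y ∈ Set.Ici β,
        Real.log x - Real.log y ≤ (2 / β ^ 2 + 1 / β) * ‖x - y‖ := by
      intro x hx y hy
      have hx0 : 0 < x := hβ.trans_le hx
      have hy0 : 0 < y := hβ.trans_le hy
      rw [← Real.log_div hx0.ne' hy0.ne']
      calc Real.log (x / y) ≤ x / y - 1 := Real.log_le_sub_one_of_pos (div_pos hx0 hy0)
        _ = (x - y) / y := by field_simp
        _ ≤ ‖x - y‖ / β := by
            exact div_le_div₀ (norm_nonneg _) (le_abs_self _) hβ hy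
        _ = 1 / β * ‖x - y‖ := by ring
        _ ≤ _ := by
            refine mul_le_mul_of_nonneg_right ?_ (norm_nonneg _)
            have : 0 < 2 / β ^ 2 := by positivity
            linarith
    intro x hx y hy
    rw [abs_sub_le_iff]
    exact ⟨key x hx y hy, by rw [norm_sub_rev]; exact key y hy x hx⟩
  semiconvex x hx y hy a b ha hb hab := by
    have hx0 : 0 < x := hβ.trans_le hx
    have hy0 : 0 < y := hβ.trans_le hy
    have hβx : β ≤ x := hx
    have hβy : β ≤ y := hy
    set c := a • x + b • y with hc
    have hc' : c = a * x + b * y := rfl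
    have hβc : β ≤ c := by
      have h1 := mul_le_mul_of_nonneg_left hβx ha
      have h2 := mul_le_mul_of_nonneg_left hβy hb
      have h3 : a * β + b * β = β := by rw [← add_mul, hab, one_mul]
      linarith
    have hc0 : 0 < c := hβ.trans_le hβc
    have h1 := Real.log_le_sub_one_of_pos (div_pos hc0 hx0)
    have h2 := Real.log_le_sub_one_of_pos (div_pos hc0 hy0)
    rw [Real.log_div hc0.ne' hx0.ne'] at h1
    rw [Real.log_div hc0.ne' hy0.ne'] at h2
    have h3 := mul_le_mul_of_nonneg_left h1 ha
    have h4 := mul_le_mul_of_nonneg_left h2 hb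
    have hb' : b = 1 - a := by linarith
    have h5 : a * (c / x - 1) + b * (c / y - 1) = a * b * ((x - y) ^ 2 / (x * y)) := by
      rw [hc', hb']; field_simp; ring
    have h6 : (x - y) ^ 2 / (x * y) ≤ (x - y) ^ 2 / β ^ 2 := by
      refine div_le_div_of_nonneg_left (sq_nonneg _) (by positivity) ?_
      rw [sq]; exact mul_le_mul hβx hβy hβ.le hx0.le
    have h7 : (x - y) ^ 2 / β ^ 2 ≤ (2 / β ^ 2 + 1 / β) / 2 * ‖x - y‖ ^ 2 := by
      rw [Real.norm_eq_abs, sq_abs]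
      have : 0 ≤ 1 / β / 2 * (x - y) ^ 2 := by positivity
      calc (x - y) ^ 2 / β ^ 2 = 2 / β ^ 2 / 2 * (x - y) ^ 2 := by ring
        _ ≤ 2 / β ^ 2 / 2 * (x - y) ^ 2 + 1 / β / 2 * (x - y) ^ 2 := by linarith
        _ = _ := by ring
    have h8 := mul_le_mul_of_nonneg_left (h6.trans h7) (mul_nonneg ha hb)
    have h9 : a * (Real.log c - Real.log x) + b * (Real.log c - Real.log y) =
        Real.log c - (a * Real.log x + b * Real.log y) := by rw [hb']; ring
    linarith

lemma exp_sub_exp_le (x y : ℝ) : Real.exp x - Real.exp y ≤ Real.exp x * (x - y) := by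
  have h := Real.add_one_le_exp (y - x)
  have h1 := mul_le_mul_of_nonneg_left h (Real.exp_pos x).le
  rw [← Real.exp_add, add_sub_cancel] at h1
  linarith

lemma abs_exp_sub_exp_le {x y m : ℝ} (hx : x ≤ m) (hy : y ≤ m) :
    |Real.exp x - Real.exp y| ≤ Real.exp m * |x - y| := by
  have key : ∀ x y : ℝ, x ≤ m → y ≤ m → Real.exp x - Real.exp y ≤ Real.exp m * |x - y| := by
    intro x y hx hy
    calc Real.exp x - Real.exp y ≤ Real.exp x * (x - y) := exp_sub_exp_le x y
      _ ≤ Real.exp x * |x - y| := by gcongr; exact le_abs_self _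
      _ ≤ _ := by gcongr
  rw [abs_sub_le_iff]
  exact ⟨key x y hx hy, by rw [abs_sub_comm]; exact key y x hy hx⟩

/-- The sign of `k` is free because the gaps of an arbitrary observation may be negative. Only the
Jensen gap of the exponential matters: it is nonnegative and, by tangent inequalities, at most `a b
exp m (x - y)²`. -/
lemma semiconvexLip_sub_mul_exp (m k : ℝ) :
    SemiconvexLip (Set.Iic m) (1 + 2 * (|k| * Real.exp m)) fun t => t - k * Real.exp t where
  lip x hx y hy := by
    have h1 := abs_exp_sub_exp_le (Set.mem_Iic.1 hx) (Set.mem_Iic.1 hy)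
    have h2 : x - k * Real.exp x - (y - k * Real.exp y) =
      (x - y) - k * (Real.exp x - Real.exp y) := by ring
    have h3 : |k * (Real.exp x - Real.exp y)| ≤ |k| * (Real.exp m * |x - y|) := by
      rw [abs_mul]; gcongr
    have h4 : 0 ≤ |k| * Real.exp m * |x - y| := by positivity
    rw [h2, Real.norm_eq_abs]
    refine (abs_sub _ _).trans ?_
    linarith
  semiconvex x hx y hy a b ha hb hab := by
    have hx' : x ≤ m := hx
    have hy' : y ≤ m := hy
    set c := a • x + b • y with hc
    have hc' : c = a * x + b * y := rfl
    have hb' : b = 1 - a := by linarith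
    have hsq : 0 ≤ a * b * ‖x - y‖ ^ 2 := by positivity
    have hconv : Real.exp c ≤ a * Real.exp x + b * Real.exp y :=
      convexOn_exp.2 (Set.mem_univ x) (Set.mem_univ y) ha hb hab
    have hup : a * Real.exp x + b * Real.exp y - Real.exp c ≤
        a * b * (Real.exp m * ‖x - y‖ ^ 2) := by
      have h1 := mul_le_mul_of_nonneg_left (exp_sub_exp_le x c) ha
      have h2 := mul_le_mul_of_nonneg_left (exp_sub_exp_le y c) hb
      have h3 : a * (Real.exp x * (x - c)) + b * (Real.exp y * (y - c)) =
          a * b * ((x - y) * (Real.exp x - Real.exp y)) := by rw [hc', hb']; ring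
      have h4 : (x - y) * (Real.exp x - Real.exp y) ≤ Real.exp m * ‖x - y‖ ^ 2 := by
        calc _ ≤ |(x - y) * (Real.exp x - Real.exp y)| := le_abs_self _
          _ = |x - y| * |Real.exp x - Real.exp y| := abs_mul _ _
          _ ≤ |x - y| * (Real.exp m * |x - y|) := by
              gcongr; exact abs_exp_sub_exp_le hx' hy'
          _ = _ := by rw [Real.norm_eq_abs]; ring
      have h5 := mul_le_mul_of_nonneg_left h4 (mul_nonneg ha hb)
      have h6 : a * (Real.exp x - Real.exp c) + b * (Real.exp y - Real.exp c) =
        a * Real.exp x + b * Real.exp y - Real.exp c := by rw [hb']; ring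
      linarith
    have hk : k * (a * Real.exp x + b * Real.exp y - Real.exp c) ≤
        |k| * (a * b * (Real.exp m * ‖x - y‖ ^ 2)) := by
      calc _ ≤ |k| * (a * Real.exp x + b * Real.exp y - Real.exp c) :=
            mul_le_mul_of_nonneg_right (le_abs_self k) (by linarith)
        _ ≤ _ := mul_le_mul_of_nonneg_left hup (abs_nonneg k)
    simp only [hc'] at *
    linarith

/-- `log ∑ exp` of Lipschitz semiconvex functions. -/
lemma SemiconvexLip.log_sum_exp {ι : Type*} (t : Finset ι) (ht : t.Nonempty) {g : ι → E → ℝ}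
    (hs : Convex ℝ s) (h : ∀ i ∈ t, SemiconvexLip s L (g i)) :
    SemiconvexLip s L fun x => Real.log (∑ i ∈ t, Real.exp (g i x)) := by
  have hpos : ∀ x, 0 < ∑ i ∈ t, Real.exp (g i x) := fun x =>
    Finset.sum_pos (fun i _ => Real.exp_pos _) ht
  -- By the Gibbs variational formula, log-sum-exp is the supremum over probability vectors `p` of
  -- `Σ p_i (g_i - log p_i)`, attained at the normalised exponentials. Each competitor is a convex
  -- combination plus a constant, so the constant `L` does not grow with the number of terms.
  refine SemiconvexLip.of_isLUB (ι := {p : ι → ℝ // (∀ i ∈ t, 0 ≤ p i) ∧ ∑ i ∈ t, p i = 1})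
    (g := fun p x => ∑ i ∈ t, p.1 i * (g i x + -Real.log (p.1 i))) hs (fun p => ?_)
    (fun p x _ => ?_) fun x _ ε hε => ?_
  · have := SemiconvexLip.sum t (s := s) fun i hi =>
      ((h i hi).add_const (-Real.log (p.1 i))).const_mul (p.2.1 i hi)
    rwa [← Finset.sum_mul, p.2.2, one_mul] at this
  · have := sum_mul_log_sub_log_le t (w := fun i => Real.exp (g i x)) p.2.1 p.2.2
      (fun i _ => (Real.exp_pos _).le) fun i _ h0 => absurd h0 (Real.exp_pos _).ne'
    simpa [Real.log_exp, sub_eq_add_neg] using this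
  · refine ⟨⟨fun i => Real.exp (g i x) / ∑ j ∈ t, Real.exp (g j x),
      fun i _ => div_nonneg (Real.exp_pos _).le (hpos x).le, ?_⟩, ?_⟩
    · rw [← Finset.sum_div, div_self (hpos x).ne']
    · have : ∀ i, Real.exp (g i x) / (∑ j ∈ t, Real.exp (g j x)) * (g i x +
          -Real.log (Real.exp (g i x) / ∑ j ∈ t, Real.exp (g j x))) =
          Real.exp (g i x) / (∑ j ∈ t, Real.exp (g j x)) *
            Real.log (∑ j ∈ t, Real.exp (g j x)) := by
        intro i
        rw [Real.log_div (Real.exp_pos _).ne' (hpos x).ne', Real.log_exp]; ring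
      simp only [this]
      rw [← Finset.sum_mul, ← Finset.sum_div, div_self (hpos x).ne', one_mul]
      linarith

lemma SemiconvexLip.strongConvexOn (h : SemiconvexLip s L g) (hs : Convex ℝ s) :
    StrongConvexOn s (-L) g := by
  refine ⟨hs, fun x hx y hy a b ha hb hab => ?_⟩
  have := h.semiconvex x hx y hy a b ha hb hab
  simp only [smul_eq_mul]
  linarith

end SemiconvexLip

end LTA


namespace LTA

/-! ### The parameter space and the size of an observation. -/

section ParamSpace

variable {K W : ℕ} {β gmin gmax : ℝ}

lemma bMat_castSucc (η : Param K W) (k : Fin K) (v : Fin W) :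
    bMat η k v.castSucc = η (Sum.inl (k, v)) := by simp [bMat]

lemma bMat_last (η : Param K W) (k : Fin K) :
    bMat η k (Fin.last W) = 1 - ∑ v : Fin W, η (Sum.inl (k, v)) := by simp [bMat]

lemma bMat_affine (k : Fin K) (e : Fin (W + 1)) (η η' : Param K W) (a b : ℝ) (hab : a + b = 1) :
    bMat (a • η + b • η') k e = a * bMat η k e + b * bMat η' k e := by
  refine Fin.lastCases ?_ (fun v => ?_) e
  · have hb : b = 1 - a := by linarith
    simp only [bMat_last, PiLp.add_apply, PiLp.smul_apply, smul_eq_mul, Finset.sum_add_distrib,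
      ← Finset.mul_sum]
    rw [hb]; ring
  · simp [bMat_castSucc]

/-- The factor `W + 1` covers the dependent last column, which involves `W` coordinates, and is at
least one even for `W = 0`. -/
lemma abs_bMat_sub_le (k : Fin K) (e : Fin (W + 1)) (η η' : Param K W) :
    |bMat η k e - bMat η' k e| ≤ (W + 1 : ℝ) * ‖η - η'‖ := by
  have hc : ∀ v, |η (Sum.inl (k, v)) - η' (Sum.inl (k, v))| ≤ ‖η - η'‖ := fun v =>
    PiLp.norm_apply_le (η - η') (Sum.inl (k, v))
  refine Fin.lastCases ?_ (fun v => ?_) e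
  · rw [bMat_last, bMat_last, sub_sub_sub_cancel_left, ← Finset.sum_sub_distrib]
    calc |∑ v : Fin W, (η' (Sum.inl (k, v)) - η (Sum.inl (k, v)))|
        ≤ ∑ v : Fin W, |η' (Sum.inl (k, v)) - η (Sum.inl (k, v))| :=
          Finset.abs_sum_le_sum_abs _ _
      _ ≤ ∑ _v : Fin W, ‖η - η'‖ := Finset.sum_le_sum fun v _ => by
          rw [abs_sub_comm]; exact hc v
      _ = W * ‖η - η'‖ := by simp
      _ ≤ _ := by gcongr; linarith
  · rw [bMat_castSucc, bMat_castSucc]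
    refine (hc v).trans (le_mul_of_one_le_left (norm_nonneg _) ?_)
    have : (0 : ℝ) ≤ W := Nat.cast_nonneg W
    linarith

lemma gMat_affine (k' k : Fin K) (η η' : Param K W) (a b : ℝ) :
    gMat (a • η + b • η') k' k = a * gMat η k' k + b * gMat η' k' k := by simp [gMat]

lemma abs_gMat_sub_le (k' k : Fin K) (η η' : Param K W) :
    |gMat η k' k - gMat η' k' k| ≤ (W + 1 : ℝ) * ‖η - η'‖ := by
  refine (PiLp.norm_apply_le (η - η') (Sum.inr (k', k))).trans
    (le_mul_of_one_le_left (norm_nonneg _) ?_)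
  have : (0 : ℝ) ≤ W := Nat.cast_nonneg W
  linarith

lemma convex_paramSpace (K W : ℕ) (β gmin gmax : ℝ) : Convex ℝ (paramSpace K W β gmin gmax) := by
  intro η h η' h' a b ha hb hab
  refine ⟨fun k e => ?_, fun k' k => ?_⟩
  · rw [bMat_affine k e η η' a b hab]
    exact convex_Icc β (1 - β) (h.1 k e) (h'.1 k e) ha hb hab
  · rw [gMat_affine]
    exact convex_Icc gmin gmax (h.2 k' k) (h'.2 k' k) ha hb hab

lemma bMat_pos (hβ : 0 < β) {η : Param K W} (h : η ∈ paramSpace K W β gmin gmax) (k : Fin K)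
    (e : Fin (W + 1)) : 0 < bMat η k e :=
  hβ.trans_le (h.1 k e).1

/-- The number of events plus the total length of the gaps. -/
noncomputable def size (y : Obs W) : ℝ := y.1.1 + ∑ n, |gap y n|

lemma size_nonneg (y : Obs W) : 0 ≤ size y :=
  add_nonneg (Nat.cast_nonneg _) (Finset.sum_nonneg fun _ _ => abs_nonneg _)

lemma sum_one_add_abs_gap (y : Obs W) (c : ℝ) : ∑ n, c * (1 + |gap y n|) = c * size y := by
  rw [← Finset.mul_sum, Finset.sum_add_distrib]; simp [size]

end ParamSpace

/-! ### Regularity and growth of the profiled evidence lower bound. -/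

section Sup

variable {K W : ℕ} {M : Model K} {β gmin gmax : ℝ}

/-- The sequences of topics of positive probability. -/
noncomputable def Model.validSeqs (M : Model K) (N : ℕ) : Finset (Fin N → Fin K) :=
  open Classical in Finset.univ.filter fun z => ∀ n : Fin N, n.1 = 0 → 0 < M.p0 (z n)

lemma Model.validSeqs_nonempty (M : Model K) (N : ℕ) : (M.validSeqs N).Nonempty := by
  obtain ⟨k, hk⟩ := M.exists_p0_pos
  exact ⟨fun _ => k, by simp [Model.validSeqs, hk]⟩

/-- The logarithm of the weight of a sequence of topics. -/
noncomputable def Model.logWeight (M : Model K) (y : Obs W) (A : Fin K → Fin K → ℝ) (x : ℝ)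
    (z : Fin y.1.1 → Fin K) (η : Param K W) : ℝ :=
  ∑ n, (Real.log (bMat η (z n) (y.1.2 n).1) + if n.1 = 0 then Real.log (M.p0 (z n))
    else gMat η (z (pre n)) (z n) - x * gap y n * Real.exp (gMat η (z (pre n)) (z n)) +
      A (z (pre n)) (z n))

lemma Model.weight_eq_exp (M : Model K) (y : Obs W) (A : Fin K → Fin K → ℝ) (x : ℝ)
    {η : Param K W} (hη : ∀ k e, 0 < bMat η k e) {z : Fin y.1.1 → Fin K}
    (hz : z ∈ M.validSeqs y.1.1) : M.weight y A x η z = Real.exp (M.logWeight y A x z η) := by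
  have hz' : ∀ n : Fin y.1.1, n.1 = 0 → 0 < M.p0 (z n) := by simpa [Model.validSeqs] using hz
  rw [Model.weight, Model.logWeight, Real.exp_sum]
  refine Finset.prod_congr rfl fun n _ => ?_
  rw [Real.exp_add, Real.exp_log (hη _ _)]
  congr 1
  split_ifs with h
  · rw [Real.exp_log (hz' n h)]
  · congr 1; ring

lemma Model.logPartition_eq (M : Model K) (y : Obs W) (A : Fin K → Fin K → ℝ) (x : ℝ)
    {η : Param K W} (hη : ∀ k e, 0 < bMat η k e) : M.logPartition y A x η =
      Real.log (∑ z ∈ M.validSeqs y.1.1, Real.exp (M.logWeight y A x z η)) := by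
  classical
  rw [Model.logPartition, ← Finset.sum_congr rfl fun z hz => M.weight_eq_exp y A x hη hz]
  congr 1
  refine (Finset.sum_subset (Finset.subset_univ _) fun z _ hz => ?_).symm
  refine M.weight_eq_zero y A x ?_
  simpa [Model.validSeqs] using hz

/-- The constant, relative to the size of the observation, of the Lipschitz and semiconvexity
bounds. -/
noncomputable def lipConst (W : ℕ) (β gmax x₁ : ℝ) : ℝ :=
  (W + 1 : ℝ) ^ 2 * (2 / β ^ 2 + 1 / β + 1 + 2 * (x₁ * Real.exp gmax))

lemma lipConst_nonneg {x₁ : ℝ} (hβ : 0 < β) (hx₁ : 0 ≤ x₁) : 0 ≤ lipConst W β gmax x₁ := by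
  unfold lipConst; positivity

/-- The constant does not involve `A`, which enters additively, and involves `x` only through its
upper bound. It is therefore common to all variational laws, as the supremum over them requires. -/
lemma Model.semiconvexLip_logWeight (M : Model K) (hβ : 0 < β) (y : Obs W)
    (A : Fin K → Fin K → ℝ) {x x₁ : ℝ} (hx : x ∈ Set.Icc 0 x₁) (z : Fin y.1.1 → Fin K) :
    SemiconvexLip (paramSpace K W β gmin gmax) (lipConst W β gmax x₁ * size y)
      (M.logWeight y A x z) := by
  have hW : (1 : ℝ) ≤ W + 1 := by
    have : (0 : ℝ) ≤ W := Nat.cast_nonneg W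
    linarith
  have hx₁ : 0 ≤ x₁ := hx.1.trans hx.2
  rw [← sum_one_add_abs_gap]
  refine SemiconvexLip.sum Finset.univ fun n _ => ?_
  have h1 : SemiconvexLip (paramSpace K W β gmin gmax)
      ((W + 1 : ℝ) ^ 2 * (2 / β ^ 2 + 1 / β))
      (fun η => Real.log (bMat η (z n) (y.1.2 n).1)) :=
    (semiconvexLip_log hβ).comp_affine (by positivity) hW (fun η hη => (hη.1 _ _).1)
      (abs_bMat_sub_le _ _) (bMat_affine _ _)
  have h2 : SemiconvexLip (paramSpace K W β gmin gmax)
      ((W + 1 : ℝ) ^ 2 * (1 + 2 * (x₁ * |gap y n| * Real.exp gmax)))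
      (fun η => if n.1 = 0 then Real.log (M.p0 (z n))
        else gMat η (z (pre n)) (z n) - x * gap y n * Real.exp (gMat η (z (pre n)) (z n)) +
          A (z (pre n)) (z n)) := by
    split_ifs with h
    · refine SemiconvexLip.mono (SemiconvexLip.const _ _) ?_
      positivity
    · refine SemiconvexLip.mono (((semiconvexLip_sub_mul_exp gmax (x * gap y n)).comp_affine
        (ℓ := fun η : Param K W => gMat η (z (pre n)) (z n)) (by positivity) hW
        (fun η hη => (hη.2 _ _).2) (abs_gMat_sub_le _ _)
        fun η η' a b _ => gMat_affine _ _ η η' a b).add_const _) ?_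
      rw [abs_mul, abs_of_nonneg hx.1]
      have := hx.2
      gcongr
  refine (h1.add h2).mono ?_
  have h3 : 0 ≤ (2 / β ^ 2 + 1 / β + 1) * |gap y n| := by positivity
  have h4 : 0 ≤ 2 * (x₁ * Real.exp gmax) := by positivity
  have h5 : 2 / β ^ 2 + 1 / β + (1 + 2 * (x₁ * |gap y n| * Real.exp gmax)) ≤
      (2 / β ^ 2 + 1 / β + 1 + 2 * (x₁ * Real.exp gmax)) * (1 + |gap y n|) := by linarith
  rw [lipConst, ← mul_add, mul_assoc ((W + 1 : ℝ) ^ 2)]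
  exact mul_le_mul_of_nonneg_left h5 (by positivity)

lemma Model.semiconvexLip_logPartition (M : Model K) (hβ : 0 < β) (y : Obs W)
    (A : Fin K → Fin K → ℝ) {x x₁ : ℝ} (hx : x ∈ Set.Icc 0 x₁) :
    SemiconvexLip (paramSpace K W β gmin gmax) (lipConst W β gmax x₁ * size y)
      (M.logPartition y A x) :=
  (SemiconvexLip.log_sum_exp _ (M.validSeqs_nonempty _) (convex_paramSpace K W β gmin gmax)
    fun z _ => M.semiconvexLip_logWeight hβ y A hx z).congr (convex_paramSpace K W β gmin gmax)
    fun _ hη => M.logPartition_eq y A x (bMat_pos hβ hη)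

lemma Model.p0_le_one (M : Model K) (k : Fin K) : M.p0 k ≤ 1 := by
  rw [← M.p0_mem.2]
  exact Finset.single_le_sum (fun j _ => M.p0_mem.1 j) (Finset.mem_univ k)

/-- There are `K ^ N` sequences, and each event contributes a factor at most exponential in one plus
its gap, uniformly in `q`. -/
lemma Model.CompactSupport.logPartition_le (hM : M.CompactSupport) (hβ : 0 < β) {x₀ x₁ : ℝ}
    (h₀ : 0 < x₀) (hx : M.suppξ ⊆ Set.Icc x₀ x₁) (y : Obs W) (q : VarParam K)
    {η : Param K W} (hη : η ∈ paramSpace K W β gmin gmax) :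
    M.logPartition y (M.meanLog q) (M.meanRate q) η ≤
      (Real.log K + (|Real.log x₁| + |gmax| + x₁ * Real.exp gmax)) * size y := by
  have hrate := hM.meanRate_mem hx q
  have hx₁ : 0 ≤ x₁ := h₀.le.trans (hrate.1.trans hrate.2)
  set C := |Real.log x₁| + |gmax| + x₁ * Real.exp gmax with hC
  have hC0 : 0 ≤ C := by positivity
  have hK : K ≠ 0 := by
    obtain ⟨k, -⟩ := M.exists_p0_pos
    exact (k.pos).ne'
  have hK1 : (1 : ℝ) ≤ K := by exact_mod_cast Nat.one_le_iff_ne_zero.2 hK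
  have hw : ∀ z, M.weight y (M.meanLog q) (M.meanRate q) η z ≤ Real.exp (C * size y) := by
    intro z
    rw [← sum_one_add_abs_gap, Real.exp_sum]
    refine Finset.prod_le_prod (fun n _ => ?_) fun n _ => ?_
    · refine mul_nonneg (bMat_pos hβ hη _ _).le ?_
      split_ifs
      · exact M.p0_mem.1 _
      · exact (Real.exp_pos _).le
    · refine (mul_le_of_le_one_left ?_ ((hη.1 _ _).2.trans (by linarith))).trans ?_
      · split_ifs
        · exact M.p0_mem.1 _
        · exact (Real.exp_pos _).le
      · split_ifs
        · exact (M.p0_le_one _).trans (Real.one_le_exp (by positivity))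
        · refine Real.exp_le_exp.2 ?_
          set g := gMat η (z (pre n)) (z n) with hg
          have hgm : g ≤ gmax := (hη.2 _ _).2
          have h1 := (hM.meanLog_le h₀ hx q (z (pre n)) (z n)).trans (le_abs_self _)
          have h2 := hgm.trans (le_abs_self _)
          have h3 : -(M.meanRate q * Real.exp g * gap y n) ≤ x₁ * Real.exp gmax * |gap y n| := by
            calc _ ≤ |M.meanRate q * Real.exp g * gap y n| := neg_le_abs _
              _ = M.meanRate q * Real.exp g * |gap y n| := by
                  rw [abs_mul, abs_of_nonneg
                    (mul_nonneg (h₀.le.trans hrate.1) (Real.exp_pos _).le)]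
              _ ≤ _ := by
                  have := hrate.2
                  gcongr
          have h4 : 0 ≤ (|Real.log x₁| + |gmax|) * |gap y n| := by positivity
          have h5 : 0 ≤ x₁ * Real.exp gmax := by positivity
          calc _ ≤ |Real.log x₁| + |gmax| + x₁ * Real.exp gmax * |gap y n| := by linarith
            _ ≤ C * (1 + |gap y n|) := by rw [hC]; linarith
  have hsum : ∑ z, M.weight y (M.meanLog q) (M.meanRate q) η z ≤
      (K : ℝ) ^ y.1.1 * Real.exp (C * size y) := by
    refine (Finset.sum_le_sum fun z _ => hw z).trans_eq ?_
    simp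
  have hle := Real.log_le_log (M.sum_weight_pos y (M.meanLog q) (M.meanRate q)
    (bMat_pos hβ hη)) hsum
  rw [Real.log_mul (by positivity) (Real.exp_pos _).ne', Real.log_exp, Real.log_pow] at hle
  refine hle.trans ?_
  rw [add_mul, mul_comm (y.1.1 : ℝ)]
  have hsz : (y.1.1 : ℝ) ≤ size y := le_add_of_nonneg_right
    (Finset.sum_nonneg fun _ _ => abs_nonneg _)
  have := mul_le_mul_of_nonneg_left hsz (Real.log_nonneg hK1)
  linarith

lemma Model.CompactSupport.bddAbove (hM : M.CompactSupport) (hβ : 0 < β) (y : Obs W)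
    {η : Param K W} (hη : η ∈ paramSpace K W β gmin gmax) :
    BddAbove (Set.range fun q =>
      M.logPartition y (M.meanLog q) (M.meanRate q) η - M.divergence q) := by
  obtain ⟨x₀, x₁, h₀, -, hx⟩ := hM.exists_bounds
  refine ⟨(Real.log K + (|Real.log x₁| + |gmax| + x₁ * Real.exp gmax)) * size y, ?_⟩
  rintro _ ⟨q, rfl⟩
  have h1 := hM.logPartition_le hβ h₀ hx y q hη
  have h2 := hM.divergence_nonneg q
  exact (sub_le_self _ h2).trans h1

instance : Nonempty (VarParam K) :=
  ⟨⟨1, one_pos, 1, one_pos, 1, fun _ _ => one_pos, 1, fun _ _ => one_pos, 1, one_pos⟩⟩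

/-- The supremum over the laws of `Λ` and `ξ` of the optimal evidence lower bound, without the
contribution of the termination time. -/
noncomputable def Model.core (M : Model K) (y : Obs W) (η : Param K W) : ℝ :=
  ⨆ q, (M.logPartition y (M.meanLog q) (M.meanRate q) η - M.divergence q)

/-- The upper bound holds for every `q`. For the lower bound a single `q` suffices, with the
sequence constantly equal to a topic of positive initial probability. -/
lemma Model.CompactSupport.exists_abs_core_le (hM : M.CompactSupport) (W : ℕ) (hβ : 0 < β) :
    ∃ C, 0 ≤ C ∧ ∀ (y : Obs W), ∀ η ∈ paramSpace K W β gmin gmax,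
      |M.core y η| ≤ C * (1 + size y) := by
  obtain ⟨x₀, x₁, h₀, h₁, hx⟩ := hM.exists_bounds
  obtain ⟨k, hk⟩ := M.exists_p0_pos
  obtain ⟨q⟩ : Nonempty (VarParam K) := inferInstance
  have hrate := hM.meanRate_mem hx q
  have hx₁ : 0 ≤ x₁ := h₀.le.trans h₁
  have hK1 : (1 : ℝ) ≤ K := by exact_mod_cast Nat.one_le_iff_ne_zero.2 k.pos.ne'
  set C₁ := Real.log K + (|Real.log x₁| + |gmax| + x₁ * Real.exp gmax) with hC₁
  set C₂ := |Real.log β| + |Real.log (M.p0 k)| + |M.meanLog q k k| + |gmin| +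
    x₁ * Real.exp gmax with hC₂
  have hC₁0 : 0 ≤ C₁ := by have := Real.log_nonneg hK1; positivity
  have hC₂0 : 0 ≤ C₂ := by positivity
  have hD := hM.divergence_nonneg q
  refine ⟨C₁ + C₂ + M.divergence q, by positivity, fun y η hη => ?_⟩
  have hs := size_nonneg y
  have hbp := bMat_pos hβ hη
  rw [abs_le]
  constructor
  · have h1 : M.logWeight y (M.meanLog q) (M.meanRate q) (fun _ => k) η ≥ -(C₂ * size y) := by
      rw [← sum_one_add_abs_gap, ← Finset.sum_neg_distrib, Model.logWeight]
      refine Finset.sum_le_sum fun n _ => ?_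
      have hb : -|Real.log β| ≤ Real.log (bMat η k (y.1.2 n).1) :=
        (neg_abs_le _).trans (Real.log_le_log hβ (hη.1 _ _).1)
      have hgn : 0 ≤ C₂ * |gap y n| := by positivity
      split_ifs
      · have h2 := neg_abs_le (Real.log (M.p0 k))
        have h3 : 0 ≤ |M.meanLog q k k| + |gmin| + x₁ * Real.exp gmax := by positivity
        rw [mul_add, mul_one]
        linarith
      · have h2 : -|gmin| ≤ gMat η k k := (neg_abs_le _).trans (hη.2 k k).1
        have h3 := neg_abs_le (M.meanLog q k k)
        have h4 : M.meanRate q * gap y n * Real.exp (gMat η k k) ≤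
            x₁ * Real.exp gmax * |gap y n| := by
          calc _ ≤ |M.meanRate q * gap y n * Real.exp (gMat η k k)| := le_abs_self _
            _ = M.meanRate q * |gap y n| * Real.exp (gMat η k k) := by
                rw [abs_mul, abs_mul, abs_of_nonneg (h₀.le.trans hrate.1), Real.abs_exp]
            _ ≤ x₁ * |gap y n| * Real.exp gmax := by
                have := hrate.2
                have := (hη.2 k k).2
                gcongr
            _ = _ := by ring
        have h5 : 0 ≤ (|Real.log β| + |Real.log (M.p0 k)| + |M.meanLog q k k| + |gmin|) *
          |gap y n| := by positivity
        have h6 : 0 ≤ x₁ * Real.exp gmax := by positivity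
        have h7 := abs_nonneg (Real.log (M.p0 k))
        have h8 : C₂ * (1 + |gap y n|) = C₂ + (|Real.log β| + |Real.log (M.p0 k)| +
          |M.meanLog q k k| + |gmin|) * |gap y n| + x₁ * Real.exp gmax * |gap y n| := by
          rw [hC₂]; ring
        rw [h8]
        linarith
    have h2 : M.logWeight y (M.meanLog q) (M.meanRate q) (fun _ => k) η ≤
        M.logPartition y (M.meanLog q) (M.meanRate q) η := by
      rw [M.logPartition_eq _ _ _ hbp,
        Real.le_log_iff_exp_le (Finset.sum_pos (fun _ _ => Real.exp_pos _)
          (M.validSeqs_nonempty _))]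
      refine Finset.single_le_sum (f := fun z =>
        Real.exp (M.logWeight y (M.meanLog q) (M.meanRate q) z η))
        (fun _ _ => (Real.exp_pos _).le) ?_
      simp [Model.validSeqs, hk]
    have h3 := le_ciSup (hM.bddAbove hβ y hη) q
    have h4 : 0 ≤ C₁ * (1 + size y) + C₂ + M.divergence q * size y := by positivity
    rw [Model.core]
    linarith
  · refine ciSup_le fun q' => ?_
    have h1 := hM.logPartition_le hβ h₀ hx y q' hη
    have h2 := hM.divergence_nonneg q'
    have h4 : 0 ≤ C₁ + C₂ * (1 + size y) + M.divergence q * (1 + size y) := by positivity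
    linarith

lemma Model.CompactSupport.f_eq_core (hM : M.CompactSupport) (hβ : 0 < β) (y : Obs W)
    {η : Param K W} (hη : η ∈ paramSpace K W β gmin gmax) :
    M.f y η = if M.fτ y.2 = 0 then 0 else M.core y η + Real.log (M.fτ y.2) := by
  split_ifs with h
  · exact M.f_eq_zero y η h
  · exact M.f_eq hM y (bMat_pos hβ hη) h (hM.bddAbove hβ y hη)

/-- A supremum of semiconvex functions with a common constant is semiconvex, so neither smoothness
in η nor attainment of the optimum is needed. -/
lemma Model.CompactSupport.semiconvexLip_core (hM : M.CompactSupport) (hβ : 0 < β) {x₀ x₁ : ℝ}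
    (h₀ : 0 < x₀) (hx : M.suppξ ⊆ Set.Icc x₀ x₁) (y : Obs W) :
    SemiconvexLip (paramSpace K W β gmin gmax) (lipConst W β gmax x₁ * size y) (M.core y) := by
  refine SemiconvexLip.of_isLUB (ι := VarParam K) (g := fun q η =>
    M.logPartition y (M.meanLog q) (M.meanRate q) η + -M.divergence q)
    (convex_paramSpace K W β gmin gmax) (fun q => ?_) (fun q η hη => ?_) fun η hη ε hε => ?_
  · have := hM.meanRate_mem hx q
    exact (M.semiconvexLip_logPartition hβ y _ ⟨h₀.le.trans this.1, this.2⟩).add_const _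
  · exact le_ciSup (hM.bddAbove hβ y hη) q
  · obtain ⟨q, hq⟩ := exists_lt_of_lt_ciSup (sub_lt_self (M.core y η) hε)
    exact ⟨q, by linarith⟩

lemma Model.CompactSupport.semiconvexLip_f (hM : M.CompactSupport) (hβ : 0 < β) {x₀ x₁ : ℝ}
    (h₀ : 0 < x₀) (h₁ : x₀ ≤ x₁) (hx : M.suppξ ⊆ Set.Icc x₀ x₁) (y : Obs W) :
    SemiconvexLip (paramSpace K W β gmin gmax) (lipConst W β gmax x₁ * size y) (M.f y) := by
  by_cases h : M.fτ y.2 = 0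
  · refine ((SemiconvexLip.const _ 0).mono
      (mul_nonneg (lipConst_nonneg hβ (h₀.le.trans h₁)) (size_nonneg y))).congr
      (convex_paramSpace K W β gmin gmax) fun η hη => ?_
    rw [hM.f_eq_core hβ y hη, if_pos h]
  · refine ((hM.semiconvexLip_core hβ h₀ hx y).add_const (Real.log (M.fτ y.2))).congr
      (convex_paramSpace K W β gmin gmax) fun η hη => ?_
    rw [hM.f_eq_core hβ y hη, if_neg h]

end Sup

/-! ### Measurability in the observation. -/

section Measurability

variable {K W : ℕ} {M : Model K} {β gmin gmax : ℝ}

lemma measurable_sigma_iff {ι X : Type*} {α : ι → Type*} [∀ i, MeasurableSpace (α i)]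
    [MeasurableSpace X] {F : (Σ i, α i) → X} :
    Measurable F ↔ ∀ i, Measurable fun v => F ⟨i, v⟩ := by
  constructor
  · intro h i s hs
    exact (MeasurableSpace.measurableSet_iInf.1 (h hs)) i
  · intro h s hs
    exact MeasurableSpace.measurableSet_iInf.2 fun i => h i hs

lemma measurable_size : Measurable (size : Obs W → ℝ) := by
  have : Measurable fun v : Σ N : ℕ, Fin N → Fin (W + 1) × ℝ => size (v, (0 : ℝ)) := by
    rw [measurable_sigma_iff]
    intro N
    change Measurable fun v : Fin N → Fin (W + 1) × ℝ =>
      (N : ℝ) + ∑ n, |(v n).2 - (v (pre n)).2|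
    fun_prop
  exact this.comp measurable_fst

lemma Model.measurable_logPartition (M : Model K) (A : Fin K → Fin K → ℝ) (x : ℝ)
    (η : Param K W) : Measurable fun y : Obs W => M.logPartition y A x η := by
  have : Measurable fun v : Σ N : ℕ, Fin N → Fin (W + 1) × ℝ =>
      M.logPartition (v, (0 : ℝ)) A x η := by
    rw [measurable_sigma_iff]
    intro N
    change Measurable fun v : Fin N → Fin (W + 1) × ℝ => Real.log (∑ z : Fin N → Fin K,
      ∏ n, bMat η (z n) (v n).1 * if n.1 = 0 then M.p0 (z n)
        else Real.exp (A (z (pre n)) (z n) + gMat η (z (pre n)) (z n) -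
          x * Real.exp (gMat η (z (pre n)) (z n)) * ((v n).2 - (v (pre n)).2)))
    refine Real.measurable_log.comp (Finset.measurable_sum _ fun z _ =>
      Finset.measurable_prod _ fun n _ => ?_)
    refine Measurable.mul ?_ ?_
    · exact (measurable_of_countable (bMat η (z n))).comp (measurable_pi_apply n).fst
    · split_ifs
      · exact measurable_const
      · refine Real.measurable_exp.comp (measurable_const.sub (measurable_const.mul ?_))
        exact ((measurable_pi_apply n).snd).sub (measurable_pi_apply (pre n)).snd
  exact this.comp measurable_fst

lemma Model.continuous_logPartition (M : Model K) (y : Obs W) {η : Param K W}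
    (hη : ∀ k e, 0 < bMat η k e) :
    Continuous fun t : (Fin K → Fin K → ℝ) × ℝ => M.logPartition y t.1 t.2 η := by
  refine Continuous.log (continuous_finsetSum _ fun z _ => continuous_finsetProd _ fun n _ => ?_)
    fun t => (M.sum_weight_pos y t.1 t.2 hη).ne'
  refine continuous_const.mul ?_
  split_ifs
  · exact continuous_const
  · fun_prop

/-- The index `q` is replaced by the triple of mean logs, mean rate and divergence, which ranges
over a subset of a finite-dimensional space. The functional is continuous in the triple, so
separability makes the supremum countable without any continuity of the means in `q`. -/
lemma Model.CompactSupport.measurable_core (hM : M.CompactSupport) (hβ : 0 < β)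
    {η : Param K W} (hη : η ∈ paramSpace K W β gmin gmax) :
    Measurable fun y : Obs W => M.core y η := by
  set S : Set (((Fin K → Fin K → ℝ) × ℝ) × ℝ) :=
    Set.range fun q : VarParam K => ((M.meanLog q, M.meanRate q), M.divergence q) with hS
  have hne : Nonempty S := (Set.range_nonempty _).to_subtype
  have hcore : ∀ y : Obs W, M.core y η =
      ⨆ t : S, (M.logPartition y t.1.1.1 t.1.1.2 η - t.1.2) := by
    intro y
    rw [Model.core, ← (Set.rangeFactorization_surjective (f := fun q : VarParam K =>
      ((M.meanLog q, M.meanRate q), M.divergence q))).iSup_comp]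
    rfl
  simp only [hcore]
  refine measurable_iSup_of_continuous (fun t => ?_) (fun y => ?_) fun y => ?_
  · exact (M.measurable_logPartition _ _ η).sub measurable_const
  · exact (((M.continuous_logPartition y (bMat_pos hβ hη)).comp continuous_fst).sub
      continuous_snd).comp continuous_subtype_val
  · refine (hM.bddAbove hβ y hη).mono ?_
    rintro _ ⟨⟨_, q, rfl⟩, rfl⟩
    exact ⟨q, rfl⟩

lemma Model.CompactSupport.measurable_f (hM : M.CompactSupport) (hβ : 0 < β)
    {η : Param K W} (hη : η ∈ paramSpace K W β gmin gmax) :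
    Measurable fun y : Obs W => M.f y η := by
  simp only [fun y => hM.f_eq_core hβ y hη]
  refine Measurable.ite ?_ measurable_const ((hM.measurable_core hβ hη).add
    (Real.measurable_log.comp (M.fτ_meas.comp measurable_snd)))
  exact (M.fτ_meas.comp measurable_snd) (measurableSet_singleton 0)

end Measurability

end LTA


namespace LTA

/-! ### Marginals of the noise. -/

section Noise

variable {K W : ℕ} {M : Model K} {β gmin gmax : ℝ}

/-- The law of the termination time. -/
noncomputable def Model.tauLaw (M : Model K) : Measure ℝ :=
  volume.withDensity fun s => ENNReal.ofReal (M.fτ s)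

instance : IsProbabilityMeasure M.tauLaw :=
  ⟨by rw [Model.tauLaw, withDensity_apply _ MeasurableSet.univ, Measure.restrict_univ, M.fτ_mass]⟩

instance : IsProbabilityMeasure M.firstTime := M.firstTime_prob

/-- The law of the uniform and exponential variables driving the events. -/
noncomputable def driveLaw : Measure (ℕ → unitInterval × unitInterval × ℝ) :=
  Measure.infinitePi fun _ : ℕ =>
    (volume : Measure unitInterval).prod ((volume : Measure unitInterval).prod (expMeasure 1))

instance : IsProbabilityMeasure driveLaw := by unfold driveLaw; infer_instance

lemma Model.noise_eq (M : Model K) : M.noise = (M.dirLaw M.r).prod ((M.gamLaw M.a M.d).prod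
    (M.tauLaw.prod (M.firstTime.prod driveLaw))) := rfl

lemma Model.CompactSupport.measurePreserving_rate (hM : M.CompactSupport) :
    MeasurePreserving (fun x : Noise K => x.2.1) M.noise (M.gamLaw M.a M.d) := by
  have := M.isProbabilityMeasure_dirLaw M.r_pos
  have := hM.isProbabilityMeasure_gamLaw M.a M.d
  rw [M.noise_eq]
  exact measurePreserving_fst.comp measurePreserving_snd

lemma Model.CompactSupport.measurePreserving_tau (hM : M.CompactSupport) :
    MeasurePreserving (fun x : Noise K => x.2.2.1) M.noise M.tauLaw := by
  have := M.isProbabilityMeasure_dirLaw M.r_pos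
  have := hM.isProbabilityMeasure_gamLaw M.a M.d
  rw [M.noise_eq]
  exact measurePreserving_fst.comp (measurePreserving_snd.comp measurePreserving_snd)

lemma Model.CompactSupport.measurePreserving_firstTime (hM : M.CompactSupport) :
    MeasurePreserving (fun x : Noise K => x.2.2.2.1) M.noise M.firstTime := by
  have := M.isProbabilityMeasure_dirLaw M.r_pos
  have := hM.isProbabilityMeasure_gamLaw M.a M.d
  rw [M.noise_eq]
  exact measurePreserving_fst.comp
    (measurePreserving_snd.comp (measurePreserving_snd.comp measurePreserving_snd))

lemma Model.CompactSupport.measurePreserving_drive (hM : M.CompactSupport) :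
    MeasurePreserving (fun x : Noise K => x.2.2.2.2) M.noise driveLaw := by
  have := M.isProbabilityMeasure_dirLaw M.r_pos
  have := hM.isProbabilityMeasure_gamLaw M.a M.d
  rw [M.noise_eq]
  exact measurePreserving_snd.comp
    (measurePreserving_snd.comp (measurePreserving_snd.comp measurePreserving_snd))

lemma measurePreserving_exp_drive (n : ℕ) :
    MeasurePreserving (fun ω : ℕ → unitInterval × unitInterval × ℝ => (ω n).2.2) driveLaw
      (expMeasure 1) :=
  (measurePreserving_snd.comp measurePreserving_snd).comp (measurePreserving_eval_infinitePi _ n)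

lemma Model.ae_tauLaw (M : Model K) : ∀ᵐ s ∂M.tauLaw, M.fτ s ≠ 0 := by
  rw [Model.tauLaw, ae_withDensity_iff M.fτ_meas.ennreal_ofReal]
  filter_upwards with s hs h
  exact hs (by simp [h])

lemma Model.CompactSupport.ae_noise (hM : M.CompactSupport) :
    ∀ᵐ x ∂M.noise, x.2.1 ∈ M.suppξ ∧ M.fτ x.2.2.1 ≠ 0 ∧ 0 < x.2.2.2.1 ∧
      ∀ n, 0 < (x.2.2.2.2 n).2.2 := by
  have h1 := hM.measurePreserving_rate.quasiMeasurePreserving.ae (M.ae_gamLaw M.a M.d)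
  have h2 := hM.measurePreserving_tau.quasiMeasurePreserving.ae M.ae_tauLaw
  have h3 := hM.measurePreserving_firstTime.quasiMeasurePreserving.ae M.firstTime_pos
  have h4 : ∀ᵐ x ∂M.noise, ∀ n, 0 < (x.2.2.2.2 n).2.2 := ae_all_iff.2 fun n =>
    ((measurePreserving_exp_drive n).comp hM.measurePreserving_drive).quasiMeasurePreserving.ae
      ae_expMeasure_pos
  filter_upwards [h1, h2, h3, h4] with x h1 h2 h3 h4
  exact ⟨h1, h2, h3, h4⟩

lemma Model.integrable_log_tauLaw (M : Model K) :
    Integrable (fun s => Real.log (M.fτ s)) M.tauLaw := by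
  rw [Model.tauLaw, integrable_withDensity_iff_integrable_smul'
    M.fτ_meas.ennreal_ofReal (by simp)]
  refine M.fτ_log.congr (Eventually.of_forall fun s => ?_)
  simp [ENNReal.toReal_ofReal (M.fτ_nonneg s)]

end Noise

/-! ### Second moment of the size of an observation. -/

section Moments

/-- Strict inequality is all that matters: it is the ratio of the geometric series that bounds the
number of events. -/
lemma lintegral_exp_neg_lt_one :
    ∫⁻ t, ENNReal.ofReal (Real.exp (-t)) ∂(expMeasure 1) < 1 := by
  have hle : ∫⁻ t, ENNReal.ofReal (Real.exp (-t)) ∂(expMeasure 1) ≤ ∫⁻ _, 1 ∂(expMeasure 1) := by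
    refine lintegral_mono_ae (ae_expMeasure_pos.mono fun t ht => ?_)
    rw [ENNReal.ofReal_le_one, Real.exp_le_one_iff]
    linarith
  have hone : ∫⁻ _ : ℝ, 1 ∂(expMeasure 1) = 1 := by simp
  rw [hone] at hle
  conv_rhs => rw [← hone]
  refine lintegral_strict_mono (IsProbabilityMeasure.ne_zero _) aemeasurable_const
    (ne_top_of_le_ne_top ENNReal.one_ne_top hle) (ae_expMeasure_pos.mono fun t ht => ?_)
  rw [ENNReal.ofReal_lt_one, Real.exp_lt_one_iff]
  linarith

/-- The index is shifted by one because the first event has its own law and does not use the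
exponential variable of index `0`. -/
lemma lintegral_exp_neg_sum (n : ℕ) :
    ∫⁻ ω, ENNReal.ofReal (Real.exp (-∑ i ∈ Finset.range n, (ω (i + 1)).2.2)) ∂driveLaw =
      (∫⁻ t, ENNReal.ofReal (Real.exp (-t)) ∂(expMeasure 1)) ^ n := by
  have hm : ∀ _ : ℕ, Measurable fun p : unitInterval × unitInterval × ℝ =>
      ENNReal.ofReal (Real.exp (-p.2.2)) := fun _ => by fun_prop
  have hind : iIndepFun (fun (i : ℕ) (ω : ℕ → unitInterval × unitInterval × ℝ) =>
      ENNReal.ofReal (Real.exp (-(ω i).2.2))) driveLaw := iIndepFun_infinitePi hm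
  have h := lintegral_prod_eq_prod_lintegral_of_indepFun
    ((Finset.range n).map (addRightEmbedding 1)) _ hind fun i =>
      (hm i).comp (measurable_pi_apply i)
  simp only [Finset.prod_map, addRightEmbedding_apply] at h
  have h2 : ∀ i : ℕ, ∫⁻ ω, ENNReal.ofReal (Real.exp (-(ω i).2.2)) ∂driveLaw =
      ∫⁻ t, ENNReal.ofReal (Real.exp (-t)) ∂(expMeasure 1) := fun i =>
    (measurePreserving_exp_drive i).lintegral_comp
      (f := fun t => ENNReal.ofReal (Real.exp (-t))) (by fun_prop)
  simp only [h2, Finset.prod_const, Finset.card_range] at h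
  rw [← h]
  refine lintegral_congr fun ω => ?_
  rw [← Finset.sum_neg_distrib, Real.exp_sum,
    ENNReal.ofReal_prod_of_nonneg fun i _ => (Real.exp_pos _).le]

lemma tsum_odd_mul_pow_ne_top {ρ : ENNReal} (hρ : ρ < 1) (c : ℝ) :
    ∑' n : ℕ, ENNReal.ofReal ((2 * n + 1) * Real.exp c) * ρ ^ n ≠ ⊤ := by
  have hρt : ρ ≠ ⊤ := hρ.ne_top
  have hr : ‖ρ.toReal‖ < 1 := by
    rw [Real.norm_of_nonneg ENNReal.toReal_nonneg]
    exact (ENNReal.toReal_lt_toReal hρt ENNReal.one_ne_top).2 hρ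
  have hs : Summable fun n : ℕ => (2 * n + 1) * Real.exp c * ρ.toReal ^ n := by
    have h1 := (summable_pow_mul_geometric_of_norm_lt_one 1 hr).mul_left (2 * Real.exp c)
    have h0 := (summable_pow_mul_geometric_of_norm_lt_one 0 hr).mul_left (Real.exp c)
    refine (h1.add h0).congr fun n => ?_
    simp only [pow_one, pow_zero]
    ring
  convert hs.tsum_ofReal_ne_top using 3 with n
  rw [ENNReal.ofReal_mul (p := (2 * n + 1) * Real.exp c) (by positivity),
    ENNReal.ofReal_pow ENNReal.toReal_nonneg, ENNReal.ofReal_toReal hρt]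

variable {K W : ℕ} {M : Model K} {β gmin gmax : ℝ}

lemma le_eventTime {η : Param K W} (hg : ∀ k' k, gMat η k' k ≤ gmax) {ξ x₁ t₀ : ℝ} (hξ : 0 < ξ)
    (hξ₁ : ξ ≤ x₁) (z : ℕ → Fin K) {w : ℕ → ℝ} (hw : ∀ n, 0 < w n) (n : ℕ) :
    t₀ + (∑ i ∈ Finset.range n, w (i + 1)) / (x₁ * Real.exp gmax) ≤
      eventTime η ξ t₀ z w n := by
  induction n with
  | zero => simp [eventTime]
  | succ n ih =>
    rw [eventTime, Finset.sum_range_succ, add_div, ← add_assoc]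
    refine add_le_add ih ?_
    have h1 := hg (z n) (z (n + 1))
    have h2 : ξ * Real.exp (gMat η (z n) (z (n + 1))) ≤ x₁ * Real.exp gmax := by
      have := hξ.le.trans hξ₁
      gcongr
    exact div_le_div_of_nonneg_left (hw _).le (by positivity) h2

lemma eventTime_mono {η : Param K W} {ξ t₀ : ℝ} (hξ : 0 < ξ) (z : ℕ → Fin K) {w : ℕ → ℝ}
    (hw : ∀ n, 0 < w n) : Monotone (eventTime η ξ t₀ z w) := by
  refine monotone_nat_of_le_succ fun n => ?_
  rw [eventTime]
  have := div_pos (hw (n + 1)) (mul_pos hξ (Real.exp_pos (gMat η (z n) (z (n + 1)))))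
  linarith

/-- Valid also if no time exceeds `τ`: the infimum of the empty set is then `0`, and no index lies
below it. -/
lemma le_of_lt_card_observe {e : ℕ → Fin (W + 1)} {t : ℕ → ℝ} {τ : ℝ} {n : ℕ}
    (hn : n < (observe e t τ).1.1) : t n ≤ τ :=
  not_lt.1 (Nat.notMem_of_lt_sInf hn)

lemma size_observe_le {e : ℕ → Fin (W + 1)} {t : ℕ → ℝ} {τ T : ℝ} (ht : Monotone t)
    (h0 : 0 ≤ t 0) (hτ : τ ≤ T) :
    size (observe e t τ) ≤ (1 + T) * (observe e t τ).1.1 := by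
  have hgap : ∀ n, |gap (observe e t τ) n| ≤ T := by
    intro n
    change |t n - t (pre n)| ≤ T
    have h1 : t (pre n).1 ≤ t n.1 := ht (Nat.sub_le _ _)
    have h2 : 0 ≤ t (pre n).1 := h0.trans (ht (Nat.zero_le _))
    have h3 : t n.1 ≤ τ := le_of_lt_card_observe n.2
    rw [abs_of_nonneg (by linarith)]
    linarith
  have hsum := Finset.sum_le_sum fun n (_ : n ∈ Finset.univ) => hgap n
  rw [size]
  simp only [Finset.sum_const, Finset.card_univ, Fintype.card_fin, nsmul_eq_mul] at hsum
  linarith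

/-- Writes `N²` as the sum of the first `N` odd numbers, so that a second moment reduces to the
events `n < N`. -/
lemma sq_le_tsum {N : ℕ} {a : ℕ → ENNReal}
    (ha : ∀ n < N, ENNReal.ofReal (2 * n + 1) ≤ a n) :
    ENNReal.ofReal ((N : ℝ) ^ 2) ≤ ∑' n, a n := by
  have h : ((N : ℝ) ^ 2) = ∑ n ∈ Finset.range N, (2 * (n : ℝ) + 1) := by
    clear ha
    induction N with
    | zero => simp
    | succ N ih => rw [Finset.sum_range_succ, ← ih]; push_cast; ring
  rw [h, ENNReal.ofReal_sum_of_nonneg fun n _ => by positivity]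
  exact (Finset.sum_le_sum fun n hn => ha n (Finset.mem_range.1 hn)).trans
    (ENNReal.sum_le_tsum _)

variable [NeZero K]

/-- Rates are at most `x₁ exp gmax`, so `n < N` forces the first `n` driving exponentials to sum to
at most `c`. The indicator of `n < N` is thus below `exp (c - sum)`, of mean `exp c * ρ ^ n`, and
the series with weights `2 n + 1` converges. The size is at most `1 + T` times `N`. -/
lemma Model.CompactSupport.exists_lintegral_size_le (hM : M.CompactSupport) {ηstar : Param K W}
    (hη : ηstar ∈ paramSpace K W β gmin gmax) :
    ∫⁻ x, ENNReal.ofReal (size (M.generate ηstar x) ^ 2) ∂M.noise ≠ ⊤ := by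
  obtain ⟨x₀, x₁, h₀, h₁, hx⟩ := hM.exists_bounds
  obtain ⟨T, hT⟩ := M.fτ_bdd
  set c := T * (x₁ * Real.exp gmax) with hc
  have hc0 : 0 < x₁ * Real.exp gmax := mul_pos (h₀.trans_le h₁) (Real.exp_pos _)
  set ρ := ∫⁻ t, ENNReal.ofReal (Real.exp (-t)) ∂(expMeasure 1) with hρ
  have hm : ∀ n : ℕ, Measurable fun ω : ℕ → unitInterval × unitInterval × ℝ =>
      ENNReal.ofReal (Real.exp (-∑ i ∈ Finset.range n, (ω (i + 1)).2.2)) := fun n => by fun_prop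
  have hbound : ∀ᵐ x ∂M.noise, ENNReal.ofReal (size (M.generate ηstar x) ^ 2) ≤
      ENNReal.ofReal ((1 + T) ^ 2) * ∑' n : ℕ, ENNReal.ofReal ((2 * n + 1) * Real.exp c) *
        ENNReal.ofReal (Real.exp (-∑ i ∈ Finset.range n, (x.2.2.2.2 (i + 1)).2.2)) := by
    filter_upwards [hM.ae_noise] with x hx'
    obtain ⟨hξ, hτ, ht₀, hw⟩ := hx'
    have hξ0 : 0 < x.2.1 := h₀.trans_le (hx hξ).1
    set z := M.topic x.1 fun n => ((x.2.2.2.2 n).1 : ℝ)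
    set t := eventTime ηstar x.2.1 x.2.2.2.1 z fun n => (x.2.2.2.2 n).2.2 with ht
    set e : ℕ → Fin (W + 1) := fun n => sample (bMat ηstar (z n)) ((x.2.2.2.2 n).2.1 : ℝ)
    have hgen : M.generate ηstar x = observe e t x.2.2.1 := rfl
    rw [hgen]
    have hsz := size_observe_le (e := e) (eventTime_mono (η := ηstar) (t₀ := x.2.2.2.1) hξ0 z hw)
      ht₀.le (hT _ hτ).2
    rw [← ht] at hsz
    have h2 := pow_le_pow_left₀ (size_nonneg _) hsz 2
    rw [mul_pow] at h2
    refine (ENNReal.ofReal_le_ofReal h2).trans ?_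
    rw [ENNReal.ofReal_mul (sq_nonneg _)]
    refine mul_le_mul_right (sq_le_tsum fun n hn => ?_) _
    rw [← ENNReal.ofReal_mul (by positivity), mul_assoc, ← Real.exp_add]
    refine ENNReal.ofReal_le_ofReal (le_mul_of_one_le_right (by positivity) ?_)
    refine Real.one_le_exp ?_
    have h3 : t n ≤ x.2.2.1 := le_of_lt_card_observe hn
    have h4 := le_eventTime (gmax := gmax) (η := ηstar) (fun k' k => (hη.2 k' k).2) (t₀ := x.2.2.2.1)
      hξ0 (hx hξ).2 z hw n
    have h5 := (hT _ hτ).2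
    have h6 : (∑ i ∈ Finset.range n, (x.2.2.2.2 (i + 1)).2.2) / (x₁ * Real.exp gmax) ≤ T := by
      linarith
    rw [div_le_iff₀ hc0] at h6
    linarith
  refine ne_top_of_le_ne_top ?_ (lintegral_mono_ae hbound)
  have hm' : ∀ n : ℕ, Measurable fun x : Noise K =>
      ENNReal.ofReal (Real.exp (-∑ i ∈ Finset.range n, (x.2.2.2.2 (i + 1)).2.2)) := fun n =>
    (hm n).comp hM.measurePreserving_drive.measurable
  rw [lintegral_const_mul _ (Measurable.tsum fun n => (hm' n).const_mul _),
    lintegral_tsum fun n => ((hm' n).const_mul _).aemeasurable]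
  refine ENNReal.mul_ne_top ENNReal.ofReal_ne_top ?_
  have hterm : ∀ n : ℕ, ∫⁻ x : Noise K, ENNReal.ofReal ((2 * n + 1) * Real.exp c) *
        ENNReal.ofReal (Real.exp (-∑ i ∈ Finset.range n, (x.2.2.2.2 (i + 1)).2.2)) ∂M.noise =
      ENNReal.ofReal ((2 * n + 1) * Real.exp c) * ρ ^ n := by
    intro n
    rw [lintegral_const_mul _ (hm' n), hM.measurePreserving_drive.lintegral_comp (hm n),
      lintegral_exp_neg_sum]
  simp only [hterm]
  exact tsum_odd_mul_pow_ne_top lintegral_exp_neg_lt_one c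

lemma Model.CompactSupport.memLp_size (hM : M.CompactSupport) {ηstar : Param K W}
    (hη : ηstar ∈ paramSpace K W β gmin gmax) (hgen : AEMeasurable (M.generate ηstar) M.noise) :
    MemLp size 2 (M.law ηstar) := by
  rw [memLp_two_iff_integrable_sq measurable_size.aestronglyMeasurable, Model.law,
    integrable_map_measure (measurable_size.pow_const 2).aestronglyMeasurable hgen]
  refine ⟨((measurable_size.pow_const 2).comp_aemeasurable hgen).aestronglyMeasurable, ?_⟩
  rw [hasFiniteIntegral_iff_ofReal (f := (fun y : Obs W => size y ^ 2) ∘ M.generate ηstar)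
    (Eventually.of_forall fun x => sq_nonneg _)]
  exact (hM.exists_lintegral_size_le hη).lt_top

lemma Model.CompactSupport.integrable_log_fτ (hM : M.CompactSupport) {ηstar : Param K W}
    (hgen : AEMeasurable (M.generate ηstar) M.noise) :
    Integrable (fun y : Obs W => Real.log (M.fτ y.2)) (M.law ηstar) := by
  have hm : Measurable fun y : Obs W => Real.log (M.fτ y.2) :=
    Real.measurable_log.comp (M.fτ_meas.comp measurable_snd)
  rw [Model.law, integrable_map_measure hm.aestronglyMeasurable hgen]
  exact hM.measurePreserving_tau.integrable_comp_of_integrable M.integrable_log_tauLaw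

end Moments

end LTA


namespace LTA

/-! ### The evidence lower bound as a semiconvex criterion function. -/

section Criterion

lemma SemiconvexCriterion.continuousOn {𝒴 E : Type*} [MeasurableSpace 𝒴] [NormedAddCommGroup E]
    [InnerProductSpace ℝ E] {μ : Measure 𝒴} {f : 𝒴 → E → ℝ} {Θ : Set E} {L : 𝒴 → ℝ}
    (h : SemiconvexCriterion μ f Θ L) (y : 𝒴) : ContinuousOn (f y) Θ := by
  refine LipschitzOnWith.continuousOn (K := (L y).toNNReal) ?_
  refine LipschitzOnWith.of_dist_le_mul fun η hη η' hη' => ?_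
  rw [Real.dist_eq, dist_eq_norm, Real.coe_toNNReal _ (h.nonneg y)]
  exact h.lip y η hη η' hη'

variable {K W : ℕ} [NeZero K] {M : Model K} {β gmin gmax : ℝ}

/-- The evidence lower bound is a Lipschitz semiconvex criterion function under the true law. -/
lemma Model.CompactSupport.exists_semiconvexCriterion (hM : M.CompactSupport) (hβ : 0 < β)
    {ηstar : Param K W} (hη : ηstar ∈ paramSpace K W β gmin gmax)
    [IsProbabilityMeasure (M.law ηstar)] :
    ∃ L, SemiconvexCriterion (M.law ηstar) M.f (paramSpace K W β gmin gmax) L := by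
  -- The image of a measure under a map that is not almost everywhere measurable is zero by
  -- convention, so a probability law forces measurability.
  have hgen : AEMeasurable (M.generate ηstar) M.noise := by
    by_contra h
    exact IsProbabilityMeasure.ne_zero (M.law ηstar) (Measure.map_of_not_aemeasurable h)
  obtain ⟨x₀, x₁, h₀, h₁, hx⟩ := hM.exists_bounds
  have hsize := hM.memLp_size hη hgen
  refine ⟨fun y => lipConst W β gmax x₁ * size y, fun η h => hM.measurable_f hβ h, fun η h => ?_,
    hsize.const_mul _,
    fun y => mul_nonneg (lipConst_nonneg hβ (h₀.le.trans h₁)) (size_nonneg y),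
    fun y => (hM.semiconvexLip_f hβ h₀ h₁ hx y).lip,
    fun y => (hM.semiconvexLip_f hβ h₀ h₁ hx y).strongConvexOn (convex_paramSpace _ _ _ _ _)⟩
  obtain ⟨C, -, hC⟩ := hM.exists_abs_core_le (gmin := gmin) (gmax := gmax) W hβ
  have hb : Integrable (fun y : Obs W => C * (1 + size y) + |Real.log (M.fτ y.2)|)
      (M.law ηstar) :=
    (((integrable_const 1).add (hsize.integrable (by norm_num))).const_mul C).add
      (hM.integrable_log_fτ hgen).abs
  refine hb.mono' (hM.measurable_f hβ h).aestronglyMeasurable (Eventually.of_forall fun y => ?_)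
  have h2 := hC y η h
  rw [hM.f_eq_core hβ y h, Real.norm_eq_abs]
  split_ifs with h3
  · rw [abs_zero]
    exact add_nonneg ((abs_nonneg _).trans h2) (abs_nonneg _)
  · exact (abs_add_le _ _).trans (add_le_add h2 le_rfl)

end Criterion

end LTA

/-! ### The main theorem. -/

theorem theorem2 {K W : ℕ} [NeZero K] (M : LTA.Model K)
    -- compact parameter space
    (β gmin gmax : ℝ) (hβ : 0 < β)
    (ηstar : LTA.Param K W) (hstar : ηstar ∈ LTA.paramSpace K W β gmin gmax)
    -- compactly supported priors
    (hsupp : M.CompactSupport)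
    -- `ηb` is a pseudo-true parameter: it maximises the expected ELBO
    (ηb : LTA.Param K W) (hmax : IsMaxOn (M.EL ηstar) (LTA.paramSpace K W β gmin gmax) ηb)
    (hint : ηb ∈ interior (LTA.paramSpace K W β gmin gmax))
    -- an i.i.d. sample from the true law
    {Ω : Type*} [MeasurableSpace Ω] (P : Measure Ω) [IsProbabilityMeasure P]
    (Y : ℕ → Ω → LTA.Obs W) (hindep : iIndepFun Y P)
    (hlaw : ∀ i, HasLaw (Y i) (M.law ηstar) P) :
    -- where `f` is smooth, `A₁` is the expected Hessian of `f`
    (M.SmoothDominated ηstar ηb →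
      ContDiffAt ℝ 2 (M.EL ηstar) ηb ∧ M.A₁ ηstar ηb = M.expectedHess ηstar ηb) ∧
    (M.LocallyIdentifiable ηstar ηb →
      (∀ᵐ y ∂(M.law ηstar), DifferentiableAt ℝ (M.f y) ηb) ∧
      (∃ U ∈ 𝓝 ηb, IsCompact U ∧ U ⊆ LTA.paramSpace K W β gmin gmax ∧
        ∀ η ∈ U, η ≠ ηb → M.EL ηstar η < M.EL ηstar ηb) ∧
      ∀ U ∈ 𝓝 ηb, IsCompact U → U ⊆ LTA.paramSpace K W β gmin gmax →
        (∀ η ∈ U, η ≠ ηb → M.EL ηstar η < M.EL ηstar ηb) →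
        -- there are measurable maximisers over `U` of the ELBO of the sample
        (∃ est : ∀ m : ℕ, (Fin m → LTA.Obs W) → LTA.Param K W,
          ∀ m, Measurable (est m) ∧
            ∀ y, est m y ∈ U ∧ IsMaxOn (M.sampleEL y) U (est m y)) ∧
        -- and all of them are consistent and asymptotically normal
        ∀ est : ∀ m : ℕ, (Fin m → LTA.Obs W) → LTA.Param K W,
          (∀ m, Measurable (est m) ∧
            ∀ y, est m y ∈ U ∧ IsMaxOn (M.sampleEL y) U (est m y)) →
          TendstoInMeasure P (fun m ω => est m fun i => Y i ω) atTop (fun _ => ηb) ∧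
          TendstoInDistribution
            (fun (m : ℕ) ω => √(m : ℝ) • ((est m fun i => Y i ω) - ηb)) atTop
            (id : LTA.Param K W → LTA.Param K W) (fun _ => P)
            (multivariateGaussian 0
              ((M.A₁ ηstar ηb)⁻¹ * M.A₂ ηstar ηb * (M.A₁ ηstar ηb)⁻¹))) := by
  -- Inherited from `P` through the law of `Y 0`; it also carries the measurability of the
  -- generating map.
  have hprob : IsProbabilityMeasure (M.law ηstar) :=
    (hlaw 0).isProbabilityMeasure_iff.1 inferInstance
  obtain ⟨L, hcrit⟩ := hsupp.exists_semiconvexCriterion hβ hstar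
  refine ⟨fun ⟨U, hU, h, hh, hd⟩ => hcrit.contDiffAt_and_hess_eq hint hU hh hd,
    fun ⟨hC2, hA₁, _⟩ => ⟨hcrit.ae_differentiableAt hint (hC2.differentiableAt (by simp)),
      LTA.SemiconvexCriterion.exists_isCompact_lt (mem_interior_iff_mem_nhds.1 hint) hmax hC2 hA₁,
      fun U hU hUc hUΘ hlt => ⟨?_, fun est hest => ?_⟩⟩⟩
  · have hsel : ∀ m : ℕ, ∃ s : (Fin m → LTA.Obs W) → LTA.Param K W, Measurable s ∧
        ∀ y, s y ∈ U ∧ IsMaxOn (M.sampleEL y) U (s y) := fun m =>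
      LTA.exists_measurable_isMaxOn hUc ⟨ηb, mem_of_mem_nhds hU⟩ (g := fun y => M.sampleEL y)
        (fun η hη => Finset.measurable_sum _ fun i _ =>
          (hcrit.measurable η (hUΘ hη)).comp (measurable_pi_apply i))
        fun y => continuousOn_finsetSum _ fun i _ => hcrit.continuousOn (y i) |>.mono hUΘ
    choose est hest using hsel
    exact ⟨est, hest⟩
  · have hmem : ∀ m ω, (est m fun i => Y i ω) ∈ U ∧
        IsMaxOn (fun η => ∑ i ∈ Finset.range m, M.f (Y i ω) η) U (est m fun i => Y i ω) := by
      intro m ω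
      have h := (hest m).2 fun i => Y i ω
      refine ⟨h.1, ?_⟩
      have heq : (fun η => ∑ i ∈ Finset.range m, M.f (Y i ω) η) =
          M.sampleEL fun i : Fin m => Y i ω := by
        funext η
        exact Finset.sum_range fun i => M.f (Y i ω) η
      rw [heq]
      exact h.2
    have hmeas : ∀ m, AEMeasurable (fun ω => est m fun i => Y i ω) P := fun m =>
      (hest m).1.comp_aemeasurable (aemeasurable_pi_lambda _ fun i => (hlaw i).aemeasurable)
    exact ⟨tendstoInMeasure_iff_norm.2 fun δ hδ => hcrit.tendsto_measure_norm_sub_ge hindep hlaw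
        hUc hUΘ (mem_of_mem_nhds hU) hlt hmem hδ,
      hcrit.tendstoInDistribution_est hindep hlaw hUc hUΘ hU hlt hC2 hA₁ hmeas hmem⟩
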